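/- **Setting.** Let $\mathcal L$ be a language with unary symbols $U_i$ ($i<k^{u}$) and binary symbols $R_q$ ($q<k$, $k\ge 1$), and let $\mathrm{Flip}\colon k\to k$ be an involution with $\mathrm{Flip}(0)=0$. In an $\mathcal L$-structure every point satisfies exactly one $U_i$ (write $U(a)=i$), every pair of distinct points satisfies exactly one $R_q$ (write $R(a,b)=q$), no $R_q(a,a)$ holds, and $R(b,a)=\mathrm{Flip}(R(a,b))$. $R_0$ means "no relation"; a structure is irreducible if $R(a,b)\ne 0$ for all $a\ne b$. Let $\mathcal F$ be a finite set of finite irreducible $\mathcal L$-structures with at least two points each, and $\mathcal K=\mathrm{Forb}(\mathcal F)$ the class of finite $\mathcal L$-structures embedding no member of $\mathcal F$. Assume that every $i<k^u$ is non-degenerate: some two-point structure in $\mathcal K$ has a point with $U=i$ and a non-zero relation between its points. An enumerated structure has underlying set a natural number or $\omega$; $\mathbf A_m$ is the structure induced on $m=\{0,\dots,m-1\}$. An ordered embedding is an increasing embedding of enumerated structures. Let $\mathbf K$ be a Fraïssé limit of $\mathcal K$ with underlying set $\omega$ that is *left dense*: for every enumerated $\mathbf A\in\mathcal K$ with $|\mathbf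 A|=m+1$ and $\mathbf A_m=\mathbf K_m$ there is an ordered embedding $f\colon\mathbf A\to\mathbf K$ which is the identity on $m$ and has $R(f(m),r)=0$ for $m\le r<f(m)$. **Tree.** $T(n)=k^u\times k^n$ and $T=\bigcup_nT(n)$; $t=(t^u,t^b)\in T(n)$ has length $\ell(t)=n$, we write $t(m)=t^b(m)$, $t^\frown q$ for the immediate successor with last value $q$, and $t|_m$ for the restriction to $m\le n$; $\sqsubseteq$ is the initial segment relation, and $\wedge$ is the longest common initial segment. Each $T(n)$ is ordered lexicographically (unary part first). The coding node of $a\in\mathbf K$ is $c(a)\in T(a)$ with $c(a)^u=U(a)$ and $c(a)(x)=R(a,x)$. For $A\subseteq\mathbf K$ put $c[A]|_m=\{c(a)|_m: a\in A, a\ge m\}$, and $\mathrm{CT}(m)=c[\mathbf K]|_m$. Level sets are always enumerated in increasing lexicographic order, and $S^u$ is the sequence of unary parts of $S$ in that order. Write $\emptyset_i=(i,\emptyset)$. **Ages.** An $\mathcal L_d$-structure is like an $\mathcal L$-structure but with labels $V\in\{0,\dots,d-1\}$ in place of the unary symbols. A gluing of rank $d$ is $\gamma=(\rho,\eta,\mathbf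 I)$ with $\rho\colon d\to k^u$ (its sort), $\mathbf I\in\mathcal K$ enumerated of size $n$ and $\eta\colon d\times n\to k$. For an $\mathcal L_d$-structure $\mathbf B$, $\mathbf B[\gamma]$ is the $\mathcal L$-structure on the disjoint union of $\mathbf I$ and $\mathbf B$ with $\mathbf I$ and the binary part of $\mathbf B$ induced, $U(b)=\rho(V(b))$ and $R(b,x)=\eta(V(b),x)$ for $b\in\mathbf B$, $x\in\mathbf I$. Put $\mathcal K(\gamma)=\{\mathbf B\text{ finite}:\mathbf B[\gamma]\in\mathcal K\}$. For $S=\{s_0<\dots<s_{d-1}\}\subseteq T(n)$ put $\mathcal K(S)=\mathcal K(S^u,(i,m)\mapsto s_i(m),\mathbf K_n)$. For $\rho\colon d\to k^u$ let $P(\rho)=\{\mathcal K(S): S\subseteq\mathrm{CT}(n)\text{ for some }n,\ S^u=\rho\}$, ordered by inclusion; $P_i=P(\rho)$ for $\rho\colon 1\to k^u$ with value $i$, and $P_i^{\min}=\bigcap P_i$. For $e\colon d_0\to d$ and a class $\mathcal A$ of $\mathcal L_d$-structures, $\mathcal A^e$ is the class of $\mathcal L_{d_0}$-structures that belong to $\mathcal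 A$ after relabelling by $V\mapsto e(V)$. $\iota_j\colon1\to d$ has value $j$, and $\epsilon_{j,d}\colon d-1\to d$ is the increasing injection omitting $j$. **Age changes and causes.** $\mathrm{Con}(\rho)$ is the set of pairs $(\mathcal A,\mathcal B)$ in $P(\rho)$ with $\mathcal B\subsetneq\mathcal A$ and nothing of $P(\rho)$ strictly between. $\mathrm{ECon}(\rho)$ consists of those with $\mathcal A^e=\mathcal B^e$ for all increasing $e\colon d_0\to d$ with $d_0<d$. $\mathrm{Spec}(\mathcal A)$, for $\mathcal A\in P(\rho)$, is the set of gluings $\gamma=(\rho,\eta,\mathbf J)$ with $\mathcal A\subseteq\mathcal K(\gamma)$ and $\mathbf J\in\mathcal K$ embeddable in a member of $\mathcal F$. For $(\mathcal A,\mathcal B)\in\mathrm{ECon}(\rho)$, $\mathrm{Cause}(\mathcal A,\mathcal B)$ is a chosen element of $\mathrm{Spec}(\mathcal B)\setminus\mathrm{Spec}(\mathcal A)$ of least size. For $(\mathcal A,\mathcal B)\in\mathrm{Con}(\rho)$ let $e$ be the increasing injection with $(\mathcal A^e,\mathcal B^e)\in\mathrm{ECon}(\rho\circ e)$; if $\mathrm{Cause}(\mathcal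 A^e,\mathcal B^e)=(\rho\circ e,\eta,\mathbf J)$, then $\mathrm{Cause}(\mathcal A,\mathcal B)=(\rho,\eta',\mathbf J)$ with $\eta'(e(i),x)=\eta(i,x)$ and $\eta'=0$ on labels outside the range of $e$. **Free relations and paths.** $\gamma\langle i,q,j\rangle$ is the rank-one gluing of sort $i$ attaching by $q$ to a single point with $U=j$. $(q,j)$ is a free relation for $i$ if $q\ne0$ and $\mathcal K(\gamma\langle i,q,j\rangle)=\mathcal K(\emptyset_i)$. $\mathsf{Free}$ is the set of $i$ having a free relation, and $\mathsf{Free}(i)=(\mathsf{Free}(i)^b,\mathsf{Free}(i)^u)$ is a chosen free relation $(q,j)$ for each such $i$. A path in $P_i$ is a linearly ordered subset, a maximal path is one maximal under inclusion, and $\mathrm{Path}(a)=\{\mathcal K(c(a)|_m):m\le a\}$. Let $\le_{path}$ be a chosen linear order of the disjoint union over $i<k^u$ of the sets of maximal paths of $P_i$, in which those of $P_i$ precede those of $P_j$ if $i<j$. **Levels.** Let $A\subseteq\mathbf K$. Its splitting nodes are the $c(a)\wedge c(b)$ for $a,b\in A$ with $U(a)=U(b)$ and $c(a),c(b)$ incomparable;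 $\mathrm{Sp}(A)$ is the set of their lengths. $\mathrm{AC}(A)=\{m\notin A\cup\mathrm{Sp}(A):\mathcal K(c[A]|_m)\ne\mathcal K(c[A]|_{m+1})\}$, and $\mathrm{Crit}(A)=A\cup\mathrm{Sp}(A)\cup\mathrm{AC}(A)$. $\mathrm{Start}(t)$ is the least $x$ with $t(x)\ne0$, if any, and $\mathrm{Start}(a)=\mathrm{Start}(c(a))$. $\mathrm{Start}(A)$ is the set of all $\mathrm{Start}(a)$ ($a\in A$), $\mathrm{FreeStart}(A)$ is the set of those with $U(a)\in\mathsf{Free}$, and $\mathrm{Crit}^+(A)=\mathrm{Crit}(A)\cup\mathrm{Start}(A)$. **Diagonal.** $A$ is *weakly diagonal* if: $c[A]$ is an antichain; $\mathrm{Sp}(A)\cap A=\emptyset$; for $m\in\mathrm{Sp}(A)$ there is exactly one splitting node of length $m$, and it has exactly two successors in $c[A]|_{m+1}$; for $m\in\mathrm{Sp}(A)$ and $t\in c[A]|_m$ we have $t^\frown0\in c[A]|_{m+1}$; $\mathrm{Start}(a)$ exists for all $a\in A$; $\mathrm{FreeStart}(A)$ is an initial segment of $\mathrm{Crit}^+(A)$.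 A weakly diagonal $A$ has *controlled paths* if $\mathrm{Path}(a)$ is a maximal path of $P_{U(a)}$ for all $a\in A$ and, for all $a,b\in A$: (1) if $U(a)=U(b)\notin\mathsf{Free}$ and $\mathrm{Start}(a)=\mathrm{Start}(b)$, then $\mathrm{Path}(a)=\mathrm{Path}(b)$; (2) if $U(a)=U(b)=i\in\mathsf{Free}$, then $\mathrm{Start}(a)\le\mathrm{Start}(b)$ iff $\mathrm{Path}(a)\le_{path}\mathrm{Path}(b)$, $U(\mathrm{Start}(a))=\mathsf{Free}(i)^u$, $c(a)(\mathrm{Start}(a))=\mathsf{Free}(i)^b$, and, if $\mathrm{Path}(a)\ne\mathrm{Path}(b)$, then $\mathrm{Start}(a)<b$ and $c(b)(\mathrm{Start}(a))=0$; (3) if $U(a)<U(b)$ are both in $\mathsf{Free}$, then $\mathrm{Start}(a)<\mathrm{Start}(b)$. $m\in\mathrm{AC}(A)$ is *controlled* if, with $\rho=(c[A]|_m)^u$ and $c[A]|_{m+1}=\{t_0<\dots<t_{d-1}\}$: $(\mathcal K(c[A]|_m),\mathcal K(c[A]|_{m+1}))\in\mathrm{Con}(\rho)$, with cause $(\rho,\eta,\mathbf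 I)$, say; there is an ordered embedding $\phi\colon\mathbf I\to\mathbf K$ whose image is left-leaning (if $y<\phi(x)$ and $R(\phi(x),y)\ne0$, then $y\in\phi[\mathbf I]$) with $\max\phi[\mathbf I]=m$, such that for $j<d$ and $y\in[\min\phi[\mathbf I],m]$ we have $t_j(y)=\eta(j,\phi^{-1}(y))$ if $y\in\phi[\mathbf I]$ and $t_j(y)=0$ otherwise; and $\mathrm{Crit}^+(A)\cap[\min\phi[\mathbf I],m]=\{m\}$. $m\in A$ is a *controlled* coding level if, with $c[A]|_m=\{s_0<\dots<s_{d-1}\}$, $s_j=c(m)$, $\rho=(c[A]|_m)^u$, $\mathcal A=\mathcal K(c[A]|_m)$, $c[A]|_{m+1}=\{t_0<\dots<t_{d-2}\}$ and $\varphi(\alpha)=t_\alpha(m)$: $\mathcal A^{\iota_j}=P_{\rho(j)}^{\min}$; $\mathcal A\langle j,\varphi\rangle^{-1}=\mathcal A^{\epsilon_{j,d}}=:\mathcal D$; and every $\mathcal B\in P(\rho)$ with $\mathcal B\subsetneq\mathcal A$ has $\mathcal B^{\epsilon_{j,d}}\subsetneq\mathcal D$ or $\mathcal B\langle j,\varphi\rangle^{-1}\subsetneq\mathcal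 D$. Here $\mathcal A\langle j,\varphi\rangle^{-1}$ is the class of finite $\mathcal L_{d-1}$-structures $\mathbf B$ that belong to $\mathcal A$ after relabelling by $\epsilon_{j,d}$ and adding a new point $x$ with label $j$ and $R(b,x)=\varphi(V^{\mathbf B}(b))$ for $b\in\mathbf B$. $m\in\mathrm{Sp}(A)$ is *controlled* if, with $c[A]|_m=\{s_0<\dots<s_{d-1}\}$, $\rho=(c[A]|_m)^u$, splitting node $s_\alpha$, $i=s_\alpha^u$ and $c[A]|_{m+1}=\{t_0<\dots<t_d\}$: - if $i\in\mathsf{Free}$ with $\mathsf{Free}(i)=(q,j)$, then $c(m)=(j,0^m)$ and $t_{\alpha+1}=s_\alpha{}^\frown q$; - if $i\notin\mathsf{Free}$ and $s_\alpha\ne(i,0^m)$, the same holds with $q=s_\alpha(\mathrm{Start}(s_\alpha))$ and $j=U(\mathrm{Start}(s_\alpha))$; - if $i\notin\mathsf{Free}$ and $s_\alpha=(i,0^m)$, then $(\mathcal K(c[A]|_m),\mathcal K(c[A]|_{m+1}\setminus\{t_\alpha\}))\in\mathrm{Con}(\rho)$, and there are $q\ne0$ and $j<k^u$ with $t_{\alpha+1}=s_\alpha{}^\frown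 q$, $\mathrm{Cause}(\mathcal K(s_\alpha),\mathcal K(s_\alpha{}^\frown q))=\gamma\langle i,q,j\rangle$ and $c(m)=(j,0^m)$. $A$ is *diagonal* if it is weakly diagonal, has controlled paths, and all its age-change, coding and splitting levels are controlled. **Theorem.** For every choice of the free relations, of the causes of essential consecutive age changes and of the order $\le_{path}$, there is an ordered embedding $f\colon\mathbf K\to\mathbf K$ such that $f[\mathbf K]$ is diagonal. -/

import Mathlib

namespace CodingTree

open FirstOrder

/-- A finite binary relational language: `ku` unary and `k` binary symbols, together with the
involution `flip` that says how `R a b` and `R b a` are related. The binary symbol `0` plays the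
role of no relation. -/
structure BinLang where
  ku : ℕ
  k : ℕ
  k_ne_zero : NeZero k
  flip : Fin k → Fin k
  flip_flip : ∀ q, flip (flip q) = q
  flip_zero : flip 0 = 0

attribute [instance] BinLang.k_ne_zero

/-! ### Structures -/

/-- A structure on `X` with `d` unary symbols partitioning `X`, and whose binary symbols partition
the pairs of distinct points. `U a` is the unary symbol that holds at `a`, and for `a ≠ b`, `R a b`
is the binary symbol that holds at `(a, b)`; no binary symbol holds at `(a, a)`, and `R a a = 0` is
a convention. With `d = L.ku` these are the structures of the language, with other `d` they are the
structures with `d` labels (the labels replacing the unary symbols). -/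
structure Str (L : BinLang) (d : ℕ) (X : Type) where
  U : X → Fin d
  R : X → X → Fin L.k
  R_self : ∀ a, R a a = 0
  R_flip : ∀ a b, R b a = L.flip (R a b)

namespace Str

variable {L : BinLang} {d d' : ℕ} {X Y : Type}

/-- The structure pulled back along a map (for injective maps: the induced substructure). -/
def comap (S : Str L d Y) (f : X → Y) : Str L d X where
  U a := S.U (f a)
  R a b := S.R (f a) (f b)
  R_self _ := S.R_self _
  R_flip _ _ := S.R_flip _ _

/-- Change the labels along `e`. -/
def relabel (S : Str L d X) (e : Fin d → Fin d') : Str L d' X where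
  U a := e (S.U a)
  R := S.R
  R_self := S.R_self
  R_flip := S.R_flip

/-- Embeddings of structures. -/
def IsEmb (S : Str L d X) (T : Str L d Y) (f : X → Y) : Prop :=
  Function.Injective f ∧ (∀ a, T.U (f a) = S.U a) ∧ ∀ a b, T.R (f a) (f b) = S.R a b

/-- Order preserving embeddings between enumerated structures (the underlying sets are
initial segments of `ℕ`). -/
def IsOEmb [Preorder X] [Preorder Y] (S : Str L d X) (T : Str L d Y) (f : X → Y) : Prop :=
  StrictMono f ∧ S.IsEmb T f

/-- Any two distinct points are related. -/
def Irreducible (S : Str L d X) : Prop := ∀ a b, a ≠ b → S.R a b ≠ 0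

end Str

/-- A finite structure with `d` labels on some finite type. -/
structure FinStr (L : BinLang) (d : ℕ) where
  carrier : Type
  finite : Finite carrier
  str : Str L d carrier

/-- Classes of finite structures with `d` labels. -/
abbrev Class (L : BinLang) (d : ℕ) := Set (FinStr L d)

/-- `S` embeds no member of `𝓕`; for finite `S` this is membership in `Forb(𝓕)`. -/
def Omits {L : BinLang} {d : ℕ} {X : Type} (𝓕 : Class L d) (S : Str L d X) : Prop :=
  ∀ F ∈ 𝓕, ¬ ∃ f, F.str.IsEmb S f

/-! ### The first-order language and Fraïssé limits -/

/-- The relation symbols. -/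
inductive RelSymb (L : BinLang) : ℕ → Type
  | un : Fin L.ku → RelSymb L 1
  | bin : Fin L.k → RelSymb L 2

/-- The first-order language. -/
def lang (L : BinLang) : Language := ⟨fun _ => Empty, RelSymb L⟩

instance (L : BinLang) : Countable (Σ l, (lang L).Functions l) :=
  inferInstanceAs (Countable (Σ _ : ℕ, Empty))

/-- A structure as a first-order structure. -/
@[reducible] def Str.toFO {L : BinLang} {X : Type} (S : Str L L.ku X) : (lang L).Structure X where
  funMap := fun f _ => Empty.elim f
  RelMap := fun {_} r => match r with
    | RelSymb.un i => fun v => S.U (v 0) = i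
    | RelSymb.bin q => fun v => v 0 ≠ v 1 ∧ S.R (v 0) (v 1) = q

/-- The class `Forb(𝓕)` as a class of first-order structures. -/
def forbClass {L : BinLang} (𝓕 : Class L L.ku) :
    Set (CategoryTheory.Bundled.{0} (lang L).Structure) :=
  {N | Finite N ∧ ∃ S : Str L L.ku N, S.toFO = N.str ∧ Omits 𝓕 S}

/-- `K`, an enumerated structure, is a Fraïssé limit of `Forb(𝓕)`. -/
def IsFraisseLimitOf {L : BinLang} (𝓕 : Class L L.ku) (K : Str L L.ku ℕ) : Prop :=
  letI := K.toFO
  Language.IsFraisseLimit (forbClass 𝓕) ℕ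

/-- Left density of an enumerated structure `K`: every one-point extension `A` (by the last point)
of an initial segment of `K`, with `A` in `Forb(𝓕)`, is realized in `K` by a point that is
unrelated to all other points of `K` before it outside the initial segment. -/
def LeftDense {L : BinLang} (𝓕 : Class L L.ku) (K : Str L L.ku ℕ) : Prop :=
  ∀ (m : ℕ) (A : Str L L.ku (Fin (m + 1))), Omits 𝓕 A →
    A.comap (Fin.castSucc : Fin m → Fin (m + 1)) = K.comap (Fin.val : Fin m → ℕ) →
    ∃ f : Fin (m + 1) → ℕ, A.IsOEmb K f ∧ (∀ x : Fin m, f x.castSucc = x) ∧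
      ∀ r, m ≤ r → r < f (Fin.last m) → K.R (f (Fin.last m)) r = 0

/-- The unary symbol `i` is non-degenerate for `Forb(𝓕)`. -/
def NonDegenerate {L : BinLang} (𝓕 : Class L L.ku) (i : Fin L.ku) : Prop :=
  ∃ S : Str L L.ku (Fin 2), Omits 𝓕 S ∧ (∃ x, S.U x = i) ∧ S.R 0 1 ≠ 0

/-! ### The tree -/

/-- `Node L n` is the level `n` of the tree `T`: a unary part `u` and a binary part `b`. -/
@[ext] structure Node (L : BinLang) (n : ℕ) where
  u : Fin L.ku
  b : Fin n → Fin L.k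

namespace Node

variable {L : BinLang} {n : ℕ}

/-- The strict lexicographic order on a level. -/
def LexLT (s t : Node L n) : Prop :=
  s.u < t.u ∨ (s.u = t.u ∧ ∃ x, (∀ y, y < x → s.b y = t.b y) ∧ s.b x < t.b x)

/-- The immediate successor of `s` with last value `q`. -/
def snoc (s : Node L n) (q : Fin L.k) : Node L (n + 1) := ⟨s.u, Fin.snoc s.b q⟩

/-- The node of level `n` on the left branch of the `i`th tree. -/
def left (i : Fin L.ku) (n : ℕ) : Node L n := ⟨i, fun _ => 0⟩

/-- `x` is the least place where the binary part of `s` is non-zero. -/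
def IsStart (s : Node L n) (x : Fin n) : Prop := s.b x ≠ 0 ∧ ∀ y, y < x → s.b y = 0

end Node

/-- `s` enumerates the level set `S` in increasing lexicographic order. -/
def IsEnum {L : BinLang} {n d : ℕ} (s : Fin d → Node L n) (S : Set (Node L n)) : Prop :=
  (∀ i j, i < j → (s i).LexLT (s j)) ∧ Set.range s = S

/-- For `m ≤ a`, the restriction to level `m` of the coding node of `a`. -/
def nodeAt {L : BinLang} (K : Str L L.ku ℕ) (a m : ℕ) : Node L m := ⟨K.U a, fun x => K.R a x⟩

/-- The coding node of `a`. -/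
def code {L : BinLang} (K : Str L L.ku ℕ) (a : ℕ) : Node L a := nodeAt K a a

/-- The restrictions to level `m` of the coding nodes of members of `A` of length at least `m`. -/
def lev {L : BinLang} (K : Str L L.ku ℕ) (A : Set ℕ) (m : ℕ) : Set (Node L m) :=
  {t | ∃ a ∈ A, m ≤ a ∧ nodeAt K a m = t}

/-! ### Gluings and ages -/

/-- A gluing of rank `d`: a sort, an attachment map and an enumerated structure. -/
structure Gluing (L : BinLang) (d : ℕ) where
  sort : Fin d → Fin L.ku
  size : ℕ
  att : Fin d → Fin size → Fin L.k
  str : Str L L.ku (Fin size)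

namespace Gluing

variable {L : BinLang} {d : ℕ}

/-- The result of gluing a structure `B` with `d` labels to the enumerated structure of `γ`. -/
def glue (γ : Gluing L d) {X : Type} (B : Str L d X) : Str L L.ku (Fin γ.size ⊕ X) where
  U := Sum.elim γ.str.U (fun b => γ.sort (B.U b))
  R
    | .inl x, .inl y => γ.str.R x y
    | .inr b, .inr c => B.R b c
    | .inr b, .inl x => γ.att (B.U b) x
    | .inl x, .inr b => L.flip (γ.att (B.U b) x)
  R_self := by
    rintro (x | b)
    · exact γ.str.R_self x
    · exact B.R_self b
  R_flip := by
    rintro (x | b) (y | c)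
    · exact γ.str.R_flip x y
    · exact (L.flip_flip _).symm
    · rfl
    · exact B.R_flip b c

/-- The age of a gluing. -/
def age (𝓕 : Class L L.ku) (γ : Gluing L d) : Class L d := {B | Omits 𝓕 (γ.glue B.str)}

/-- The one-point structure with unary symbol `j`, attached by `q`, of rank one and sort `i`. -/
def point (i : Fin L.ku) (q : Fin L.k) (j : Fin L.ku) : Gluing L 1 where
  sort := fun _ => i
  size := 1
  att := fun _ _ => q
  str := ⟨fun _ => j, fun _ _ => 0, fun _ => rfl, fun _ _ => L.flip_zero.symm⟩

/-- Extend a gluing of rank `d₀` along an injection `e` to one of rank `d` with sort `ρ`; the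
labels outside the range of `e` are attached by `0`. -/
noncomputable def extend {d₀ : ℕ} (ρ : Fin d → Fin L.ku) (e : Fin d₀ → Fin d)
    (ζ : Gluing L d₀) : Gluing L d where
  sort := ρ
  size := ζ.size
  att := Function.extend e ζ.att (fun _ _ => 0)
  str := ζ.str

end Gluing

section Ages

variable {L : BinLang} (𝓕 : Class L L.ku) (K : Str L L.ku ℕ)

/-- The gluing given by a `d`-tuple of nodes of level `n` and the first `n` points of `K`. -/
def nodeGluing {d n : ℕ} (σ : Fin d → Node L n) : Gluing L d where
  sort := fun i => (σ i).u
  size := n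
  att := fun i x => (σ i).b x
  str := K.comap Fin.val

/-- The age of a tuple of nodes. -/
def age {d n : ℕ} (σ : Fin d → Node L n) : Class L d := (nodeGluing K σ).age 𝓕

/-- The age of a single node. -/
def age₁ {n : ℕ} (s : Node L n) : Class L 1 := age 𝓕 K (fun _ : Fin 1 => s)

/-- The poset `P(ρ)` of ages of level subsets of the coding tree of `K` with sort `ρ`, ordered
by inclusion. -/
def ages {d : ℕ} (ρ : Fin d → Fin L.ku) : Set (Class L d) :=
  {A | ∃ (n : ℕ) (s : Fin d → Node L n), (∀ i j, i < j → (s i).LexLT (s j)) ∧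
    (∀ i, s i ∈ lev K Set.univ n) ∧ (∀ i, (s i).u = ρ i) ∧ age 𝓕 K s = A}

/-- The constant sort of rank one. -/
def sort₁ (i : Fin L.ku) : Fin 1 → Fin L.ku := fun _ => i

/-- The class of structures whose relabelling along `e` is in `A`. -/
def restr {d d₀ : ℕ} (A : Class L d) (e : Fin d₀ → Fin d) : Class L d₀ :=
  {B | (⟨B.carrier, B.finite, B.str.relabel e⟩ : FinStr L d) ∈ A}

/-- Consecutive age changes in `P(ρ)`. -/
def Con {d : ℕ} (ρ : Fin d → Fin L.ku) (A B : Class L d) : Prop :=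
  A ∈ ages 𝓕 K ρ ∧ B ∈ ages 𝓕 K ρ ∧ B ⊂ A ∧ ¬ ∃ C ∈ ages 𝓕 K ρ, B ⊂ C ∧ C ⊂ A

/-- Essential consecutive age changes. -/
def ECon {d : ℕ} (ρ : Fin d → Fin L.ku) (A B : Class L d) : Prop :=
  Con 𝓕 K ρ A B ∧
    ∀ (d₀ : ℕ) (e : Fin d₀ → Fin d), d₀ < d → StrictMono e → restr A e = restr B e

/-- The enumerated structures of `Forb(𝓕)` which embed into a member of `𝓕`. -/
def IsPiece {n : ℕ} (J : Str L L.ku (Fin n)) : Prop :=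
  Omits 𝓕 J ∧ ∃ F ∈ 𝓕, ∃ f, J.IsEmb F.str f

/-- The spectrum of a class `A` in `P(ρ)`. -/
def Spec {d : ℕ} (ρ : Fin d → Fin L.ku) (A : Class L d) : Set (Gluing L d) :=
  {γ | γ.sort = ρ ∧ IsPiece 𝓕 γ.str ∧ A ⊆ γ.age 𝓕}

/-- `γ` is in the spectrum of `B` but not in that of `A`, and has least possible size. -/
def IsMinCause {d : ℕ} (ρ : Fin d → Fin L.ku) (A B : Class L d) (γ : Gluing L d) : Prop :=
  γ ∈ Spec 𝓕 ρ B \ Spec 𝓕 ρ A ∧ ∀ γ' ∈ Spec 𝓕 ρ B \ Spec 𝓕 ρ A, γ.size ≤ γ'.size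

/-- `(q, j)` is a free relation for `i`. -/
def IsFreeRel (i : Fin L.ku) (q : Fin L.k) (j : Fin L.ku) : Prop :=
  q ≠ 0 ∧ (Gluing.point i q j).age 𝓕 = age₁ 𝓕 K (Node.left i 0)

/-- `i` has a free relation. -/
def HasFree (i : Fin L.ku) : Prop := ∃ q j, IsFreeRel 𝓕 K i q j

/-! ### Paths -/

/-- The set `P_i`. -/
def P₁ (i : Fin L.ku) : Set (Class L 1) := ages 𝓕 K (sort₁ i)

/-- The minimum of `P_i`, as the intersection of all its members. -/
def Pmin (i : Fin L.ku) : Class L 1 := ⋂₀ P₁ 𝓕 K i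

/-- The path of `a`. -/
def Path (a : ℕ) : Set (Class L 1) := {A | ∃ m ≤ a, age₁ 𝓕 K (nodeAt K a m) = A}

/-- `p` is a linearly ordered subset of `P_i`. -/
def IsPath (i : Fin L.ku) (p : Set (Class L 1)) : Prop :=
  p ⊆ P₁ 𝓕 K i ∧ IsChain (· ⊆ ·) p

/-- `p` is a path in `P_i` which is maximal under inclusion. -/
def IsMaxPath (i : Fin L.ku) (p : Set (Class L 1)) : Prop :=
  IsPath 𝓕 K i p ∧ ∀ q, IsPath 𝓕 K i q → p ⊆ q → q = p

/-- The disjoint union over all `i` of the sets of maximal paths in `P_i`. -/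
structure MaxPath where
  sort : Fin L.ku
  path : Set (Class L 1)
  isMax : IsMaxPath 𝓕 K sort path

/-- The arbitrary choices on which the notion of a diagonal substructure depends: a free relation
for each unary symbol that has one (`free i` is irrelevant for other `i`), the cause of each
essential consecutive age change (`cause` is irrelevant at other arguments), and a linear order
of the maximal paths that puts those in `P_i` before those in `P_j` when `i < j`. -/
structure Choices where
  free : Fin L.ku → Fin L.k × Fin L.ku
  free_spec : ∀ i, HasFree 𝓕 K i → IsFreeRel 𝓕 K i (free i).1 (free i).2
  cause : ∀ d : ℕ, (Fin d → Fin L.ku) → Class L d → Class L d → Gluing L d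
  cause_spec : ∀ (d : ℕ) (ρ : Fin d → Fin L.ku) (A B : Class L d), ECon 𝓕 K ρ A B →
    (∃ γ, IsMinCause 𝓕 ρ A B γ) → IsMinCause 𝓕 ρ A B (cause d ρ A B)
  pathOrder : LinearOrder (MaxPath 𝓕 K)
  pathOrder_spec : ∀ p q : MaxPath 𝓕 K, p.sort < q.sort → pathOrder.le p q

variable {𝓕 K}

/-- `γ` is the cause of the (possibly non-essential) consecutive age change `(A, B)`: the cause of
the essential age change that it induces along some increasing injection, extended to rank `d`. -/
def Choices.IsCauseOf (C : Choices 𝓕 K) {d : ℕ} (ρ : Fin d → Fin L.ku) (A B : Class L d)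
    (γ : Gluing L d) : Prop :=
  ∃ (d₀ : ℕ) (e : Fin d₀ → Fin d), StrictMono e ∧
    ECon 𝓕 K (fun i => ρ (e i)) (restr A e) (restr B e) ∧
    γ = Gluing.extend ρ e (C.cause d₀ (fun i => ρ (e i)) (restr A e) (restr B e))

end Ages

/-! ### Critical levels -/

section Levels

variable {L : BinLang} (𝓕 : Class L L.ku) (K : Str L L.ku ℕ) (A : Set ℕ)

/-- `s` is a splitting node of `A`, i.e. the meet of two incomparable coding nodes of `A`. -/
def IsSplitNode {m : ℕ} (s : Node L m) : Prop :=
  ∃ a ∈ A, ∃ b ∈ A, m < a ∧ m < b ∧ nodeAt K a m = s ∧ nodeAt K b m = s ∧ K.R a m ≠ K.R b m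

/-- The splitting levels. -/
def Sp : Set ℕ := {m | ∃ s : Node L m, IsSplitNode K A s}

/-- The age-change levels. -/
def AC : Set ℕ :=
  {m | m ∉ A ∪ Sp K A ∧ ∃ (d : ℕ) (s : Fin d → Node L m) (t : Fin d → Node L (m + 1)),
    IsEnum s (lev K A m) ∧ IsEnum t (lev K A (m + 1)) ∧ age 𝓕 K s ≠ age 𝓕 K t}

/-- The critical levels. -/
def Crit : Set ℕ := A ∪ Sp K A ∪ AC 𝓕 K A

/-- `Start(a)` exists. -/
def HasStart (a : ℕ) : Prop := ∃ x < a, K.R a x ≠ 0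

/-- `Start(a)`, the least `x < a` related to `a` (if there is one). -/
noncomputable def start (a : ℕ) : ℕ := sInf {x | x < a ∧ K.R a x ≠ 0}

/-- All start levels of `A`. -/
def startSet : Set ℕ := {m | ∃ a ∈ A, HasStart K a ∧ start K a = m}

/-- The start levels of the members of `A` whose unary symbol has a free relation. -/
def freeStart : Set ℕ := {m | ∃ a ∈ A, HasFree 𝓕 K (K.U a) ∧ HasStart K a ∧ start K a = m}

/-- Critical levels and start levels. -/
def CritPlus : Set ℕ := Crit 𝓕 K A ∪ startSet K A

/-- Weakly diagonal substructures. -/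
structure WeaklyDiagonal : Prop where
  /-- No coding node of `A` is an initial segment of another one. -/
  antichain : ∀ a ∈ A, ∀ b ∈ A, a < b → nodeAt K b a ≠ code K a
  split_not_code : Sp K A ∩ A = ∅
  split_unique : ∀ m ∈ Sp K A, ∃! s : Node L m, IsSplitNode K A s
  split_two : ∀ (m : ℕ) (s : Node L m), IsSplitNode K A s →
    {q | s.snoc q ∈ lev K A (m + 1)}.ncard = 2
  split_left : ∀ m ∈ Sp K A, ∀ t ∈ lev K A m, t.snoc 0 ∈ lev K A (m + 1)
  hasStart : ∀ a ∈ A, HasStart K a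
  /-- `freeStart` is an initial segment of `CritPlus`. -/
  freeStart_initial : ∀ x ∈ CritPlus 𝓕 K A, ∀ y ∈ freeStart 𝓕 K A, x ≤ y → x ∈ freeStart 𝓕 K A

/-- All coding nodes of `A` have maximal paths. -/
def HasMaximalPaths : Prop := ∀ a ∈ A, IsMaxPath 𝓕 K (K.U a) (Path 𝓕 K a)

end Levels

/-! ### Controlled paths and controlled levels -/

section Controlled

variable {L : BinLang} {𝓕 : Class L L.ku} {K : Str L L.ku ℕ} (C : Choices 𝓕 K) (A : Set ℕ)

/-- Controlled paths. -/
structure ControlledPaths : Prop where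
  maximal : HasMaximalPaths 𝓕 K A
  nonfree : ∀ a ∈ A, ∀ b ∈ A, K.U a = K.U b → ¬ HasFree 𝓕 K (K.U a) →
    start K a = start K b → Path 𝓕 K a = Path 𝓕 K b
  free_order : ∀ a ∈ A, ∀ b ∈ A, K.U a = K.U b → HasFree 𝓕 K (K.U a) →
    ∀ p q : MaxPath 𝓕 K, p.sort = K.U a → p.path = Path 𝓕 K a →
      q.sort = K.U b → q.path = Path 𝓕 K b →
      (start K a ≤ start K b ↔ C.pathOrder.le p q)
  free_start : ∀ a ∈ A, HasFree 𝓕 K (K.U a) →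
    K.U (start K a) = (C.free (K.U a)).2 ∧ K.R a (start K a) = (C.free (K.U a)).1
  /-- The coding node of `b` is defined and zero at `Start(a)`. -/
  free_zero : ∀ a ∈ A, ∀ b ∈ A, K.U a = K.U b → HasFree 𝓕 K (K.U a) →
    Path 𝓕 K a ≠ Path 𝓕 K b → start K a < b ∧ K.R b (start K a) = 0
  free_sorts : ∀ a ∈ A, ∀ b ∈ A, HasFree 𝓕 K (K.U a) → HasFree 𝓕 K (K.U b) →
    K.U a < K.U b → start K a < start K b

/-- An ordered embedding whose image is left-leaning: a point of the image is unrelated to all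
smaller points outside the image. -/
def IsOLEmb {n : ℕ} (I : Str L L.ku (Fin n)) (K : Str L L.ku ℕ) (φ : Fin n → ℕ) : Prop :=
  I.IsOEmb K φ ∧ ∀ x y, y < φ x → K.R (φ x) y ≠ 0 → y ∈ Set.range φ

/-- `m` is a controlled age-change level. -/
def ControlledAC (m : ℕ) : Prop :=
  ∃ (d : ℕ) (s : Fin d → Node L m) (t : Fin d → Node L (m + 1)),
    IsEnum s (lev K A m) ∧ IsEnum t (lev K A (m + 1)) ∧
    Con 𝓕 K (fun i => (s i).u) (age 𝓕 K s) (age 𝓕 K t) ∧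
    ∃ γ : Gluing L d, C.IsCauseOf (fun i => (s i).u) (age 𝓕 K s) (age 𝓕 K t) γ ∧
      ∃ φ : Fin γ.size → ℕ, IsOLEmb γ.str K φ ∧ IsGreatest (Set.range φ) m ∧
        ∃ i, IsLeast (Set.range φ) i ∧
          (∀ (j : Fin d) (y : Fin (m + 1)), i ≤ y →
            (∀ x, φ x = y → (t j).b y = γ.att j x) ∧
            ((y : ℕ) ∉ Set.range φ → (t j).b y = 0)) ∧
          CritPlus 𝓕 K A ∩ Set.Icc i m = {m}

/-- Add to a structure with `l` labels a new point labelled `j`, relabel along `π`, and relate the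
points `b` labelled `α` to the new point `x` by `R b x = φ α`. -/
def FinStr.addPoint {d l : ℕ} (j : Fin d) (π : Fin l → Fin d) (φ : Fin l → Fin L.k)
    (B : FinStr L l) : FinStr L d where
  carrier := Option B.carrier
  finite := by
    have := B.finite
    infer_instance
  str :=
    { U := fun o => o.elim j (fun b => π (B.str.U b))
      R := fun o o' => match o, o' with
        | some b, some c => B.str.R b c
        | some b, none => φ (B.str.U b)
        | none, some b => L.flip (φ (B.str.U b))
        | none, none => 0
      R_self := by
        rintro (_ | b)
        · rfl
        · exact B.str.R_self b
      R_flip := by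
        rintro (_ | b) (_ | c)
        · exact L.flip_zero.symm
        · exact (L.flip_flip _).symm
        · rfl
        · exact B.str.R_flip b c }

/-- The structures `B` such that `B` with the new point added is in `A`. -/
def addPointInv {d l : ℕ} (A : Class L d) (j : Fin d) (π : Fin l → Fin d) (φ : Fin l → Fin L.k) :
    Class L l :=
  {B | FinStr.addPoint j π φ B ∈ A}

/-- Controlled coding triples. -/
structure ControlledCodingTriple (𝓕 : Class L L.ku) (K : Str L L.ku ℕ) {d : ℕ}
    (ρ : Fin (d + 1) → Fin L.ku) (A : Class L (d + 1)) (j : Fin (d + 1)) (φ : Fin d → Fin L.k) :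
    Prop where
  mem : A ∈ ages 𝓕 K ρ
  min : restr A (fun _ : Fin 1 => j) = Pmin 𝓕 K (ρ j)
  next : addPointInv A j j.succAbove φ = restr A j.succAbove
  strict : ∀ B ∈ ages 𝓕 K ρ, B ⊂ A →
    restr B j.succAbove ⊂ restr A j.succAbove ∨
      addPointInv B j j.succAbove φ ⊂ restr A j.succAbove

/-- `m` is a controlled coding level. -/
def ControlledCoding (𝓕 : Class L L.ku) (K : Str L L.ku ℕ) (A : Set ℕ) (m : ℕ) : Prop :=
  ∃ (d : ℕ) (s : Fin (d + 1) → Node L m) (t : Fin d → Node L (m + 1)) (j : Fin (d + 1)),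
    IsEnum s (lev K A m) ∧ IsEnum t (lev K A (m + 1)) ∧ s j = code K m ∧
    ControlledCodingTriple 𝓕 K (fun i => (s i).u) (age 𝓕 K s) j
      (fun α => (t α).b (Fin.last m))

/-- `m` is a controlled splitting level. -/
def ControlledSplitting (m : ℕ) : Prop :=
  ∃ (d : ℕ) (s : Fin d → Node L m) (t : Fin (d + 1) → Node L (m + 1)) (α : Fin d),
    IsEnum s (lev K A m) ∧ IsEnum t (lev K A (m + 1)) ∧ IsSplitNode K A (s α) ∧
    -- the unary symbol of the splitting node has a free relation
    (HasFree 𝓕 K (s α).u →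
      code K m = Node.left (C.free (s α).u).2 m ∧
      t α.succ = (s α).snoc (C.free (s α).u).1) ∧
    -- no free relation, and the splitting node is not on the left branch
    (¬ HasFree 𝓕 K (s α).u → s α ≠ Node.left (s α).u m →
      ∃ x : Fin m, (s α).IsStart x ∧
        code K m = Node.left (K.U x) m ∧ t α.succ = (s α).snoc ((s α).b x)) ∧
    -- no free relation, and the splitting node is on the left branch
    (¬ HasFree 𝓕 K (s α).u → s α = Node.left (s α).u m →
      Con 𝓕 K (fun i => (s i).u) (age 𝓕 K s)
        (age 𝓕 K (fun i => t (α.castSucc.succAbove i))) ∧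
      ∃ (q : Fin L.k) (j : Fin L.ku), q ≠ 0 ∧ t α.succ = (s α).snoc q ∧
        C.IsCauseOf (sort₁ (s α).u) (age₁ 𝓕 K (s α)) (age₁ 𝓕 K (t α.succ))
          (Gluing.point (s α).u q j) ∧
        code K m = Node.left j m)

/-- Diagonal substructures. -/
structure Diagonal : Prop where
  weaklyDiagonal : WeaklyDiagonal 𝓕 K A
  controlledPaths : ControlledPaths C A
  controlledAC : ∀ m ∈ AC 𝓕 K A, ControlledAC C A m
  controlledCoding : ∀ m ∈ A, ControlledCoding 𝓕 K A m
  controlledSplitting : ∀ m ∈ Sp K A, ControlledSplitting C A m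

end Controlled

end CodingTree

/-! The embedding is built through its coding nodes. An infinite matrix `G` is filled column by
column, row `a` being destined to become the coding node of `f a`: it is used up to column `f a`,
and in column `f n` every later row `a` takes the value `K.R a n`. As long as the age of a row
contains the one-point structure, left density (`Ambient.realize`) yields a point of `K` whose
coding node is that row followed by zeros; this is how `f n` is found once row `n` is ready.

Ages are computable because forbidden structures are irreducible: only cliques matter, and a zero
relation contributes nothing. Hence letting a tuple of nodes pass a left-leaning copy of the
structure of a gluing, with the attachments of that gluing, intersects its age with the age of the
gluing (`Ambient.age_pass`). So zeros are harmless, the posets of ages are finite and closed under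
such intersections, and every consecutive age change is produced by a copy of its cause
(`Ambient.seg_ageChange`). As a cause has least size, its proper truncations change nothing, and the
age drops exactly at the last point of the copy.

The invariant `StageInv` says that, before `n` is coded, any tuple of remaining rows has the same
age as the tuple of nodes of level `n` in `K` that it represents. One stage (`Ambient.exists_stage`)
restores it for `n + 1`. Rows on a left branch that have to leave it are started by the initial age
change of their path (`Ambient.seg_start`); rows that differ towards `n` are separated without any
age change, by a free relation or by a repeated start value (`Ambient.seg_separate`); the age
descends by controlled changes (`Ambient.seg_descend`) to a minimal age from which coding `n` leaves
precisely the ages of level `n + 1` in `K` (`Ambient.exists_coding_age`). A class `lowerAge` of ages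
that must stay reachable bounds all these steps from below.

Maximal paths `p a` containing `Path 𝓕 K a` are fixed in advance and every step moves each row along
its own path, at most one class at a time; thus the path of `f a` is `p a`. Starts by free relations
cost no age and are placed before everything else, in the order of the paths (`FreeStarts`). Each
segment of columns records that its levels are quiet, controlled age changes or controlled
splittings (`Seg`, `LevelOK`), from which diagonality is read off in `Construction.diagonal`. -/

namespace CodingTree

/-! ### Reduction to cliques, and the lexicographically ordered levels of the tree. -/

variable {L : BinLang} {𝓕 : Class L L.ku} {K : Str L L.ku ℕ}

/-- The hypotheses on the class `Forb(𝓕)` and on its enumerated limit `K` that the construction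
uses. -/
structure Ambient (𝓕 : Class L L.ku) (K : Str L L.ku ℕ) : Prop where
  fin : 𝓕.Finite
  irr : ∀ F ∈ 𝓕, F.str.Irreducible
  two : ∀ F ∈ 𝓕, 2 ≤ Nat.card F.carrier
  nondeg : ∀ i, NonDegenerate 𝓕 i
  omits : Omits 𝓕 K
  dense : LeftDense 𝓕 K

/-! ### Omitting irreducible structures -/

namespace Str

variable {d : ℕ} {X Y Z : Type}

/-- The map `f` restricts to an embedding on `C`. -/
def EmbOn (S : Str L d X) (T : Str L d Y) (f : X → Y) (C : Set X) : Prop :=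
  Set.InjOn f C ∧ (∀ a ∈ C, T.U (f a) = S.U a) ∧ ∀ a ∈ C, ∀ b ∈ C, T.R (f a) (f b) = S.R a b

theorem IsEmb.comp {S : Str L d X} {T : Str L d Y} {W : Str L d Z} {g : Y → Z} {f : X → Y}
    (hg : T.IsEmb W g) (hf : S.IsEmb T f) : S.IsEmb W (g ∘ f) :=
  ⟨hg.1.comp hf.1, fun a => (hg.2.1 _).trans (hf.2.1 a),
    fun a b => (hg.2.2 _ _).trans (hf.2.2 a b)⟩

theorem isEmb_comap {S : Str L d Y} {f : X → Y} (hf : Function.Injective f) :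
    (S.comap f).IsEmb S f := ⟨hf, fun _ => rfl, fun _ _ => rfl⟩

end Str

theorem Omits.of_emb {X Y : Type} {S : Str L L.ku X} {T : Str L L.ku Y} {f : X → Y}
    (hT : Omits 𝓕 T) (hf : S.IsEmb T f) : Omits 𝓕 S :=
  fun F hF ⟨g, hg⟩ => hT F hF ⟨f ∘ g, hf.comp hg⟩

/-- It suffices to look at the non-trivial cliques. -/
theorem Ambient.omits_of_cliques (H : Ambient 𝓕 K) {Y : Type} {Z : Str L L.ku Y}
    (h : ∀ C : Set Y, C.Nontrivial → (∀ a ∈ C, ∀ b ∈ C, a ≠ b → Z.R a b ≠ 0) →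
      ∃ (Y' : Type) (W : Str L L.ku Y') (g : Y → Y'), Omits 𝓕 W ∧ Z.EmbOn W g C) :
    Omits 𝓕 Z := by
  rintro F hF ⟨f, hf⟩
  -- The image of a forbidden structure is a clique, as it is irreducible, and has at least two
  -- points; only this clique has to be moved into a structure of the class.
  obtain ⟨Y', W, g, hW, hg⟩ := h (Set.range f) (by
    have := F.finite
    have h2 := H.two F hF
    have : Nontrivial F.carrier := (Finite.one_lt_card_iff_nontrivial).1 h2
    obtain ⟨a, b, hab⟩ := exists_pair_ne F.carrier
    exact ⟨f a, ⟨a, rfl⟩, f b, ⟨b, rfl⟩, fun h => hab (hf.1 h)⟩) (by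
    rintro _ ⟨a, rfl⟩ _ ⟨b, rfl⟩ hab
    rw [hf.2.2]
    exact H.irr F hF a b (fun h => hab (h ▸ rfl)))
  refine hW F hF ⟨g ∘ f, ?_, fun a => ?_, fun a b => ?_⟩
  · intro a b hab
    exact hf.1 (hg.1 ⟨a, rfl⟩ ⟨b, rfl⟩ hab)
  · exact (hg.2.1 _ ⟨a, rfl⟩).trans (hf.2.1 a)
  · exact (hg.2.2 _ ⟨a, rfl⟩ _ ⟨b, rfl⟩).trans (hf.2.2 a b)

/-- It suffices to cover every non-trivial clique by a substructure in the class. -/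
theorem Ambient.omits_of_covered (H : Ambient 𝓕 K) {Y : Type} {Z : Str L L.ku Y}
    (h : ∀ C : Set Y, C.Nontrivial → (∀ a ∈ C, ∀ b ∈ C, a ≠ b → Z.R a b ≠ 0) →
      ∃ (V : Type) (S : Str L L.ku V) (i : V → Y), Omits 𝓕 S ∧ S.IsEmb Z i ∧
        ∀ c ∈ C, c ∈ Set.range i) :
    Omits 𝓕 Z := by
  classical
  refine H.omits_of_cliques fun C hC hR => ?_
  obtain ⟨V, S, i, hS, hi, hCi⟩ := h C hC hR
  obtain ⟨c₀, hc₀⟩ := hC.nonempty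
  obtain ⟨v₀, -⟩ := hCi c₀ hc₀
  let g : Y → V := fun y => if h : ∃ v, i v = y then h.choose else v₀
  have hg : ∀ c ∈ C, i (g c) = c := fun c hc => by
    have hc' : ∃ v, i v = c := hCi c hc
    simp only [g, hc', dite_true]
    exact hc'.choose_spec
  refine ⟨V, S, g, hS, fun a ha b hb hab => ?_, fun a ha => ?_, fun a ha b hb => ?_⟩
  · rw [← hg a ha, ← hg b hb, hab]
  · rw [← hi.2.1, hg a ha]
  · rw [← hi.2.2, hg a ha, hg b hb]

/-! ### Nodes given by functions -/

/-- The node of level `n` given by the first `n` values of `g`. -/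
def nd (i : Fin L.ku) (g : ℕ → Fin L.k) (n : ℕ) : Node L n := ⟨i, fun x => g x⟩

theorem nd_eq_iff {i j : Fin L.ku} {g h : ℕ → Fin L.k} {n : ℕ} :
    nd i g n = nd j h n ↔ i = j ∧ ∀ x < n, g x = h x := by
  refine ⟨fun H => ?_, fun ⟨h1, h2⟩ => ?_⟩
  · rw [Node.ext_iff] at H
    exact ⟨H.1, fun x hx => congrFun H.2 ⟨x, hx⟩⟩
  · exact Node.ext h1 (funext fun x => h2 x x.2)

theorem nd_mono {i j : Fin L.ku} {g h : ℕ → Fin L.k} {m n : ℕ} (hmn : m ≤ n)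
    (e : nd i g n = nd j h n) : nd i g m = nd j h m := by
  rw [nd_eq_iff] at e ⊢
  exact ⟨e.1, fun x hx => e.2 x (hx.trans_le hmn)⟩

theorem nd_succ {i j : Fin L.ku} {g h : ℕ → Fin L.k} {m : ℕ} :
    nd i g (m + 1) = nd j h (m + 1) ↔ nd i g m = nd j h m ∧ g m = h m := by
  simp only [nd_eq_iff]
  refine ⟨fun e => ⟨⟨e.1, fun x hx => e.2 x (by omega)⟩, e.2 m (by omega)⟩,
    fun e => ⟨e.1.1, fun x hx => ?_⟩⟩
  rcases Nat.lt_succ_iff_lt_or_eq.1 hx with hx | rfl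
  · exact e.1.2 x hx
  · exact e.2

theorem snoc_nd (i : Fin L.ku) (g : ℕ → Fin L.k) (n : ℕ) :
    (nd i g n).snoc (g n) = nd i g (n + 1) := by
  refine Node.ext rfl (funext fun x => ?_)
  refine Fin.lastCases ?_ (fun x => ?_) x <;> simp [Node.snoc, nd]

theorem snoc_inj {n : ℕ} {s t : Node L n} {p q : Fin L.k} :
    s.snoc p = t.snoc q ↔ s = t ∧ p = q := by
  refine ⟨fun h => ?_, fun ⟨h1, h2⟩ => h1 ▸ h2 ▸ rfl⟩
  rw [Node.ext_iff] at h
  have h2 : Fin.snoc (α := fun _ => Fin L.k) s.b p = Fin.snoc t.b q := h.2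
  obtain ⟨h3, h4⟩ := Fin.snoc_inj.1 h2
  exact ⟨Node.ext h.1 h3, h4⟩

/-- The values of a node, continued by zeros. -/
def Node.val {n : ℕ} (s : Node L n) (x : ℕ) : Fin L.k := if h : x < n then s.b ⟨x, h⟩ else 0

theorem nd_val {n : ℕ} (s : Node L n) : nd s.u s.val n = s :=
  Node.ext rfl (funext fun x => by simp [nd, Node.val])

theorem Node.val_of_le {n x : ℕ} (s : Node L n) (h : n ≤ x) : s.val x = 0 := by
  simp [Node.val, h]

theorem nodeAt_eq_nd (a m : ℕ) : nodeAt K a m = nd (K.U a) (K.R a) m := rfl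

theorem left_eq_nd (i : Fin L.ku) (m : ℕ) : Node.left i m = nd i (fun _ => 0) m := rfl

/-! ### The lexicographic order -/

namespace Node

variable {n : ℕ}

/-- Nodes of a level as elements of a lexicographic product. -/
def toLexProd (s : Node L n) : Fin L.ku ×ₗ Lex (Fin n → Fin L.k) := toLex (s.u, toLex s.b)

theorem toLexProd_injective : Function.Injective (toLexProd (L := L) (n := n)) := by
  intro s t h
  have h' : (s.u, toLex s.b) = (t.u, toLex t.b) := h
  exact Node.ext (congrArg Prod.fst h') (congrArg Prod.snd h')

theorem lexLT_iff {s t : Node L n} : s.LexLT t ↔ s.toLexProd < t.toLexProd := by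
  rw [toLexProd, toLexProd, Prod.Lex.toLex_lt_toLex]
  rfl

theorem LexLT.ne {s t : Node L n} (h : s.LexLT t) : s ≠ t := by
  rintro rfl
  rw [lexLT_iff] at h
  exact lt_irrefl _ h

theorem LexLT.trans {s t u : Node L n} (h : s.LexLT t) (h' : t.LexLT u) : s.LexLT u := by
  rw [lexLT_iff] at *
  exact h.trans h'

theorem LexLT.asymm {s t : Node L n} (h : s.LexLT t) : ¬ t.LexLT s :=
  fun h' => (h.trans h').ne rfl

end Node

/-- The order is decided at the first difference, so a tuple of rows stays in order when columns are
added. -/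
theorem LexLT_nd_mono {i j : Fin L.ku} {g h : ℕ → Fin L.k} {m n : ℕ} (hmn : m ≤ n)
    (e : (nd i g m).LexLT (nd j h m)) : (nd i g n).LexLT (nd j h n) := by
  rcases e with e | ⟨e, x, h1, h2⟩
  · exact .inl e
  · exact .inr ⟨e, ⟨x, x.2.trans_le hmn⟩, fun y hy => h1 ⟨y, lt_trans hy x.2⟩ hy, h2⟩

theorem snoc_LexLT_self {n : ℕ} (s : Node L n) {p q : Fin L.k} (h : p < q) :
    (s.snoc p).LexLT (s.snoc q) := by
  refine .inr ⟨rfl, Fin.last n, fun y hy => ?_, by simpa [Node.snoc] using h⟩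
  have e : y = Fin.castSucc ⟨y, hy⟩ := rfl
  rw [e]
  simp only [Node.snoc, Fin.snoc_castSucc]

instance (n : ℕ) : Finite (Node L n) :=
  Finite.of_injective (fun s : Node L n => (s.u, s.b)) fun _ _ h =>
    Node.ext (congrArg Prod.fst h) (congrArg Prod.snd h)

theorem exists_isEnum {n : ℕ} (S : Set (Node L n)) : ∃ (d : ℕ) (s : Fin d → Node L n), IsEnum s S := by
  classical
  let T : Finset (Fin L.ku ×ₗ Lex (Fin n → Fin L.k)) := (Set.toFinite (Node.toLexProd '' S)).toFinset
  have hT : ∀ i, ∃ s ∈ S, s.toLexProd = T.orderEmbOfFin rfl i := by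
    intro i
    have h : T.orderEmbOfFin rfl i ∈ T := T.orderEmbOfFin_mem rfl i
    exact (Set.Finite.mem_toFinset (Set.toFinite (Node.toLexProd '' S))).1 h
  choose s hs hs' using hT
  refine ⟨T.card, s, fun i j hij => ?_, Set.Subset.antisymm (by rintro _ ⟨i, rfl⟩; exact hs i) ?_⟩
  · rw [Node.lexLT_iff, hs', hs']
    simpa using hij
  · intro t ht
    have : t.toLexProd ∈ Set.range (T.orderEmbOfFin rfl) := by
      rw [Finset.range_orderEmbOfFin]
      exact (Set.Finite.mem_toFinset _).2 ⟨t, ht, rfl⟩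
    obtain ⟨i, hi⟩ := this
    exact ⟨i, Node.toLexProd_injective ((hs' i).trans hi)⟩

theorem IsEnum.injective {n d : ℕ} {s : Fin d → Node L n} {S : Set (Node L n)} (h : IsEnum s S) :
    Function.Injective s := by
  intro i j hij
  rcases lt_trichotomy i j with h' | h' | h'
  · exact absurd hij (h.1 _ _ h').ne
  · exact h'
  · exact absurd hij.symm (h.1 _ _ h').ne

theorem IsEnum.lt_iff {n d : ℕ} {s : Fin d → Node L n} {S : Set (Node L n)} (h : IsEnum s S)
    {i j : Fin d} : i < j ↔ (s i).LexLT (s j) := by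
  refine ⟨h.1 i j, fun h' => ?_⟩
  rcases lt_trichotomy i j with hl | rfl | hl
  · exact hl
  · exact absurd rfl h'.ne
  · exact absurd (h.1 _ _ hl) h'.asymm

/-- Two enumerations differ by an order isomorphism between `Fin d` and `Fin d'`, which forces `d =
d'` and is then the identity. -/
theorem IsEnum.unique {n d d' : ℕ} {s : Fin d → Node L n} {s' : Fin d' → Node L n}
    {S : Set (Node L n)} (h : IsEnum s S) (h' : IsEnum s' S) : ∃ e : d = d', s = s' ∘ Fin.cast e := by
  have key : ∀ i, ∃ j, s' j = s i := fun i => by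
    have : s i ∈ Set.range s' := h'.2 ▸ h.2 ▸ ⟨i, rfl⟩
    exact this
  have key' : ∀ i, ∃ j, s j = s' i := fun i => by
    have : s' i ∈ Set.range s := h.2 ▸ h'.2 ▸ ⟨i, rfl⟩
    exact this
  choose a ha using key
  choose b hb using key'
  let E : Fin d ≃o Fin d' :=
    { toFun := a
      invFun := b
      left_inv := fun i => h.injective (by rw [hb, ha])
      right_inv := fun i => h'.injective (by rw [ha, hb])
      map_rel_iff' := by
        intro i j
        rw [← not_lt, ← not_lt, not_iff_not]
        show a j < a i ↔ j < i
        rw [h'.lt_iff, h.lt_iff, ha, ha] }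
  have hd : d = d' := by simpa using Fintype.card_congr E.toEquiv
  subst hd
  refine ⟨rfl, ?_⟩
  have : E = OrderIso.refl (Fin d) := Subsingleton.elim _ _
  funext i
  have h1 : a i = i := congrArg (fun e : Fin d ≃o Fin d => e i) this
  rw [← ha i, h1]
  rfl

end CodingTree

/-! ### Ages of gluings, and the use of left density. -/

namespace CodingTree

variable {L : BinLang} {𝓕 : Class L L.ku} {K : Str L L.ku ℕ}

/-! ### Membership in ages -/

/-- The structure with one point, labelled `v`. -/
def FinStr.pt {d : ℕ} (v : Fin d) : FinStr L d where
  carrier := Unit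
  finite := inferInstance
  str := ⟨fun _ => v, fun _ _ => 0, fun _ => rfl, fun _ _ => L.flip_zero.symm⟩

/-- The substructure on the points with labels in `V`, relabelled along `f`. -/
def FinStr.sub {d d₀ : ℕ} (X : FinStr L d) (V : Set (Fin d)) (f : V → Fin d₀) : FinStr L d₀ where
  carrier := {x // X.str.U x ∈ V}
  finite := by
    have := X.finite
    infer_instance
  str := ⟨fun x => f ⟨X.str.U x, x.2⟩, fun x y => X.str.R x y, fun _ => X.str.R_self _,
    fun _ _ => X.str.R_flip _ _⟩

theorem omits_relabel_of_mem_age {d : ℕ} {γ : Gluing L d} {X : FinStr L d} (h : X ∈ γ.age 𝓕) :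
    Omits 𝓕 (X.str.relabel γ.sort) :=
  Omits.of_emb (f := Sum.inr) h ⟨Sum.inr_injective, fun _ => rfl, fun _ _ => rfl⟩

theorem restr_age {d d₀ n : ℕ} (σ : Fin d → Node L n) (e : Fin d₀ → Fin d) :
    restr (age 𝓕 K σ) e = age 𝓕 K (σ ∘ e) := by
  ext X
  exact ⟨fun h => Omits.of_emb (f := id) h ⟨Function.injective_id, by rintro (_ | _) <;> rfl,
    by rintro (_ | _) (_ | _) <;> rfl⟩, fun h => Omits.of_emb (f := id) h
    ⟨Function.injective_id, by rintro (_ | _) <;> rfl, by rintro (_ | _) (_ | _) <;> rfl⟩⟩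

theorem restr_age_one {d n : ℕ} (σ : Fin d → Node L n) (v : Fin d) :
    restr (age 𝓕 K σ) (fun _ : Fin 1 => v) = age₁ 𝓕 K (σ v) := restr_age _ _

theorem restr_mono {d d₀ : ℕ} {A B : Class L d} (h : A ⊆ B) (e : Fin d₀ → Fin d) :
    restr A e ⊆ restr B e := fun _ hX => h hX

/-- Dropping points and merging labels that carry the same node yields a substructure of the glued
structure. -/
theorem sub_mem_age {d d₀ n : ℕ} {σ : Fin d → Node L n} {τ : Fin d₀ → Node L n} {X : FinStr L d}
    {V : Set (Fin d)} {f : V → Fin d₀} (hV : ∀ v : V, σ v = τ (f v)) (hX : X ∈ age 𝓕 K σ) :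
    X.sub V f ∈ age 𝓕 K τ := by
  refine Omits.of_emb (f := Sum.map id Subtype.val) hX
    ⟨Sum.map_injective.2 ⟨Function.injective_id, Subtype.val_injective⟩, ?_, ?_⟩
  · rintro (y | x)
    · rfl
    · exact congrArg Node.u (hV ⟨_, x.2⟩)
  · rintro (y | x) (z | w)
    · rfl
    · exact congrArg L.flip (congrFun (congrArg Node.b (hV ⟨_, w.2⟩)) y)
    · exact congrFun (congrArg Node.b (hV ⟨_, x.2⟩)) z
    · rfl

/-- Only the points whose labels are attached to the gluing matter. -/
theorem Ambient.mem_gluing_age (H : Ambient 𝓕 K) {d d₀ : ℕ} {γ : Gluing L d} {X : FinStr L d}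
    (h : Omits 𝓕 (X.str.relabel γ.sort)) (V : Set (Fin d))
    (hV : ∀ v ∉ V, ∀ x, γ.att v x = 0) (f : V → Fin d₀) {γ' : Gluing L d₀}
    {ψ : Fin γ.size → Fin γ'.size} (hψ : γ.str.IsEmb γ'.str ψ)
    (hs : ∀ v : V, γ'.sort (f v) = γ.sort v)
    (ha : ∀ (v : V) x, γ'.att (f v) (ψ x) = γ.att v x)
    (hm : X.sub V f ∈ γ'.age 𝓕) : X ∈ γ.age 𝓕 := by
  classical
  refine H.omits_of_cliques fun C hC hR => ?_
  by_cases hl : ∃ y, Sum.inl y ∈ C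
  · obtain ⟨y, hy⟩ := hl
    -- A point whose label lies outside `V` is unrelated to the point `y` of the clique.
    have hmem : ∀ x, Sum.inr x ∈ C → X.str.U x ∈ V := by
      intro x hx
      by_contra hx'
      exact hR _ hx _ hy (by simp) (hV _ hx' y)
    refine ⟨_, _, Sum.elim (fun z => Sum.inl (ψ z))
      (fun x => if hx : X.str.U x ∈ V then Sum.inr ⟨x, hx⟩ else Sum.inl (ψ y)), hm, ?_, ?_, ?_⟩
    · rintro (a | a) h1 (b | b) h2 hab
      · simp only [Sum.elim_inl, Sum.inl.injEq] at hab
        rw [hψ.1 hab]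
      · simp [hmem b h2] at hab
      · simp [hmem a h1] at hab
      · simp only [Sum.elim_inr, hmem a h1, hmem b h2, dite_true] at hab
        exact congrArg Sum.inr (congrArg Subtype.val (Sum.inr.inj hab))
    · rintro (a | a) h1
      · exact hψ.2.1 a
      · simp only [Sum.elim_inr, hmem a h1, dite_true]
        exact hs ⟨_, hmem a h1⟩
    · rintro (a | a) h1 (b | b) h2
      · exact hψ.2.2 a b
      · simp only [Sum.elim_inr, Sum.elim_inl, hmem b h2, dite_true]
        exact congrArg L.flip (ha ⟨_, hmem b h2⟩ a)
      · simp only [Sum.elim_inr, Sum.elim_inl, hmem a h1, dite_true]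
        exact ha ⟨_, hmem a h1⟩ b
      · simp only [Sum.elim_inr, hmem a h1, hmem b h2, dite_true]
        rfl
  · have hr : ∀ z ∈ C, ∃ x, z = Sum.inr x := by
      rintro (z | z) hz
      · exact absurd ⟨z, hz⟩ hl
      · exact ⟨z, rfl⟩
    obtain ⟨z₀, hz₀⟩ := hC.nonempty
    obtain ⟨x₀, -⟩ := hr z₀ hz₀
    refine ⟨_, _, Sum.elim (fun _ => x₀) id, h, ?_, ?_, ?_⟩
    · intro a h1 b h2 hab
      obtain ⟨a, rfl⟩ := hr a h1
      obtain ⟨b, rfl⟩ := hr b h2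
      exact congrArg Sum.inr hab
    · intro a h1
      obtain ⟨a, rfl⟩ := hr a h1
      rfl
    · intro a h1 b h2
      obtain ⟨a, rfl⟩ := hr a h1
      obtain ⟨b, rfl⟩ := hr b h2
      rfl

theorem Ambient.mem_extend_age (H : Ambient 𝓕 K) {d d₀ : ℕ} {ρ : Fin d → Fin L.ku}
    {e : Fin d₀ → Fin d} (he : Function.Injective e) {γ : Gluing L d₀}
    (hγ : γ.sort = fun i => ρ (e i)) {X : FinStr L d} (h : Omits 𝓕 (X.str.relabel ρ))
    (hm : X.sub (Set.range e) (fun v => v.2.choose) ∈ γ.age 𝓕) :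
    X ∈ (Gluing.extend ρ e γ).age 𝓕 := by
  refine H.mem_gluing_age (γ := Gluing.extend ρ e γ) (γ' := γ) h (Set.range e) ?_ _ (ψ := id)
    ⟨Function.injective_id, fun _ => rfl, fun _ _ => rfl⟩ ?_ ?_ hm
  · intro v hv x
    simp only [Gluing.extend]
    rw [Function.extend_apply' _ _ _ (fun h => hv h)]
  · intro v
    rw [hγ]
    exact congrArg ρ v.2.choose_spec
  · intro v x
    simp only [Gluing.extend]
    conv_rhs => rw [← v.2.choose_spec, he.extend_apply]
    rfl

theorem restr_extend_age {d d₀ : ℕ} {ρ : Fin d → Fin L.ku} {e : Fin d₀ → Fin d}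
    (he : Function.Injective e) {γ : Gluing L d₀} (hγ : γ.sort = fun i => ρ (e i)) :
    restr ((Gluing.extend ρ e γ).age 𝓕) e = γ.age 𝓕 := by
  have h : ∀ v x, Function.extend e γ.att (fun _ _ => 0) (e v) x = γ.att v x := fun v x =>
    congrFun (he.extend_apply _ _ _) x
  ext X
  refine ⟨fun hX => Omits.of_emb (f := id) hX ⟨Function.injective_id, ?_, ?_⟩,
    fun hX => Omits.of_emb (f := id) hX ⟨Function.injective_id, ?_, ?_⟩⟩
  · rintro (_ | _)
    · rfl
    · exact (congrFun hγ _).symm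
  · rintro (_ | _) (_ | _)
    · rfl
    · exact congrArg L.flip (h _ _)
    · exact h _ _
    · rfl
  · rintro (_ | _)
    · rfl
    · exact congrFun hγ _
  · rintro (_ | _) (_ | _)
    · rfl
    · exact congrArg L.flip (h _ _).symm
    · exact (h _ _).symm
    · rfl

/-! ### Realizing nodes, and left-leaning copies -/

theorem pt_mem_of_realized (H : Ambient 𝓕 K) {n a : ℕ} (h : n ≤ a) :
    FinStr.pt 0 ∈ age₁ 𝓕 K (nodeAt K a n) := by
  refine Omits.of_emb (f := Sum.elim Fin.val (fun _ => a)) H.omits ⟨?_, ?_, ?_⟩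
  · rintro (x | x) (y | y) hxy
    · exact congrArg Sum.inl (Fin.val_injective hxy)
    · exact absurd hxy (x.2.trans_le h).ne
    · exact absurd hxy.symm (y.2.trans_le h).ne
    · rfl
  · rintro (x | x) <;> rfl
  · rintro (x | x) (y | y)
    · rfl
    · exact K.R_flip _ _
    · rfl
    · exact K.R_self _

theorem pt_mem_age_iff {d n : ℕ} {σ : Fin d → Node L n} {v : Fin d} :
    FinStr.pt v ∈ age 𝓕 K σ ↔ FinStr.pt 0 ∈ age₁ 𝓕 K (σ v) := by
  rw [← restr_age_one]
  rfl

/-- Left density: a consistent node is realized by a point unrelated to the points before it above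
the level of the node. -/
theorem Ambient.realize (H : Ambient 𝓕 K) {m : ℕ} {s : Node L m}
    (h : FinStr.pt 0 ∈ age₁ 𝓕 K s) :
    ∃ a, m ≤ a ∧ nodeAt K a m = s ∧ ∀ r, m ≤ r → r < a → K.R a r = 0 := by
  classical
  let W := (nodeGluing K (fun _ : Fin 1 => s)).glue (FinStr.pt (L := L) (0 : Fin 1)).str
  -- The glued structure is enumerated with the new point last, to make it a one-point extension of
  -- an initial segment.
  let e : Fin (m + 1) → Fin m ⊕ Unit := fun x => if h : (x : ℕ) < m then .inl ⟨x, h⟩ else .inr ()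
  have he : Function.Injective e := by
    intro x y hxy
    by_cases hx : (x : ℕ) < m <;> by_cases hy : (y : ℕ) < m
    · simp only [e, hx, hy, dite_true, Sum.inl.injEq, Fin.mk.injEq] at hxy
      exact Fin.ext hxy
    · simp [e, hx, hy] at hxy
    · simp [e, hx, hy] at hxy
    · exact Fin.ext (by omega)
  have hc : ∀ x : Fin m, e x.castSucc = .inl x := fun x => by simp [e]
  have hl : e (Fin.last m) = .inr () := by simp [e]
  obtain ⟨f, hf, hid, h0⟩ := H.dense m (W.comap e)
    (Omits.of_emb (S := W.comap e) h (Str.isEmb_comap he)) (by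
      have h1 : ((W.comap e).comap (Fin.castSucc : Fin m → _)).U = (K.comap (Fin.val : Fin m → ℕ)).U := by
        funext x
        show W.U (e x.castSucc) = _
        rw [hc]
        rfl
      have h2 : ((W.comap e).comap (Fin.castSucc : Fin m → _)).R = (K.comap (Fin.val : Fin m → ℕ)).R := by
        funext x y
        show W.R (e x.castSucc) (e y.castSucc) = _
        rw [hc, hc]
        rfl
      generalize (W.comap e).comap (Fin.castSucc : Fin m → _) = S at h1 h2
      generalize K.comap (Fin.val : Fin m → ℕ) = T at h1 h2
      cases S
      cases T
      cases h1
      cases h2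
      rfl)
  refine ⟨f (Fin.last m), ?_, ?_, h0⟩
  · rcases Nat.eq_zero_or_pos m with rfl | hm
    · exact Nat.zero_le _
    · have := hf.1 (show Fin.castSucc (⟨m - 1, by omega⟩ : Fin m) < Fin.last m from
        Fin.castSucc_lt_last _)
      rw [hid] at this
      simp only at this
      omega
  · refine Node.ext ?_ (funext fun x => ?_)
    · have := hf.2.2.1 (Fin.last m)
      rw [show (W.comap e).U (Fin.last m) = W.U (e (Fin.last m)) from rfl, hl] at this
      exact this
    · have := hf.2.2.2 (Fin.last m) x.castSucc
      rw [show (W.comap e).R (Fin.last m) x.castSucc = W.R (e (Fin.last m)) (e x.castSucc) from rfl,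
        hl, hc, hid] at this
      exact this

theorem Ambient.mem_lev_univ (H : Ambient 𝓕 K) {n : ℕ} {s : Node L n} :
    s ∈ lev K Set.univ n ↔ FinStr.pt 0 ∈ age₁ 𝓕 K s := by
  refine ⟨?_, fun h => ?_⟩
  · rintro ⟨a, -, ha, rfl⟩
    exact pt_mem_of_realized H ha
  · obtain ⟨a, ha, h1, -⟩ := H.realize h
    exact ⟨a, trivial, ha, h1⟩

/-- Points are added one by one. The node attaching the next point to the copy found so far, and
zero elsewhere, is consistent, and `realize` adds only zeros above its level, so the copy stays
left-leaning. -/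
theorem Ambient.exists_left_leaning (H : Ambient 𝓕 K) {e : ℕ} (I : Str L L.ku (Fin e))
    (hI : Omits 𝓕 I) (N : ℕ) : ∃ φ, IsOLEmb I K φ ∧ ∀ x, N ≤ φ x := by
  classical
  induction e with
  | zero => exact ⟨Fin.elim0, ⟨⟨fun a => a.elim0, fun a => a.elim0, fun a => a.elim0,
      fun a => a.elim0⟩, fun a => a.elim0⟩, fun a => a.elim0⟩
  | succ e ih =>
    obtain ⟨φ, ⟨⟨hmono, hinj, hU, hR⟩, hleft⟩, hN⟩ := ih (I.comap Fin.castSucc)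
      (Omits.of_emb hI (Str.isEmb_comap (Fin.castSucc_injective e)))
    obtain ⟨M, hM⟩ : ∃ M, N ≤ M ∧ ∀ x, φ x < M := by
      refine ⟨max N ((Finset.univ.sup φ) + 1), le_max_left _ _, fun x => ?_⟩
      exact lt_max_of_lt_right (Nat.lt_succ_of_le (Finset.le_sup (Finset.mem_univ x)))
    let g : ℕ → Fin L.k := fun y => if h : ∃ x, φ x = y then I.R (Fin.last e) h.choose.castSucc else 0
    have hg : ∀ x, g (φ x) = I.R (Fin.last e) x.castSucc := by
      intro x
      have hx : ∃ x', φ x' = φ x := ⟨x, rfl⟩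
      simp only [g, hx, dite_true]
      rw [hinj hx.choose_spec]
    have hg0 : ∀ y, y ∉ Set.range φ → g y = 0 := fun y hy => dif_neg hy
    -- A clique through the new point lies in a copy of part of `I`; any other clique lies in `K`.
    have hreal : FinStr.pt 0 ∈ age₁ 𝓕 K (nd (I.U (Fin.last e)) g M) := by
      refine H.omits_of_cliques fun C hC hCR => ?_
      by_cases hr : Sum.inr () ∈ C
      · have hC' : ∀ y, Sum.inl y ∈ C → ∃ x, φ x = (y : ℕ) := by
          intro y hy
          by_contra hy'
          exact hCR _ hr _ hy Sum.inr_ne_inl (hg0 y hy')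
        refine ⟨_, I, Sum.elim (fun y => if h : ∃ x, φ x = (y : ℕ) then h.choose.castSucc else 0)
          (fun _ => Fin.last e), hI, ?_, ?_, ?_⟩
        · rintro (a | a) h1 (b | b) h2 hab
          · have ha := hC' a h1
            have hb := hC' b h2
            simp only [Sum.elim_inl, ha, hb, dite_true] at hab
            have := Fin.castSucc_injective _ hab
            have h3 := hb.choose_spec
            rw [← this, ha.choose_spec] at h3
            exact congrArg Sum.inl (Fin.ext h3)
          · have ha := hC' a h1
            simp only [Sum.elim_inl, Sum.elim_inr, ha, dite_true] at hab
            exact absurd hab (Fin.castSucc_lt_last _).ne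
          · have hb := hC' b h2
            simp only [Sum.elim_inl, Sum.elim_inr, hb, dite_true] at hab
            exact absurd hab.symm (Fin.castSucc_lt_last _).ne
          · rfl
        · rintro (a | a) h1
          · have ha := hC' a h1
            simp only [Sum.elim_inl, ha, dite_true]
            rw [show I.U ha.choose.castSucc = (I.comap Fin.castSucc).U ha.choose from rfl,
              ← hU, ha.choose_spec]
            rfl
          · rfl
        · rintro (a | a) h1 (b | b) h2
          · have ha := hC' a h1
            have hb := hC' b h2
            simp only [Sum.elim_inl, ha, hb, dite_true]
            rw [show I.R ha.choose.castSucc hb.choose.castSucc =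
              (I.comap Fin.castSucc).R ha.choose hb.choose from rfl,
              ← hR, ha.choose_spec, hb.choose_spec]
            rfl
          · have ha := hC' a h1
            simp only [Sum.elim_inl, Sum.elim_inr, ha, dite_true]
            rw [I.R_flip (Fin.last e), ← hg, ha.choose_spec]
            rfl
          · have hb := hC' b h2
            simp only [Sum.elim_inl, Sum.elim_inr, hb, dite_true]
            rw [← hg, hb.choose_spec]
            rfl
          · exact I.R_self _
      · refine ⟨_, K, Sum.elim Fin.val (fun _ => 0), H.omits, ?_, ?_, ?_⟩
        · rintro (a | a) h1 (b | b) h2 hab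
          · exact congrArg Sum.inl (Fin.ext hab)
          · exact absurd h2 hr
          · exact absurd h1 hr
          · exact absurd h1 hr
        · rintro (a | a) h1
          · rfl
          · exact absurd h1 hr
        · rintro (a | a) h1 (b | b) h2
          · rfl
          · exact absurd h2 hr
          · exact absurd h1 hr
          · exact absurd h1 hr
    obtain ⟨a, ha, hnode, h0⟩ := H.realize hreal
    have hnode' : K.U a = I.U (Fin.last e) ∧ ∀ x < M, K.R a x = g x := by
      rw [nodeAt_eq_nd, nd_eq_iff] at hnode
      exact hnode
    have hφ : ∀ x, φ x < a := fun x => (hM.2 x).trans_le ha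
    have hRa : ∀ x, K.R a (φ x) = I.R (Fin.last e) x.castSucc := fun x => by
      rw [hnode'.2 _ (hM.2 x), hg]
    let φ' : Fin (e + 1) → ℕ := Fin.snoc φ a
    have hφc : ∀ x : Fin e, φ' x.castSucc = φ x := fun x => by simp [φ']
    have hφl : φ' (Fin.last e) = a := by simp [φ']
    have hmono' : StrictMono φ' := by
      intro x y hxy
      induction y using Fin.lastCases with
      | last =>
        obtain ⟨x, rfl⟩ := Fin.exists_castSucc_eq.2 hxy.ne
        rw [hφc, hφl]
        exact hφ x
      | cast y =>
        have hx : x ≠ Fin.last e := (hxy.trans (Fin.castSucc_lt_last _)).ne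
        obtain ⟨x, rfl⟩ := Fin.exists_castSucc_eq.2 hx
        rw [hφc, hφc]
        exact hmono (by simpa using hxy)
    refine ⟨φ', ⟨⟨hmono', hmono'.injective, fun x => ?_, fun x y => ?_⟩, fun x y hy hxy => ?_⟩,
      fun x => ?_⟩
    · induction x using Fin.lastCases with
      | last => rw [hφl, hnode'.1]
      | cast x => rw [hφc]; exact hU x
    · induction x using Fin.lastCases with
      | last =>
        induction y using Fin.lastCases with
        | last => rw [K.R_self, I.R_self]
        | cast y => rw [hφc, hφl, hRa]
      | cast x =>
        induction y using Fin.lastCases with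
        | last => rw [hφc, hφl, K.R_flip a, hRa, ← I.R_flip]
        | cast y => rw [hφc, hφc]; exact hR x y
    · induction x using Fin.lastCases with
      | last =>
        rw [hφl] at hy hxy
        have hyM : y < M := by
          by_contra h
          exact hxy (h0 y (not_lt.1 h) hy)
        rw [hnode'.2 y hyM] at hxy
        by_contra h
        refine hxy (hg0 y fun ⟨z, hz⟩ => h ⟨z.castSucc, ?_⟩)
        rw [hφc, hz]
      | cast x =>
        rw [hφc] at hy hxy
        obtain ⟨z, hz⟩ := hleft x y hy hxy
        exact ⟨z.castSucc, by rw [hφc, hz]⟩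
    · induction x using Fin.lastCases with
      | last => rw [hφl]; exact hM.1.trans ha
      | cast x => rw [hφc]; exact hN x

end CodingTree

/-! ### How ages change along nodes; finiteness of the posets of ages; causes. -/

namespace CodingTree

variable {L : BinLang} {𝓕 : Class L L.ku} {K : Str L L.ku ℕ}

/-! ### Ages and extensions of nodes -/

/-- The gluing without attached structure. -/
def Gluing.bare {d : ℕ} (ρ : Fin d → Fin L.ku) : Gluing L d :=
  ⟨ρ, 0, fun _ x => x.elim0, ⟨fun x => x.elim0, fun x => x.elim0, fun x => x.elim0,
    fun x => x.elim0⟩⟩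

/-- The gluing restricted to the first `e` points of the attached structure. -/
def Gluing.trunc {d : ℕ} (γ : Gluing L d) (e : ℕ) (he : e ≤ γ.size) : Gluing L d :=
  ⟨γ.sort, e, fun v x => γ.att v (x.castLE he), γ.str.comap (Fin.castLE he)⟩

theorem mem_bare_age {d : ℕ} {ρ : Fin d → Fin L.ku} {X : FinStr L d} :
    X ∈ (Gluing.bare ρ).age 𝓕 ↔ Omits 𝓕 (X.str.relabel ρ) := by
  refine ⟨omits_relabel_of_mem_age (γ := Gluing.bare ρ), fun h => ?_⟩
  refine Omits.of_emb (f := Sum.elim (fun x : Fin 0 => x.elim0) id) h ⟨?_, ?_, ?_⟩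
  · rintro (a | a) (b | b) hab
    exacts [a.elim0, a.elim0, b.elim0, congrArg Sum.inr hab]
  · rintro (a | a)
    exacts [a.elim0, rfl]
  · rintro (a | a) (b | b)
    exacts [a.elim0, a.elim0, b.elim0, rfl]

theorem isEmb_castLE {d n n' : ℕ} (hn : n ≤ n') (ν : Fin d → Fin L.ku) (g : Fin d → ℕ → Fin L.k)
    (X : FinStr L d) : ((nodeGluing K (fun v => nd (ν v) (g v) n)).glue X.str).IsEmb
      ((nodeGluing K (fun v => nd (ν v) (g v) n')).glue X.str) (Sum.map (Fin.castLE hn) id) := by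
  refine ⟨Sum.map_injective.2 ⟨Fin.castLE_injective hn, Function.injective_id⟩, ?_, ?_⟩
  · rintro (_ | _) <;> rfl
  · rintro (_ | _) (_ | _) <;> rfl

theorem age_anti {d n n' : ℕ} (hn : n ≤ n') (ν : Fin d → Fin L.ku) (g : Fin d → ℕ → Fin L.k) :
    age 𝓕 K (fun v => nd (ν v) (g v) n') ⊆ age 𝓕 K (fun v => nd (ν v) (g v) n) :=
  fun X hX => Omits.of_emb hX (isEmb_castLE hn ν g X)

theorem age₁_anti {n n' : ℕ} (hn : n ≤ n') (i : Fin L.ku) (g : ℕ → Fin L.k) :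
    age₁ 𝓕 K (nd i g n') ⊆ age₁ 𝓕 K (nd i g n) :=
  age_anti hn (fun _ : Fin 1 => i) (fun _ => g)

theorem Ambient.omits_comap_val (H : Ambient 𝓕 K) (n : ℕ) :
    Omits 𝓕 (K.comap (Fin.val : Fin n → ℕ)) :=
  H.omits.of_emb (Str.isEmb_comap Fin.val_injective)

/-- Passing a left-leaning copy of the structure of a gluing. -/
theorem Ambient.age_pass (H : Ambient 𝓕 K) {d n n' : ℕ} (hn : n ≤ n') {ν : Fin d → Fin L.ku}
    {g : Fin d → ℕ → Fin L.k} {γ : Gluing L d} (hs : γ.sort = ν) {φ : Fin γ.size → ℕ}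
    (hφ : IsOLEmb γ.str K φ) (hhi : ∀ x, φ x < n')
    (ha : ∀ v x, g v (φ x) = γ.att v x)
    (h0 : ∀ v y, n ≤ y → y < n' → y ∉ Set.range φ → g v y = 0) :
    age 𝓕 K (fun v => nd (ν v) (g v) n') = age 𝓕 K (fun v => nd (ν v) (g v) n) ∩ γ.age 𝓕 := by
  classical
  subst hs
  have hinj := hφ.1.2.1
  have hemb₁ := isEmb_castLE (K := K) hn γ.sort g
  have hemb₂ : ∀ X : FinStr L d, (γ.glue X.str).IsEmb
      ((nodeGluing K (fun v => nd (γ.sort v) (g v) n')).glue X.str)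
      (Sum.map (fun x => (⟨φ x, hhi x⟩ : Fin n')) id) := by
    intro X
    refine ⟨Sum.map_injective.2 ⟨fun x y h => hinj (congrArg Fin.val h), Function.injective_id⟩,
      ?_, ?_⟩
    · rintro (x | _)
      · exact hφ.1.2.2.1 x
      · rfl
    · rintro (x | x) (y | y)
      · exact hφ.1.2.2.2 x y
      · exact congrArg L.flip (ha _ _)
      · exact ha _ _
      · rfl
  refine Set.Subset.antisymm (Set.subset_inter (age_anti hn _ _) fun X hX =>
    Omits.of_emb hX (hemb₂ X)) ?_
  · rintro X ⟨h1, h2⟩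
    refine H.omits_of_covered fun C hC hR => ?_
    by_cases hr : ∃ b, Sum.inr b ∈ C
    · obtain ⟨b₀, hb₀⟩ := hr
      have hy : ∀ y : Fin n', Sum.inl y ∈ C → (y : ℕ) < n ∨ ∃ x, φ x = (y : ℕ) := by
        intro y hy
        by_contra hcon
        simp only [not_or, not_lt] at hcon
        exact hR _ hb₀ _ hy Sum.inr_ne_inl (h0 _ y hcon.1 y.2 hcon.2)
      -- Either the clique meets `K` only below `n`, and the old age covers it, or it contains a
      -- point of the copy, and the age of the gluing covers it.
      by_cases hlow : ∀ y : Fin n', Sum.inl y ∈ C → (y : ℕ) < n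
      · refine ⟨_, _, Sum.map (Fin.castLE hn) id, h1, hemb₁ X, ?_⟩
        rintro (y | x) hz
        · exact ⟨.inl ⟨y, hlow y hz⟩, rfl⟩
        · exact ⟨.inr x, rfl⟩
      · simp only [not_forall, not_lt] at hlow
        obtain ⟨y₀, hy₀, hny₀⟩ := hlow
        obtain ⟨x₀, hx₀⟩ := (hy y₀ hy₀).resolve_left (by omega)
        refine ⟨_, _, Sum.map (fun x => (⟨φ x, hhi x⟩ : Fin n')) id, h2, hemb₂ X, ?_⟩
        rintro (y | x) hz
        · obtain ⟨x, hx⟩ : ∃ x, φ x = (y : ℕ) := by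
            rcases hy y hz with hyn | h
            · have hne : K.R (φ x₀) y ≠ 0 := by
                rw [hx₀]
                exact hR _ hy₀ _ hz (fun h => by
                  have := congrArg Fin.val (Sum.inl.inj h)
                  omega)
              exact hφ.2 x₀ y (by omega) hne
            · exact h
          exact ⟨.inl x, congrArg Sum.inl (Fin.ext hx)⟩
        · exact ⟨.inr x, rfl⟩
    · refine ⟨_, _, Sum.inl, H.omits_comap_val n', ⟨Sum.inl_injective, fun _ => rfl,
        fun _ _ => rfl⟩, ?_⟩
      rintro (y | x) hz
      · exact ⟨y, rfl⟩
      · exact absurd ⟨x, hz⟩ hr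

/-- This is `age_pass` for the empty gluing, whose age imposes nothing new. -/
theorem Ambient.age_zero (H : Ambient 𝓕 K) {d n n' : ℕ} (hn : n ≤ n') {ν : Fin d → Fin L.ku}
    {g : Fin d → ℕ → Fin L.k} (h0 : ∀ v y, n ≤ y → y < n' → g v y = 0) :
    age 𝓕 K (fun v => nd (ν v) (g v) n') = age 𝓕 K (fun v => nd (ν v) (g v) n) := by
  rw [H.age_pass hn (ν := ν) (g := g) (γ := Gluing.bare ν) rfl (φ := fun x => x.elim0)
    ⟨⟨fun a => a.elim0, fun a => a.elim0, fun a => a.elim0, fun a => a.elim0⟩, fun a => a.elim0⟩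
    (fun a => a.elim0) (fun _ a => a.elim0) (fun v y h1 h2 _ => h0 v y h1 h2)]
  exact Set.inter_eq_left.2 fun X hX => mem_bare_age.2 (omits_relabel_of_mem_age hX)

/-- Without relations between the two parts, no non-trivial clique meets both of them. -/
theorem Ambient.mem_age_left (H : Ambient 𝓕 K) {d n : ℕ} {ν : Fin d → Fin L.ku} {X : FinStr L d} :
    X ∈ age 𝓕 K (fun v => Node.left (ν v) n) ↔ Omits 𝓕 (X.str.relabel ν) := by
  refine ⟨fun h => omits_relabel_of_mem_age h, fun h => ?_⟩
  have := H.age_zero (n := 0) (n' := n) (Nat.zero_le _) (ν := ν) (g := fun _ _ => 0)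
    (fun _ _ _ _ => rfl)
  have h2 : X ∈ age 𝓕 K (fun v => nd (ν v) (fun _ => 0) n) := by
    rw [this]
    exact Omits.of_emb (f := id) (mem_bare_age.2 h) ⟨Function.injective_id, by
      rintro (x | x)
      exacts [x.elim0, rfl], by
      rintro (x | x) (y | y)
      exacts [x.elim0, x.elim0, y.elim0, rfl]⟩
  exact h2

/-- The class of all structures of sort `i` and rank one. -/
theorem Ambient.mem_age₁_left (H : Ambient 𝓕 K) {i : Fin L.ku} {n : ℕ} {X : FinStr L 1} :
    X ∈ age₁ 𝓕 K (Node.left i n) ↔ Omits 𝓕 (X.str.relabel (sort₁ i)) :=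
  H.mem_age_left (ν := sort₁ i)

theorem Ambient.age₁_left (H : Ambient 𝓕 K) (i : Fin L.ku) (n : ℕ) :
    age₁ 𝓕 K (Node.left i n) = age₁ 𝓕 K (Node.left i 0) := by
  ext X
  rw [H.mem_age₁_left, H.mem_age₁_left]

theorem Ambient.omits_single (H : Ambient 𝓕 K) {X : Type} [Subsingleton X] (S : Str L L.ku X) :
    Omits 𝓕 S :=
  H.omits_of_cliques fun _ ⟨_, _, _, _, hab⟩ => absurd (Subsingleton.elim _ _) hab

/-! ### The posets of ages -/

theorem Ambient.pt_mem_ages (H : Ambient 𝓕 K) {d : ℕ} {ρ : Fin d → Fin L.ku} {A : Class L d}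
    (hA : A ∈ ages 𝓕 K ρ) (v : Fin d) : FinStr.pt v ∈ A := by
  obtain ⟨n, s, -, h, -, rfl⟩ := hA
  exact pt_mem_age_iff.2 (H.mem_lev_univ.1 (h v))

theorem omits_of_mem_ages {d : ℕ} {ρ : Fin d → Fin L.ku} {A : Class L d}
    (hA : A ∈ ages 𝓕 K ρ) {X : FinStr L d} (hX : X ∈ A) : Omits 𝓕 (X.str.relabel ρ) := by
  obtain ⟨n, s, -, -, h, rfl⟩ := hA
  obtain rfl : (fun i => (s i).u) = ρ := funext h
  exact omits_relabel_of_mem_age hX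

theorem sub_mem_restr {d d₀ : ℕ} {ρ : Fin d → Fin L.ku} {A : Class L d}
    (hA : A ∈ ages 𝓕 K ρ) {X : FinStr L d} (hX : X ∈ A) {V : Set (Fin d)} {f : V → Fin d₀}
    {e : Fin d₀ → Fin d} (hV : ∀ v : V, e (f v) = v) : X.sub V f ∈ restr A e := by
  obtain ⟨n, s, -, -, -, rfl⟩ := hA
  rw [restr_age]
  exact sub_mem_age (fun v => by simp [hV v]) hX

theorem restr_mem_ages {d d₀ : ℕ} {ρ : Fin d → Fin L.ku} {A : Class L d}
    (hA : A ∈ ages 𝓕 K ρ) {e : Fin d₀ → Fin d} (he : StrictMono e) :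
    restr A e ∈ ages 𝓕 K (fun i => ρ (e i)) := by
  obtain ⟨n, s, h1, h2, h3, rfl⟩ := hA
  exact ⟨n, s ∘ e, fun i j hij => h1 _ _ (he hij), fun i => h2 _, fun i => h3 _,
    (restr_age _ _).symm⟩

theorem restr_one_mem {d : ℕ} {ρ : Fin d → Fin L.ku} {A : Class L d}
    (hA : A ∈ ages 𝓕 K ρ) (v : Fin d) : restr A (fun _ : Fin 1 => v) ∈ P₁ 𝓕 K (ρ v) :=
  restr_mem_ages hA (Subsingleton.strictMono _)

theorem Ambient.subset_extend_age (H : Ambient 𝓕 K) {d d₀ : ℕ} {ρ : Fin d → Fin L.ku}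
    {B : Class L d} (hB : B ∈ ages 𝓕 K ρ) {e : Fin d₀ → Fin d} (he : Function.Injective e)
    {γ : Gluing L d₀} (hγ : γ.sort = fun i => ρ (e i)) (h : restr B e ⊆ γ.age 𝓕) :
    B ⊆ (Gluing.extend ρ e γ).age 𝓕 := fun _ hX =>
  H.mem_extend_age he hγ (omits_of_mem_ages hB hX)
    (h (sub_mem_restr hB hX fun v => v.2.choose_spec))

/-- The nodes are continued by the attachments of `γ` along a left-leaning copy of its structure and
by zeros elsewhere. `age_pass` computes the new age, and `hp` keeps the longer nodes consistent,
hence realized. -/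
theorem Ambient.inter_mem_ages (H : Ambient 𝓕 K) {d : ℕ} {ρ : Fin d → Fin L.ku}
    {A : Class L d} (hA : A ∈ ages 𝓕 K ρ) {γ : Gluing L d} (hs : γ.sort = ρ)
    (hγ : Omits 𝓕 γ.str) (hp : ∀ v, FinStr.pt v ∈ γ.age 𝓕) : A ∩ γ.age 𝓕 ∈ ages 𝓕 K ρ := by
  classical
  have hpA := fun v => H.pt_mem_ages hA v
  obtain ⟨n, s, h1, -, h3, rfl⟩ := hA
  obtain rfl : (fun i => (s i).u) = ρ := funext h3
  obtain ⟨φ, hφ, hlo⟩ := H.exists_left_leaning γ.str hγ n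
  obtain ⟨n', hn, hhi⟩ : ∃ n', n ≤ n' ∧ ∀ x, φ x < n' :=
    ⟨max n ((Finset.univ.sup φ) + 1), le_max_left _ _, fun x =>
      lt_max_of_lt_right (Nat.lt_succ_of_le (Finset.le_sup (Finset.mem_univ x)))⟩
  let g : Fin d → ℕ → Fin L.k := fun v y =>
    if h : ∃ x, φ x = y then γ.att v h.choose else (s v).val y
  have hg : ∀ v x, g v (φ x) = γ.att v x := fun v x => by
    have hx : ∃ x', φ x' = φ x := ⟨x, rfl⟩
    simp only [g, hx, dite_true]
    rw [hφ.1.2.1 hx.choose_spec]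
  have hgs : ∀ v, nd (s v).u (g v) n = s v := fun v => by
    conv_rhs => rw [← nd_val (s v)]
    rw [nd_eq_iff]
    refine ⟨rfl, fun x hx => dif_neg fun ⟨y, hy⟩ => ?_⟩
    have := hlo y
    omega
  have key := H.age_pass hn (ν := fun v => (s v).u) (g := g) hs hφ hhi hg (fun v y h1 h2 h3 =>
    (dif_neg h3).trans (Node.val_of_le _ h1))
  simp only [hgs] at key
  refine ⟨n', fun v => nd (s v).u (g v) n', fun i j hij => ?_, fun v => ?_, fun _ => rfl, key⟩
  · refine LexLT_nd_mono hn ?_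
    rw [hgs, hgs]
    exact h1 i j hij
  · rw [H.mem_lev_univ]
    refine pt_mem_age_iff (σ := fun v => nd (s v).u (g v) n') |>.1 ?_
    rw [key]
    exact ⟨hpA v, hp v⟩

/-- A structure outside the age of a gluing is outside the age of a gluing of a piece. -/
theorem exists_piece {d : ℕ} {γ : Gluing L d} {X : FinStr L d} (hX : X ∉ γ.age 𝓕) :
    ∃ γ' : Gluing L d, γ'.sort = γ.sort ∧ γ.age 𝓕 ⊆ γ'.age 𝓕 ∧ X ∉ γ'.age 𝓕 ∧
      (∃ h, γ'.str.IsEmb γ.str h) ∧ ∃ F ∈ 𝓕, (∃ f, γ'.str.IsEmb F.str f) ∧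
        γ'.size ≤ Nat.card F.carrier := by
  classical
  simp only [Gluing.age, Set.mem_ofPred_eq, Omits, not_forall, not_not] at hX
  obtain ⟨F, hF, f, hf⟩ := hX
  have := F.finite
  -- The piece is the trace on the gluing of an embedded forbidden structure.
  let I : Finset (Fin γ.size) := Finset.univ.filter fun y => Sum.inl y ∈ Set.range f
  let ψ : Fin I.card ≃ I := I.equivFin.symm
  have hψ : Function.Injective (fun x => (ψ x : Fin γ.size)) :=
    Subtype.val_injective.comp ψ.injective
  have hmem : ∀ x, ∃ a, f a = Sum.inl (ψ x : Fin γ.size) := fun x => by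
    have := (ψ x).2
    simpa [I] using this
  choose p hp using hmem
  let γ' : Gluing L d := ⟨γ.sort, I.card, fun v x => γ.att v (ψ x), γ.str.comap fun x => (ψ x : _)⟩
  have hemb : ∀ Y : FinStr L d, (γ'.glue Y.str).IsEmb (γ.glue Y.str)
      (Sum.map (fun x => (ψ x : Fin γ.size)) id) := by
    intro Y
    refine ⟨Sum.map_injective.2 ⟨hψ, Function.injective_id⟩, ?_, ?_⟩
    · rintro (_ | _) <;> rfl
    · rintro (_ | _) (_ | _) <;> rfl
  have hpe : γ'.str.IsEmb F.str p := by
    refine ⟨fun x y hxy => hψ (Sum.inl.inj ((hp x).symm.trans ((congrArg f hxy).trans (hp y)))),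
      fun x => ?_, fun x y => ?_⟩
    · rw [← hf.2.1, hp]
      rfl
    · rw [← hf.2.2, hp, hp]
      rfl
  refine ⟨γ', rfl, fun Y hY => Omits.of_emb hY (hemb Y), fun hXm => ?_, ⟨_, Str.isEmb_comap hψ⟩,
    F, hF, ⟨p, hpe⟩, ?_⟩
  · have hlift : ∀ a, ∃ z : Fin I.card ⊕ X.carrier,
        Sum.map (fun x => (ψ x : Fin γ.size)) id z = f a := by
      intro a
      rcases hfa : f a with y | x
      · have hy : y ∈ I := by simpa [I] using ⟨a, hfa⟩
        exact ⟨.inl (ψ.symm ⟨y, hy⟩), by simp⟩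
      · exact ⟨.inr x, rfl⟩
    choose z hz using hlift
    refine hXm F hF ⟨z, fun a b hab => hf.1 ?_, fun a => ?_, fun a b => ?_⟩
    · rw [← hz, ← hz, hab]
    · rw [← hf.2.1, ← hz, (hemb X).2.1]
    · rw [← hf.2.2, ← hz, ← hz, (hemb X).2.2]
  · have := Nat.card_le_card_of_injective p hpe.1
    simpa [γ'] using this

theorem finite_gluing (d N : ℕ) : {γ : Gluing L d | γ.size ≤ N}.Finite := by
  let T := Σ n : Fin (N + 1), (Fin d → Fin L.ku) × (Fin d → Fin n → Fin L.k) ×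
    (Fin n → Fin L.ku) × (Fin n → Fin n → Fin L.k)
  let F : {γ : Gluing L d | γ.size ≤ N} → T := fun γ =>
    ⟨⟨γ.1.size, Nat.lt_succ_of_le γ.2⟩, γ.1.sort, γ.1.att, γ.1.str.U, γ.1.str.R⟩
  have : Finite {γ : Gluing L d | γ.size ≤ N} := by
    refine Finite.of_injective F ?_
    rintro ⟨⟨s, n, a, ⟨U, R, h1, h2⟩⟩, h⟩ ⟨⟨s', n', a', ⟨U', R', h1', h2'⟩⟩, h'⟩ hF
    have hn : n = n' := congrArg (fun z : T => (z.1 : ℕ)) hF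
    subst hn
    have hF' := eq_of_heq (Sigma.mk.inj hF).2
    simp only [Prod.mk.injEq] at hF'
    obtain ⟨rfl, h3, h4, h5⟩ := hF'
    have e3 : a = a' := h3
    have e4 : U = U' := h4
    have e5 : R = R' := h5
    subst e3 e4 e5
    rfl
  exact Set.toFinite _

/-- By `exists_piece`, an age is determined by the gluings of size at most `N` whose ages contain
it, and there are only finitely many gluings of that size. -/
theorem Ambient.finite_ages (H : Ambient 𝓕 K) {d : ℕ} (ρ : Fin d → Fin L.ku) :
    (ages 𝓕 K ρ).Finite := by
  obtain ⟨N, hN⟩ : ∃ N, ∀ F ∈ 𝓕, Nat.card F.carrier ≤ N := by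
    obtain ⟨N, hN⟩ := (H.fin.image fun F => Nat.card F.carrier).bddAbove
    exact ⟨N, fun F hF => hN ⟨F, hF, rfl⟩⟩
  let Φ : Class L d → Set (Gluing L d) := fun A => {γ | γ.size ≤ N ∧ γ.sort = ρ ∧ A ⊆ γ.age 𝓕}
  have hfin : (𝒫 {γ : Gluing L d | γ.size ≤ N}).Finite := (finite_gluing d N).finite_subsets
  refine Set.Finite.of_finite_image (f := Φ) (hfin.subset ?_) ?_
  · rintro _ ⟨A, -, rfl⟩ γ hγ
    exact hγ.1
  · have key : ∀ A ∈ ages 𝓕 K ρ, ∀ B ∈ ages 𝓕 K ρ, Φ A ⊆ Φ B → B ⊆ A := by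
      rintro _ ⟨n, s, -, -, h3, rfl⟩ B - hAB X hX
      by_contra hXA
      obtain ⟨γ', h1, h2, h4, -, F, hF, -, h5⟩ := exists_piece hXA
      have : γ' ∈ Φ (age 𝓕 K s) := ⟨h5.trans (hN F hF), h1.trans (funext h3), h2⟩
      exact h4 ((hAB this).2.2 hX)
    intro A hA B hB hAB
    exact Set.Subset.antisymm (key B hB A hA hAB.ge) (key A hA B hB hAB.le)

/-! ### Consecutive age changes -/

theorem Ambient.exists_con (H : Ambient 𝓕 K) {d : ℕ} {ρ : Fin d → Fin L.ku} {A B : Class L d}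
    (hA : A ∈ ages 𝓕 K ρ) (hB : B ∈ ages 𝓕 K ρ) (h : B ⊂ A) : ∃ C, Con 𝓕 K ρ A C ∧ B ⊆ C := by
  obtain ⟨C, hBC, hC⟩ := ((H.finite_ages ρ).subset
    (Set.sep_subset _ fun C => C ⊂ A)).exists_le_maximal (a := B) ⟨hB, h⟩
  exact ⟨C, ⟨hA, hC.1.1, hC.1.2, fun ⟨D, hD, hCD, hDA⟩ =>
    hCD.not_subset (hC.2 ⟨hD, hDA⟩ hCD.subset)⟩, hBC⟩

/-- The intersection belongs to the poset and lies between `B` and `A`, so it is one of them. -/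
theorem Ambient.con_inter_eq (H : Ambient 𝓕 K) {d : ℕ} {ρ : Fin d → Fin L.ku} {A B : Class L d}
    (h : Con 𝓕 K ρ A B) {γ : Gluing L d} (hs : γ.sort = ρ) (hγ : Omits 𝓕 γ.str)
    (hB : B ⊆ γ.age 𝓕) (hA : ¬ A ⊆ γ.age 𝓕) : A ∩ γ.age 𝓕 = B := by
  have hm := H.inter_mem_ages h.1 hs hγ fun v => hB (H.pt_mem_ages h.2.1 v)
  by_contra hne
  refine h.2.2.2 ⟨_, hm, ?_, ?_⟩
  · exact (Set.subset_inter h.2.2.1.subset hB).ssubset_of_ne (Ne.symm hne)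
  · exact Set.inter_subset_left.ssubset_of_ne fun he => hA (Set.inter_eq_left.1 he)

theorem Con.between {d : ℕ} {ρ : Fin d → Fin L.ku} {A B C : Class L d} (h : Con 𝓕 K ρ A B)
    (hC : C ∈ ages 𝓕 K ρ) (h1 : B ⊆ C) (h2 : C ⊆ A) : C = A ∨ C = B := by
  by_contra hcon
  simp only [not_or] at hcon
  exact h.2.2.2 ⟨C, hC, h1.ssubset_of_ne (Ne.symm hcon.2), h2.ssubset_of_ne hcon.1⟩

/-- A class strictly between the restrictions is the age of a tuple of nodes, whose extension by
zeros is a gluing of rank `d` with age above `B`. Either this age contains `A`, or it cuts `A` down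
to `B`; after restriction, both contradict strictness. -/
theorem Ambient.con_restr (H : Ambient 𝓕 K) {d d₀ : ℕ} {ρ : Fin d → Fin L.ku} {A B : Class L d}
    (h : Con 𝓕 K ρ A B) {e : Fin d₀ → Fin d} (he : StrictMono e) :
    restr B e = restr A e ∨ Con 𝓕 K (fun i => ρ (e i)) (restr A e) (restr B e) := by
  by_cases heq : restr B e = restr A e
  · exact .inl heq
  refine .inr ⟨restr_mem_ages h.1 he, restr_mem_ages h.2.1 he,
    (restr_mono h.2.2.1.subset e).ssubset_of_ne heq, ?_⟩
  rintro ⟨_, ⟨n, s, h1, h2, h3, rfl⟩, hBC, hCA⟩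
  have hsort : (nodeGluing K s).sort = fun i => ρ (e i) := funext h3
  have hsub := H.subset_extend_age h.2.1 he.injective hsort hBC.subset
  have hre := restr_extend_age (𝓕 := 𝓕) (ρ := ρ) he.injective hsort
  refine hCA.not_subset ?_
  have hnA : ¬ A ⊆ (Gluing.extend ρ e (nodeGluing K s)).age 𝓕 → False := fun hn => by
    have := H.con_inter_eq h (γ := Gluing.extend ρ e (nodeGluing K s)) rfl
      (H.omits_comap_val n) hsub hn
    refine hBC.not_subset fun X hX => ?_
    rw [← this]
    refine ⟨hCA.subset hX, ?_⟩
    have hX' : X ∈ restr ((Gluing.extend ρ e (nodeGluing K s)).age 𝓕) e := by rw [hre]; exact hX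
    exact hX'
  have := restr_mono (not_not.1 hnA) e
  rw [hre] at this
  exact this

theorem Ambient.exists_minCause (H : Ambient 𝓕 K) {d : ℕ} {ρ : Fin d → Fin L.ku}
    {A B : Class L d} (h : Con 𝓕 K ρ A B) : ∃ γ, IsMinCause 𝓕 ρ A B γ := by
  have hne : (Spec 𝓕 ρ B \ Spec 𝓕 ρ A).Nonempty := by
    obtain ⟨X, hXA, hXB⟩ := Set.exists_of_ssubset h.2.2.1
    obtain ⟨n, s, -, -, h3, hs⟩ := h.2.1
    rw [← hs] at hXB
    obtain ⟨γ, h1, h2, h4, ⟨g, hg⟩, F, hF, hf, -⟩ := exists_piece hXB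
    rw [age] at hs
    refine ⟨γ, ⟨h1.trans (funext h3), ⟨(H.omits_comap_val n).of_emb hg, F, hF, hf⟩, hs ▸ h2⟩,
      fun hA => h4 (hA.2.2 hXA)⟩
  obtain ⟨γ, hγ, hmin⟩ := WellFounded.has_min (InvImage.wf Gluing.size Nat.lt_wfRel.wf) _ hne
  exact ⟨γ, hγ, fun γ' hγ' => not_lt.1 (hmin γ' hγ')⟩

/-- Among the increasing `e` that distinguish `A` from `B`, one of least rank gives an essential
change. -/
theorem Ambient.exists_cause (H : Ambient 𝓕 K) (C : Choices 𝓕 K) {d : ℕ} {ρ : Fin d → Fin L.ku}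
    {A B : Class L d} (h : Con 𝓕 K ρ A B) : ∃ (d₀ : ℕ) (e : Fin d₀ → Fin d) (γ : Gluing L d₀),
      StrictMono e ∧ C.IsCauseOf ρ A B (Gluing.extend ρ e γ) ∧
        Con 𝓕 K (fun i => ρ (e i)) (restr A e) (restr B e) ∧
        IsMinCause 𝓕 (fun i => ρ (e i)) (restr A e) (restr B e) γ := by
  classical
  have hex : ∃ d₀, ∃ e : Fin d₀ → Fin d, StrictMono e ∧ restr A e ≠ restr B e :=
    ⟨d, id, strictMono_id, fun he => h.2.2.1.ne he.symm⟩
  obtain ⟨e, he, hne⟩ := Nat.find_spec hex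
  have hcon := (H.con_restr h he).resolve_left hne.symm
  have hE : ECon 𝓕 K (fun i => ρ (e i)) (restr A e) (restr B e) := by
    refine ⟨hcon, fun d₁ e' hd he' => ?_⟩
    by_contra hcc
    exact Nat.find_min hex hd ⟨e ∘ e', he.comp he', hcc⟩
  exact ⟨_, e, _, he, ⟨_, e, he, hE, rfl⟩, hcon, C.cause_spec _ _ _ _ hE (H.exists_minCause hcon)⟩

/-- A gluing of size zero excludes no member of `A`, so it cannot lie outside the spectrum of `A`.
-/
theorem IsMinCause.size_pos (H : Ambient 𝓕 K) {d : ℕ} {ρ : Fin d → Fin L.ku} {A B : Class L d}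
    {γ : Gluing L d} (h : IsMinCause 𝓕 ρ A B γ) (hA : A ∈ ages 𝓕 K ρ) : 0 < γ.size := by
  rcases Nat.eq_zero_or_pos γ.size with h0 | h0
  · exfalso
    refine h.1.2 ⟨h.1.1.1, h.1.1.2.1, fun X hX => ?_⟩
    refine H.mem_gluing_age (γ' := γ) (V := ∅) (f := fun v => v.2.elim) (ψ := id) ?_ ?_ ?_ ?_ ?_ ?_
    · rw [h.1.1.1]
      exact omits_of_mem_ages hA hX
    · intro v _ x
      exact (h0 ▸ x).elim0
    · exact ⟨Function.injective_id, fun _ => rfl, fun _ _ => rfl⟩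
    · exact fun v => v.2.elim
    · exact fun v => v.2.elim
    · refine H.omits_of_cliques fun C hC => ?_
      obtain ⟨a, -, -⟩ := hC
      rcases a with a | a
      · exact (h0 ▸ a).elim0
      · exact a.2.elim
  · exact h0

/-- A proper truncation is smaller than the cause and lies in the spectrum of `B`, so minimality
puts it in that of `A`. Consequently nothing changes before the last point of a copy of the cause.
-/
theorem IsMinCause.subset_trunc {d : ℕ} {ρ : Fin d → Fin L.ku} {A B : Class L d}
    {γ : Gluing L d} (h : IsMinCause 𝓕 ρ A B γ) {e : ℕ} (he : e < γ.size) :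
    A ⊆ (γ.trunc e he.le).age 𝓕 := by
  have hinj := Fin.castLE_injective he.le
  have hemb : (γ.trunc e he.le).str.IsEmb γ.str (Fin.castLE he.le) := Str.isEmb_comap hinj
  have hpiece : IsPiece 𝓕 (γ.trunc e he.le).str := by
    obtain ⟨ho, F, hF, f, hf⟩ := h.1.1.2.1
    exact ⟨ho.of_emb hemb, F, hF, _, hf.comp hemb⟩
  have hsub : γ.age 𝓕 ⊆ (γ.trunc e he.le).age 𝓕 := fun X hX => by
    refine Omits.of_emb (f := Sum.map (Fin.castLE he.le) id) hX
      ⟨Sum.map_injective.2 ⟨hinj, Function.injective_id⟩, ?_, ?_⟩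
    · rintro (_ | _) <;> rfl
    · rintro (_ | _) (_ | _) <;> rfl
  by_contra hA
  have := h.2 (γ.trunc e he.le) ⟨⟨h.1.1.1, hpiece, h.1.1.2.2.trans hsub⟩, fun hA' => hA hA'.2.2⟩
  exact absurd he (not_lt.2 this)

end CodingTree

/-! ### One-point gluings, maximal paths, and the initial age change of a symbol without free
relation. -/

namespace CodingTree

variable {L : BinLang} {𝓕 : Class L L.ku} {K : Str L L.ku ℕ}

/-! ### Attaching a single point -/

/-- The gluing of a single point with unary symbol `j`. -/
def Gluing.col {d : ℕ} (ν : Fin d → Fin L.ku) (a : Fin d → Fin L.k) (j : Fin L.ku) : Gluing L d where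
  sort := ν
  size := 1
  att := fun v _ => a v
  str := ⟨fun _ => j, fun _ _ => 0, fun _ => rfl, fun _ _ => L.flip_zero.symm⟩

theorem age₁_subset_point {n : ℕ} (s : Node L n) (x : Fin n) :
    age₁ 𝓕 K s ⊆ (Gluing.point s.u (s.b x) (K.U x)).age 𝓕 := by
  intro X hX
  refine Omits.of_emb (f := Sum.map (fun _ => x) id) hX
    ⟨Sum.map_injective.2 ⟨fun a b _ => Subsingleton.elim (α := Fin 1) a b, Function.injective_id⟩,
      ?_, ?_⟩
  · rintro (_ | _) <;> rfl
  · rintro (_ | _) (_ | _)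
    · exact K.R_self _
    · rfl
    · rfl
    · rfl

/-- A point unrelated to all earlier points is a left-leaning copy of a one-point structure, so
`age_pass` applies to it alone. -/
theorem Ambient.age_col (H : Ambient 𝓕 K) {d m : ℕ} {j : Fin L.ku} (hm : code K m = Node.left j m)
    (ν : Fin d → Fin L.ku) (g : Fin d → ℕ → Fin L.k) :
    age 𝓕 K (fun v => nd (ν v) (g v) (m + 1)) =
      age 𝓕 K (fun v => nd (ν v) (g v) m) ∩ (Gluing.col ν (fun v => g v m) j).age 𝓕 := by
  have hU : K.U m = j := congrArg Node.u hm
  have hR : ∀ y < m, K.R m y = 0 := fun y hy => congrFun (congrArg Node.b hm) ⟨y, hy⟩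
  have hs : Subsingleton (Fin (Gluing.col ν (fun v => g v m) j).size) :=
    inferInstanceAs (Subsingleton (Fin 1))
  refine H.age_pass (γ := Gluing.col ν (fun v => g v m) j) (Nat.le_succ m) rfl (φ := fun _ => m)
    ⟨⟨Subsingleton.strictMono _, Function.injective_of_subsingleton _, fun _ => hU, fun a b => K.R_self m⟩,
      fun x y hy hy' => absurd (hR y hy) hy'⟩ (fun _ => Nat.lt_succ_self m) (fun _ _ => rfl) ?_
  intro v y h1 h2 h3
  exact absurd ⟨⟨0, Nat.one_pos⟩, show m = y by omega⟩ h3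

theorem Ambient.mem_col_age (H : Ambient 𝓕 K) {d : ℕ} {ν : Fin d → Fin L.ku} {a : Fin d → Fin L.k}
    {i j : Fin L.ku} {q : Fin L.k} (V : Set (Fin d)) (h0 : ∀ v ∉ V, a v = 0)
    (hV : ∀ v ∈ V, ν v = i ∧ a v = q) {X : FinStr L d} (h : Omits 𝓕 (X.str.relabel ν))
    (hX : X.sub V (fun _ => 0) ∈ (Gluing.point i q j).age 𝓕) : X ∈ (Gluing.col ν a j).age 𝓕 :=
  H.mem_gluing_age (γ := Gluing.col ν a j) (γ' := Gluing.point i q j) h V (fun v hv _ => h0 v hv)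
    _ (ψ := id) ⟨Function.injective_id, fun _ => rfl, fun _ _ => rfl⟩ (fun v => (hV v v.2).1.symm)
    (fun v _ => (hV v v.2).2.symm) hX

/-- These points, available above any level, carry the splittings and starts. -/
theorem Ambient.exists_left (H : Ambient 𝓕 K) (j : Fin L.ku) (N : ℕ) :
    ∃ m, N ≤ m ∧ code K m = Node.left j m := by
  obtain ⟨a, ha, h1, h2⟩ := H.realize (s := Node.left j N) (H.mem_age₁_left.2 (H.omits_single (X := Unit) _))
  refine ⟨a, ha, Node.ext (Node.ext_iff.1 h1).1 (funext fun x => ?_)⟩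
  by_cases hx : (x : ℕ) < N
  · exact congrFun (Node.ext_iff.1 h1).2 ⟨x, hx⟩
  · exact h2 x (not_lt.1 hx) x.2

/-! ### The posets of rank one -/

theorem age₁_mem_P₁ (H : Ambient 𝓕 K) {n : ℕ} {s : Node L n} (h : FinStr.pt 0 ∈ age₁ 𝓕 K s) :
    age₁ 𝓕 K s ∈ P₁ 𝓕 K s.u :=
  ⟨n, fun _ => s, fun i j hij => absurd hij (Subsingleton.elim i j ▸ lt_irrefl _),
    fun _ => H.mem_lev_univ.2 h, fun _ => rfl, rfl⟩

theorem Ambient.exists_of_mem_P₁ (H : Ambient 𝓕 K) {i : Fin L.ku} {A : Class L 1}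
    (h : A ∈ P₁ 𝓕 K i) :
    ∃ (n : ℕ) (s : Node L n), s.u = i ∧ FinStr.pt 0 ∈ age₁ 𝓕 K s ∧ age₁ 𝓕 K s = A := by
  obtain ⟨n, s, -, h2, h3, rfl⟩ := h
  have hs : s = fun _ => s 0 := funext fun x => congrArg s (Subsingleton.elim _ _)
  exact ⟨n, s 0, h3 0, H.mem_lev_univ.1 (h2 0), by rw [age₁, ← hs]⟩

theorem Ambient.top_mem (H : Ambient 𝓕 K) (i : Fin L.ku) :
    age₁ 𝓕 K (Node.left i 0) ∈ P₁ 𝓕 K i :=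
  age₁_mem_P₁ H (s := Node.left i 0) (H.mem_age₁_left.2 (H.omits_single (X := Unit) _))

theorem Ambient.subset_top (H : Ambient 𝓕 K) {i : Fin L.ku} {A : Class L 1} (h : A ∈ P₁ 𝓕 K i) :
    A ⊆ age₁ 𝓕 K (Node.left i 0) := fun _ hX => H.mem_age₁_left.2 (omits_of_mem_ages h hX)

theorem Ambient.inter_mem_P₁ (H : Ambient 𝓕 K) {i : Fin L.ku} {A B : Class L 1}
    (hA : A ∈ P₁ 𝓕 K i) (hB : B ∈ P₁ 𝓕 K i) : A ∩ B ∈ P₁ 𝓕 K i := by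
  obtain ⟨n, s, rfl, hp, rfl⟩ := H.exists_of_mem_P₁ hB
  refine H.inter_mem_ages hA (γ := nodeGluing K (fun _ : Fin 1 => s)) rfl (H.omits_comap_val n)
    fun v => ?_
  rw [Subsingleton.elim v 0]
  exact hp

/-- The poset is finite and closed under intersections. -/
theorem Ambient.Pmin_mem (H : Ambient 𝓕 K) (i : Fin L.ku) : Pmin 𝓕 K i ∈ P₁ 𝓕 K i := by
  obtain ⟨M, -, hM⟩ := (H.finite_ages (sort₁ i)).exists_le_minimal (H.top_mem i)
  have : Pmin 𝓕 K i = M := by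
    refine Set.Subset.antisymm (Set.sInter_subset_of_mem hM.1) (Set.subset_sInter fun A hA => ?_)
    have := hM.2 (H.inter_mem_P₁ hM.1 hA) Set.inter_subset_left
    exact fun X hX => (this hX).2
  rw [this]
  exact hM.1

theorem Pmin_subset {i : Fin L.ku} {A : Class L 1} (h : A ∈ P₁ 𝓕 K i) : Pmin 𝓕 K i ⊆ A :=
  Set.sInter_subset_of_mem h

theorem Ambient.point_age_subset_top (H : Ambient 𝓕 K) (i : Fin L.ku) (q : Fin L.k)
    (j : Fin L.ku) : (Gluing.point i q j).age 𝓕 ⊆ age₁ 𝓕 K (Node.left i 0) := fun _ hX =>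
  H.mem_age₁_left.2 (omits_relabel_of_mem_age (γ := Gluing.point i q j) hX)

theorem Ambient.not_top_subset_point (H : Ambient 𝓕 K) {i j : Fin L.ku} {q : Fin L.k}
    (hi : ¬ HasFree 𝓕 K i) (hq : q ≠ 0) :
    ¬ age₁ 𝓕 K (Node.left i 0) ⊆ (Gluing.point i q j).age 𝓕 := fun h =>
  hi ⟨q, j, hq, Set.Subset.antisymm (H.point_age_subset_top i q j) h⟩

/-- Without a free relation, each non-zero entry costs age, so the top age characterizes the left
branch. -/
theorem Ambient.eq_left_of_age (H : Ambient 𝓕 K) {n : ℕ} {s : Node L n} (hi : ¬ HasFree 𝓕 K s.u)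
    (h : age₁ 𝓕 K (Node.left s.u 0) ⊆ age₁ 𝓕 K s) : s = Node.left s.u n := by
  refine Node.ext rfl (funext fun x => ?_)
  by_contra hx
  exact H.not_top_subset_point hi hx (h.trans (age₁_subset_point s x))

/-- Non-degeneracy provides a consistent one-point gluing with a non-zero relation; as that relation
is not free, its age cuts the top properly. -/
theorem Ambient.Pmin_ne_top (H : Ambient 𝓕 K) {i : Fin L.ku} (hi : ¬ HasFree 𝓕 K i) :
    Pmin 𝓕 K i ≠ age₁ 𝓕 K (Node.left i 0) := by
  intro heq
  obtain ⟨S, hS, ⟨x, hx⟩, hR⟩ := H.nondeg i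
  obtain ⟨y, hxy, hy⟩ : ∃ y, y ≠ x ∧ S.R x y ≠ 0 := by
    have h10 : S.R 1 0 ≠ 0 := fun h => hR (by rw [S.R_flip 1 0, h, L.flip_zero])
    fin_cases x
    · exact ⟨1, by decide, hR⟩
    · exact ⟨0, by decide, h10⟩
  have hpt : ∀ v, FinStr.pt v ∈ (Gluing.point i (S.R x y) (S.U y)).age 𝓕 := by
    intro v
    refine Omits.of_emb (f := Sum.elim (fun _ => y) (fun _ => x)) hS ⟨?_, ?_, ?_⟩
    · rintro (a | a) (b | b) hab
      · exact congrArg Sum.inl (Subsingleton.elim (α := Fin 1) a b)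
      · exact absurd hab hxy
      · exact absurd hab.symm hxy
      · rfl
    · rintro (a | a)
      · rfl
      · exact hx
    · rintro (a | a) (b | b)
      · exact S.R_self _
      · exact S.R_flip _ _
      · rfl
      · exact S.R_self _
  have hm := H.inter_mem_ages (H.top_mem i) (γ := Gluing.point i (S.R x y) (S.U y)) rfl
    (H.omits_single (X := Fin 1) _) hpt
  have h1 := Pmin_subset hm
  rw [heq] at h1
  exact H.not_top_subset_point hi hy (h1.trans Set.inter_subset_right)

/-! ### Paths -/

theorem IsMaxPath.mem_of_comparable {i : Fin L.ku} {p : Set (Class L 1)} (hp : IsMaxPath 𝓕 K i p)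
    {A : Class L 1} (hA : A ∈ P₁ 𝓕 K i) (h : ∀ B ∈ p, A ⊆ B ∨ B ⊆ A) : A ∈ p := by
  have := hp.2 (insert A p) ⟨Set.insert_subset hA hp.1.1, hp.1.2.insert fun B hB _ => h B hB⟩
    (Set.subset_insert A p)
  rw [← this]
  exact Set.mem_insert A p

theorem IsMaxPath.comparable {i : Fin L.ku} {p : Set (Class L 1)} (hp : IsMaxPath 𝓕 K i p)
    {A B : Class L 1} (hA : A ∈ p) (hB : B ∈ p) : A ⊆ B ∨ B ⊆ A := hp.1.2.total hA hB

theorem IsMaxPath.top_mem {i : Fin L.ku} {p : Set (Class L 1)} (hp : IsMaxPath 𝓕 K i p)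
    (H : Ambient 𝓕 K) : age₁ 𝓕 K (Node.left i 0) ∈ p :=
  hp.mem_of_comparable (H.top_mem i) fun _ hB => .inr (H.subset_top (hp.1.1 hB))

theorem IsMaxPath.Pmin_mem {i : Fin L.ku} {p : Set (Class L 1)} (hp : IsMaxPath 𝓕 K i p)
    (H : Ambient 𝓕 K) : Pmin 𝓕 K i ∈ p :=
  hp.mem_of_comparable (H.Pmin_mem i) fun _ hB => .inl (Pmin_subset (hp.1.1 hB))

/-- A class strictly between `A` and its successor in `p` would be comparable with all of `p`, hence
would belong to `p`. -/
theorem IsMaxPath.exists_next {i : Fin L.ku} {p : Set (Class L 1)} (hp : IsMaxPath 𝓕 K i p)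
    (H : Ambient 𝓕 K) {A B : Class L 1} (hA : A ∈ p) (hB : B ∈ p) (h : B ⊂ A) :
    ∃ A' ∈ p, Con 𝓕 K (sort₁ i) A A' ∧ B ⊆ A' := by
  have hfin : p.Finite := (H.finite_ages (sort₁ i)).subset hp.1.1
  obtain ⟨A', hBA', hA'⟩ := (hfin.subset (Set.sep_subset p fun C => C ⊂ A)).exists_le_maximal
    (a := B) ⟨hB, h⟩
  refine ⟨A', hA'.1.1, ⟨hp.1.1 hA, hp.1.1 hA'.1.1, hA'.1.2, ?_⟩, hBA'⟩
  rintro ⟨D, hD, h1, h2⟩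
  have hDp : D ∈ p := by
    refine hp.mem_of_comparable hD fun E hE => ?_
    by_cases hEA : E ⊂ A
    · rcases hp.comparable hE hA'.1.1 with h3 | h3
      · exact .inr (h3.trans h1.subset)
      · exact .inr ((hA'.2 ⟨hE, hEA⟩ h3).trans h1.subset)
    · rcases hp.comparable hE hA with h3 | h3
      · by_cases hEA' : E = A
        · exact .inl (hEA' ▸ h2.subset)
        · exact absurd (h3.ssubset_of_ne hEA') hEA
      · exact .inl (h2.subset.trans h3)
  exact h1.not_subset (hA'.2 ⟨hDp, h2⟩ h1.subset)

/-- A descending sequence of consecutive steps along a maximal path visits all of it. -/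
theorem IsMaxPath.eq_of_steps {i : Fin L.ku} {p : Set (Class L 1)} (hp : IsMaxPath 𝓕 K i p)
    (H : Ambient 𝓕 K) (u : ℕ → Class L 1) (a : ℕ) (h0 : u 0 = age₁ 𝓕 K (Node.left i 0))
    (hu : ∀ m ≤ a, u m ∈ p)
    (hs : ∀ m < a, u (m + 1) = u m ∨ Con 𝓕 K (sort₁ i) (u m) (u (m + 1)))
    (ha : u a = Pmin 𝓕 K i) : {A | ∃ m ≤ a, u m = A} = p := by
  refine Set.Subset.antisymm (by rintro _ ⟨m, hm, rfl⟩; exact hu m hm) fun q hq => ?_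
  have key : ∀ m ≤ a, (∃ m' ≤ m, u m' = q) ∨ q ⊂ u m := by
    intro m
    induction m with
    | zero =>
      intro _
      by_cases hq0 : q = u 0
      · exact .inl ⟨0, le_rfl, hq0.symm⟩
      · exact .inr ((h0 ▸ H.subset_top (hp.1.1 hq)).ssubset_of_ne hq0)
    | succ m ih =>
      intro hm
      rcases ih (by omega) with ⟨m', h1, h2⟩ | h1
      · exact .inl ⟨m', by omega, h2⟩
      · rcases hs m (by omega) with h2 | h2
        · exact .inr (h2 ▸ h1)
        · by_cases hqm : q = u (m + 1)
          · exact .inl ⟨m + 1, le_rfl, hqm.symm⟩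
          · rcases hp.comparable hq (hu (m + 1) hm) with h3 | h3
            · exact .inr (h3.ssubset_of_ne hqm)
            · rcases h2.between (hp.1.1 hq) h3 h1.subset with h4 | h4
              · exact absurd h4 h1.ne
              · exact absurd h4 hqm
  rcases key a le_rfl with h | h
  · exact h
  · rw [ha] at h
    exact absurd (Pmin_subset (hp.1.1 hq)) h.not_subset

/-- A maximal path chosen here becomes the path of the image of `a`. -/
theorem Ambient.exists_maxPath (H : Ambient 𝓕 K) (a : ℕ) :
    ∃ p, IsMaxPath 𝓕 K (K.U a) p ∧ Path 𝓕 K a ⊆ p := by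
  have hfin : {p | IsPath 𝓕 K (K.U a) p}.Finite :=
    (H.finite_ages (sort₁ (K.U a))).finite_subsets.subset fun p hp => hp.1
  have hpath : IsPath 𝓕 K (K.U a) (Path 𝓕 K a) := by
    refine ⟨?_, ?_⟩
    · rintro _ ⟨m, hm, rfl⟩
      exact age₁_mem_P₁ H (pt_mem_of_realized H hm)
    · rintro _ ⟨m, hm, rfl⟩ _ ⟨m', hm', rfl⟩ -
      rcases le_total m m' with h | h
      · exact .inr (age₁_anti h _ _)
      · exact .inl (age₁_anti h _ _)
  obtain ⟨p, h1, h2⟩ := hfin.exists_le_maximal hpath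
  exact ⟨p, ⟨h2.1, fun q hq hpq => Set.Subset.antisymm (h2.2 hq hpq) hpq⟩, h1⟩

theorem Ambient.finite_maxPath (H : Ambient 𝓕 K) : Finite (MaxPath 𝓕 K) := by
  have : ∀ i, Finite {p | IsMaxPath 𝓕 K i p} := fun i =>
    ((H.finite_ages (sort₁ i)).finite_subsets.subset fun p hp => hp.1.1)
  refine Finite.of_injective
    (fun p : MaxPath 𝓕 K => (⟨p.sort, p.path, p.isMax⟩ : Σ i, {p | IsMaxPath 𝓕 K i p})) ?_
  rintro ⟨i, p, hp⟩ ⟨j, q, hq⟩ h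
  simp only [Sigma.mk.injEq] at h
  obtain ⟨rfl, h⟩ := h
  have := congrArg Subtype.val (eq_of_heq h)
  simp only at this
  subst this
  rfl

/-! ### The first age change without free relations -/

/-- In rank zero there are no points, so consecutive changes of rank one are automatically
essential. -/
theorem Ambient.restr_zero (H : Ambient 𝓕 K) {d : ℕ} {ρ : Fin d → Fin L.ku} {A : Class L d}
    (hA : A ∈ ages 𝓕 K ρ) (e : Fin 0 → Fin d) : restr A e = Set.univ := by
  obtain ⟨n, s, -, -, -, rfl⟩ := hA
  refine Set.eq_univ_of_forall fun X => ?_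
  have hX : IsEmpty X.carrier := ⟨fun x => (X.str.U x).elim0⟩
  rw [restr_age]
  refine Omits.of_emb (f := Sum.elim id hX.elim) (H.omits_comap_val n) ⟨?_, ?_, ?_⟩
  · rintro (a | a) (b | b) hab
    exacts [congrArg Sum.inl hab, hX.elim b, hX.elim a, hX.elim a]
  · rintro (a | a)
    exacts [rfl, hX.elim a]
  · rintro (a | a) (b | b)
    exacts [rfl, hX.elim b, hX.elim a, hX.elim a]

/-- A cause must attach its label non-trivially at some point `x`, or it would exclude nothing from
the top class. The one-point gluing at `x` already excludes something, since there is no free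
relation, and it contains `B` in its age; least size therefore leaves a single point. -/
theorem Ambient.exists_point_cause (H : Ambient 𝓕 K) (C : Choices 𝓕 K) {i : Fin L.ku}
    (hi : ¬ HasFree 𝓕 K i) {B : Class L 1}
    (h : Con 𝓕 K (sort₁ i) (age₁ 𝓕 K (Node.left i 0)) B) :
    ∃ (q : Fin L.k) (j : Fin L.ku), q ≠ 0 ∧ B ⊆ (Gluing.point i q j).age 𝓕 ∧
      C.IsCauseOf (sort₁ i) (age₁ 𝓕 K (Node.left i 0)) B (Gluing.point i q j) := by
  have hE : ECon 𝓕 K (sort₁ i) (age₁ 𝓕 K (Node.left i 0)) B := by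
    refine ⟨h, fun d₀ e hd _ => ?_⟩
    obtain rfl : d₀ = 0 := by omega
    rw [H.restr_zero h.1, H.restr_zero h.2.1]
  have hmin := C.cause_spec _ _ _ _ hE (H.exists_minCause h)
  have hcause : C.IsCauseOf (sort₁ i) (age₁ 𝓕 K (Node.left i 0)) B (Gluing.extend (sort₁ i) id
      (C.cause 1 (sort₁ i) (age₁ 𝓕 K (Node.left i 0)) B)) := ⟨1, id, strictMono_id, hE, rfl⟩
  generalize C.cause 1 (sort₁ i) (age₁ 𝓕 K (Node.left i 0)) B = γ at hmin hcause
  have hpos := hmin.size_pos H h.1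
  have hone : ∃ x, γ.att 0 x ≠ 0 := by
    by_contra hcon
    simp only [not_exists, not_not] at hcon
    refine hmin.1.2 ⟨hmin.1.1.1, hmin.1.1.2.1, fun X hX => ?_⟩
    have ho := omits_of_mem_ages h.1 hX
    rw [← hmin.1.1.1] at ho
    refine H.mem_gluing_age (γ := γ) (γ' := γ) ho ∅ (fun v _ x => ?_) (fun v => v.2.elim)
      (ψ := id) ⟨Function.injective_id, fun _ => rfl, fun _ _ => rfl⟩ (fun v => v.2.elim)
      (fun v => v.2.elim) ?_
    · rw [Subsingleton.elim v 0]
      exact hcon x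
    · refine Omits.of_emb (f := Sum.elim id fun x => x.2.elim) hmin.1.1.2.1.1 ⟨?_, ?_, ?_⟩
      · rintro (a | a) (b | b) hab
        exacts [congrArg Sum.inl hab, b.2.elim, a.2.elim, a.2.elim]
      · rintro (a | a)
        exacts [rfl, a.2.elim]
      · rintro (a | a) (b | b)
        exacts [rfl, b.2.elim, a.2.elim, a.2.elim]
  obtain ⟨x, hx⟩ := hone
  have hsub : γ.age 𝓕 ⊆ (Gluing.point i (γ.att 0 x) (γ.str.U x)).age 𝓕 := by
    intro X hX
    have hl : ∀ b : X.carrier, X.str.U b = 0 := fun b => Subsingleton.elim _ _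
    refine Omits.of_emb (f := Sum.map (fun _ => x) id) hX ⟨Sum.map_injective.2
      ⟨fun a b _ => Subsingleton.elim (α := Fin 1) a b, Function.injective_id⟩, ?_, ?_⟩
    · rintro (_ | _)
      · rfl
      · exact congrFun hmin.1.1.1 _
    · rintro (_ | b) (_ | c)
      · exact γ.str.R_self _
      · exact congrArg L.flip (congrArg (γ.att · x) (hl c))
      · exact congrArg (γ.att · x) (hl b)
      · rfl
  have hB := hmin.1.1.2.2.trans hsub
  have hle : γ.size ≤ 1 := by
    refine hmin.2 (Gluing.point i (γ.att 0 x) (γ.str.U x)) ⟨⟨rfl, ⟨H.omits_single (X := Fin 1) _, ?_⟩,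
      hB⟩, fun hA => H.not_top_subset_point hi hx hA.2.2⟩
    obtain ⟨-, F, hF, f, hf⟩ := hmin.1.1.2.1
    exact ⟨F, hF, fun _ => f x, fun a b _ => Subsingleton.elim (α := Fin 1) a b,
      fun _ => hf.2.1 x, fun _ _ => F.str.R_self _⟩
  refine ⟨γ.att 0 x, γ.str.U x, hx, hB, ?_⟩
  have hs := hmin.1.1.1
  clear hmin hsub hB
  obtain ⟨s, n, a, ⟨U, R, h1, h2⟩⟩ := γ
  simp only at hle hpos x hx hs
  obtain rfl : n = 1 := by omega
  subst hs
  convert hcause using 1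
  simp only [Gluing.extend, Gluing.point, Gluing.mk.injEq, heq_eq_eq, true_and]
  refine ⟨rfl, ?_, ?_⟩
  · funext v y
    rw [Subsingleton.elim v 0, Subsingleton.elim y x]
    exact (congrFun (Function.injective_id.extend_apply a (fun _ _ => 0) 0) x).symm
  · congr 1
    · funext y
      rw [Subsingleton.elim y x]
    · funext y z
      rw [Subsingleton.elim y z]
      exact (h1 z).symm

end CodingTree

/-! ### Consecutive steps compatible with the paths, and the matrix of future coding nodes. -/

namespace CodingTree

variable {L : BinLang} {𝓕 : Class L L.ku} {K : Str L L.ku ℕ}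

/-! ### One step along paths -/

/-- If some label `v` has to drop, `A` is cut for `v` alone to the next class of its path. A
consecutive class above this cut leaves the other labels unchanged and moves `v` by at most this one
step. If no label drops, any consecutive class above `E` will do. -/
theorem Ambient.exists_step (H : Ambient 𝓕 K) {d : ℕ} {ρ : Fin d → Fin L.ku} {A E : Class L d}
    (hA : A ∈ ages 𝓕 K ρ) (hE : E ∈ ages 𝓕 K ρ) (hEA : E ⊂ A) (P : Fin d → Set (Class L 1))
    (hP : ∀ v, IsMaxPath 𝓕 K (ρ v) (P v)) (hAP : ∀ v, restr A (fun _ : Fin 1 => v) ∈ P v)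
    (hEP : ∀ v, restr E (fun _ : Fin 1 => v) ∈ P v) :
    ∃ B, Con 𝓕 K ρ A B ∧ E ⊆ B ∧ ∀ v, restr B (fun _ : Fin 1 => v) ∈ P v := by
  classical
  by_cases hall : ∀ v, restr E (fun _ : Fin 1 => v) = restr A (fun _ : Fin 1 => v)
  · obtain ⟨B, hB, hEB⟩ := H.exists_con hA hE hEA
    refine ⟨B, hB, hEB, fun v => ?_⟩
    have : restr B (fun _ : Fin 1 => v) = restr A (fun _ : Fin 1 => v) :=
      Set.Subset.antisymm (restr_mono hB.2.2.1.subset _) (hall v ▸ restr_mono hEB _)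
    rw [this]
    exact hAP v
  · simp only [not_forall] at hall
    obtain ⟨v, hv⟩ := hall
    obtain ⟨A', hA', hcon, hEA'⟩ := (hP v).exists_next H (hAP v) (hEP v)
      ((restr_mono hEA.subset _).ssubset_of_ne hv)
    obtain ⟨n, τ, hτ, -, rfl⟩ := H.exists_of_mem_P₁ hcon.2.1
    -- All labels other than `v` sit on left branches and so impose no condition.
    let σ : Fin d → Node L n := Function.update (fun w => Node.left (ρ w) n) v τ
    have hσv : σ v = τ := Function.update_self _ _ _
    have hσw : ∀ w, w ≠ v → σ w = Node.left (ρ w) n := fun w hw => Function.update_of_ne hw _ _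
    have hσs : (nodeGluing K σ).sort = ρ := by
      funext w
      by_cases hw : w = v
      · subst hw
        exact (congrArg Node.u hσv).trans hτ
      · exact congrArg Node.u (hσw w hw)
    have hEσ : E ⊆ age 𝓕 K σ := by
      intro X hX
      refine H.mem_gluing_age (γ := nodeGluing K σ) (γ' := nodeGluing K fun _ : Fin 1 => τ)
        (by rw [hσs]; exact omits_of_mem_ages hE hX) {v} (fun w hw x => ?_) (fun _ => 0) (ψ := id)
        ⟨Function.injective_id, fun _ => rfl, fun _ _ => rfl⟩ (fun w => ?_) (fun w x => ?_)
        (hEA' (sub_mem_restr hE hX (f := fun _ => 0) fun w => w.2.symm))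
      · exact congrFun (congrArg Node.b (hσw w hw)) x
      · exact congrArg Node.u ((congrArg σ w.2).trans hσv).symm
      · exact congrFun (congrArg Node.b ((congrArg σ w.2).trans hσv).symm) x
    have hB₀ : A ∩ age 𝓕 K σ ∈ ages 𝓕 K ρ := H.inter_mem_ages hA hσs (H.omits_comap_val n)
      fun w => hEσ (H.pt_mem_ages hE w)
    have hr : ∀ w, restr (A ∩ age 𝓕 K σ) (fun _ : Fin 1 => w) =
        restr A (fun _ : Fin 1 => w) ∩ age₁ 𝓕 K (σ w) := fun w => by
      rw [← restr_age_one]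
      rfl
    have hne : A ∩ age 𝓕 K σ ≠ A := by
      intro h
      have h1 := hr v
      rw [h, hσv] at h1
      exact hcon.2.2.1.not_subset (Set.inter_eq_left.1 h1.symm)
    obtain ⟨B, hB, hBB⟩ := H.exists_con hA hB₀ (Set.inter_subset_left.ssubset_of_ne hne)
    refine ⟨B, hB, (Set.subset_inter hEA.subset hEσ).trans hBB, fun w => ?_⟩
    have hBA := restr_mono hB.2.2.1.subset (fun _ : Fin 1 => w)
    have hBw := restr_mono hBB (fun _ : Fin 1 => w)
    rw [hr] at hBw
    by_cases hw : w = v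
    · subst hw
      rw [hσv, Set.inter_eq_right.2 hcon.2.2.1.subset] at hBw
      rcases hcon.between (restr_one_mem hB.2.1 w) hBw hBA with h | h
      · rw [h]; exact hAP w
      · rw [h]; exact hA'
    · rw [hσw w hw, H.age₁_left, Set.inter_eq_left.2 (H.subset_top (restr_one_mem hA w))] at hBw
      rw [Set.Subset.antisymm hBA hBw]
      exact hAP w

/-! ### Matrices and their levels -/

/-- The node of level `m` given by the row `a` of a matrix. -/
def row (K : Str L L.ku ℕ) (G : ℕ → ℕ → Fin L.k) (a m : ℕ) : Node L m := nd (K.U a) (G a) m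

/-- The nodes of level `m` given by the rows with index at least `n`. -/
def rows (K : Str L L.ku ℕ) (G : ℕ → ℕ → Fin L.k) (n m : ℕ) : Set (Node L m) :=
  {t | ∃ a, n ≤ a ∧ row K G a m = t}

/-- A tuple of rows. -/
def tup (K : Str L L.ku ℕ) (G : ℕ → ℕ → Fin L.k) {d : ℕ} (r : Fin d → ℕ) (m : ℕ) :
    Fin d → Node L m := fun i => row K G (r i) m

/-- `G'` agrees with `G` in the first `m` columns. -/
def Agree (m : ℕ) (G G' : ℕ → ℕ → Fin L.k) : Prop := ∀ a, ∀ x < m, G' a x = G a x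

/-- The first `m` columns of `G`, continued by `w`. -/
def ext (G : ℕ → ℕ → Fin L.k) (m : ℕ) (w : ℕ → ℕ → Fin L.k) : ℕ → ℕ → Fin L.k :=
  fun a y => if y < m then G a y else w a y

theorem agree_ext (G : ℕ → ℕ → Fin L.k) (m : ℕ) (w : ℕ → ℕ → Fin L.k) : Agree m G (ext G m w) :=
  fun _ _ hx => if_pos hx

theorem ext_of_le {G w : ℕ → ℕ → Fin L.k} {m a y : ℕ} (h : m ≤ y) : ext G m w a y = w a y :=
  if_neg (not_lt.2 h)

theorem Agree.mono {m m' : ℕ} {G G' : ℕ → ℕ → Fin L.k} (h : Agree m' G G') (hm : m ≤ m') :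
    Agree m G G' := fun a x hx => h a x (hx.trans_le hm)

theorem Agree.trans {m : ℕ} {G G' G'' : ℕ → ℕ → Fin L.k} (h : Agree m G G') (h' : Agree m G' G'') :
    Agree m G G'' := fun a x hx => (h' a x hx).trans (h a x hx)

theorem Agree.row_eq {m : ℕ} {G G' : ℕ → ℕ → Fin L.k} (h : Agree m G G') (a : ℕ) :
    row K G' a m = row K G a m := nd_eq_iff.2 ⟨rfl, fun x hx => h a x hx⟩

theorem Agree.tup_eq {m : ℕ} {G G' : ℕ → ℕ → Fin L.k} (h : Agree m G G') {d : ℕ} (r : Fin d → ℕ) :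
    tup K G' r m = tup K G r m := funext fun i => h.row_eq (r i)

theorem row_mono {G G' : ℕ → ℕ → Fin L.k} {a b m n : ℕ} (h : m ≤ n)
    (e : row K G a n = row K G' b n) : row K G a m = row K G' b m := nd_mono h e

theorem row_succ {G : ℕ → ℕ → Fin L.k} {a b m : ℕ} :
    row K G a (m + 1) = row K G b (m + 1) ↔ row K G a m = row K G b m ∧ G a m = G b m := nd_succ

theorem row_eq_left {G : ℕ → ℕ → Fin L.k} {a m : ℕ} {i : Fin L.ku} :
    row K G a m = Node.left i m ↔ K.U a = i ∧ ∀ x < m, G a x = 0 := by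
  rw [left_eq_nd]
  exact nd_eq_iff

theorem age_tup_comp (G : ℕ → ℕ → Fin L.k) {d d' m : ℕ} (r : Fin d → ℕ) (r' : Fin d' → ℕ)
    (π : Fin d' → Fin d) (h : ∀ i, row K G (r' i) m = row K G (r (π i)) m) :
    age 𝓕 K (tup K G r' m) = restr (age 𝓕 K (tup K G r m)) π := by
  rw [restr_age]
  exact congrArg (age 𝓕 K) (funext h)

theorem restr_age_tup (G : ℕ → ℕ → Fin L.k) {d m : ℕ} (r : Fin d → ℕ) (i : Fin d) :
    restr (age 𝓕 K (tup K G r m)) (fun _ : Fin 1 => i) = age₁ 𝓕 K (row K G (r i) m) :=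
  restr_age_one _ _

section Levels

variable (𝓕 K) (p : ℕ → Set (Class L 1)) (n : ℕ) (G : ℕ → ℕ → Fin L.k) (x : ℕ)

/-- The ages of the rows stay on the prescribed paths. -/
def PathStep : Prop := ∀ a, n ≤ a → age₁ 𝓕 K (row K G a (x + 1)) ∈ p a ∧
  (age₁ 𝓕 K (row K G a (x + 1)) = age₁ 𝓕 K (row K G a x) ∨
    Con 𝓕 K (sort₁ (K.U a)) (age₁ 𝓕 K (row K G a x)) (age₁ 𝓕 K (row K G a (x + 1))))

/-- No row splits. -/
def NoSplit : Prop := ∀ a, n ≤ a → ∀ b, n ≤ b → row K G a x = row K G b x → G a x = G b x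

/-- No row starts. -/
def NoStart : Prop := ∀ a, n ≤ a → row K G a x = Node.left (K.U a) x → G a x = 0

/-- No age changes. -/
def SameAge : Prop := ∀ (d : ℕ) (r : Fin d → ℕ), (∀ i, n ≤ r i) →
  age 𝓕 K (tup K G r (x + 1)) = age 𝓕 K (tup K G r x)

/-- Nothing happens on level `x`. -/
def Quiet : Prop := NoSplit K n G x ∧ NoStart K n G x ∧ SameAge 𝓕 K n G x

variable {𝓕 K} (C : Choices 𝓕 K)

/-- A controlled age change on level `x`, quiet above `base`. -/
def GoodAC (base : ℕ) : Prop :=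
  NoSplit K n G x ∧ NoStart K n G x ∧
    ∃ (d : ℕ) (s : Fin d → Node L x) (t : Fin d → Node L (x + 1)),
      IsEnum s (rows K G n x) ∧ IsEnum t (rows K G n (x + 1)) ∧
      Con 𝓕 K (fun i => (s i).u) (age 𝓕 K s) (age 𝓕 K t) ∧
      ∃ γ : Gluing L d, C.IsCauseOf (fun i => (s i).u) (age 𝓕 K s) (age 𝓕 K t) γ ∧
        ∃ φ : Fin γ.size → ℕ, IsOLEmb γ.str K φ ∧ IsGreatest (Set.range φ) x ∧
          ∃ i, IsLeast (Set.range φ) i ∧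
            (∀ (j : Fin d) (y : Fin (x + 1)), i ≤ y →
              (∀ z, φ z = y → (t j).b y = γ.att j z) ∧
              ((y : ℕ) ∉ Set.range φ → (t j).b y = 0)) ∧
            base ≤ i ∧ ∀ y, i ≤ y → y < x → Quiet 𝓕 K n G y

variable {x} in
/-- A node may be split with the new value `q`. -/
def SplitControl (s : Node L x) (q : Fin L.k) : Prop :=
  (HasFree 𝓕 K s.u → code K x = Node.left (C.free s.u).2 x ∧ q = (C.free s.u).1) ∧
  (¬ HasFree 𝓕 K s.u → s ≠ Node.left s.u x →
    ∃ y : Fin x, s.IsStart y ∧ code K x = Node.left (K.U y) x ∧ q = s.b y) ∧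
  (¬ HasFree 𝓕 K s.u → s = Node.left s.u x →
    Con 𝓕 K (sort₁ s.u) (age₁ 𝓕 K s) (age₁ 𝓕 K (s.snoc q)) ∧
    ∃ j : Fin L.ku, C.IsCauseOf (sort₁ s.u) (age₁ 𝓕 K s) (age₁ 𝓕 K (s.snoc q))
      (Gluing.point s.u q j) ∧ code K x = Node.left j x)

/-- A controlled splitting on level `x`. -/
def GoodSplit : Prop :=
  ∃ (X : Set ℕ) (s : Node L x) (q : Fin L.k), q ≠ 0 ∧ (∃ a, n ≤ a ∧ a ∈ X) ∧
    (∀ a ∈ X, n ≤ a → row K G a x = s) ∧ (∃ b, n ≤ b ∧ b ∉ X ∧ row K G b x = s) ∧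
    (∀ a ∈ X, n ≤ a → G a x = q) ∧ (∀ a ∉ X, n ≤ a → G a x = 0) ∧
    SplitControl C s q ∧
    (s = Node.left s.u x → ∀ a ∈ X, n ≤ a → ∀ b ∈ X, n ≤ b → p a = p b)

/-- Level `x` is admissible. -/
def LevelOK (base : ℕ) : Prop :=
  PathStep 𝓕 K p n G x ∧
    (Quiet 𝓕 K n G x ∨ GoodAC n G x C base ∨ GoodSplit p n G x C)

/-- The columns from `m` to `m'` of `G'` continue the first `m` columns of `G` by admissible
levels. -/
structure Seg (base m : ℕ) (G : ℕ → ℕ → Fin L.k) (m' : ℕ) (G' : ℕ → ℕ → Fin L.k) : Prop where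
  le : m ≤ m'
  agree : Agree m G G'
  -- Quantifying over all continuations lets segments be concatenated and passed to the limit
  -- matrix.
  ok : ∀ G'', Agree m' G' G'' → ∀ x, m ≤ x → x < m' → LevelOK p n G'' x C base

end Levels

variable {C : Choices 𝓕 K} {p : ℕ → Set (Class L 1)} {n : ℕ} {G G' : ℕ → ℕ → Fin L.k}

theorem Seg.refl (base m : ℕ) : Seg p n C base m G m G :=
  ⟨le_rfl, fun _ _ _ => rfl, fun _ _ x h1 h2 => by omega⟩

theorem Seg.trans {base m m' m'' : ℕ} {G'' : ℕ → ℕ → Fin L.k} (h : Seg p n C base m G m' G')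
    (h' : Seg p n C base m' G' m'' G'') : Seg p n C base m G m'' G'' := by
  refine ⟨h.le.trans h'.le, h.agree.trans (h'.agree.mono h.le), fun G₁ hG x h1 h2 => ?_⟩
  by_cases hx : x < m'
  · exact h.ok G₁ (h'.agree.trans (hG.mono h'.le)) x h1 hx
  · exact h'.ok G₁ hG x (not_lt.1 hx) h2

theorem Ambient.age_tup_zero (H : Ambient 𝓕 K) {m m' : ℕ} (hm : m ≤ m') {d : ℕ} {r : Fin d → ℕ}
    (h0 : ∀ v y, m ≤ y → y < m' → G (r v) y = 0) :
    age 𝓕 K (tup K G r m') = age 𝓕 K (tup K G r m) :=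
  H.age_zero hm (ν := fun v => K.U (r v)) (g := fun v => G (r v)) h0

theorem Ambient.age_row_zero (H : Ambient 𝓕 K) {m m' a : ℕ} (hm : m ≤ m')
    (h0 : ∀ y, m ≤ y → y < m' → G a y = 0) :
    age₁ 𝓕 K (row K G a m') = age₁ 𝓕 K (row K G a m) :=
  H.age_tup_zero hm (r := fun _ : Fin 1 => a) fun _ => h0

theorem Ambient.quiet_of_zero (H : Ambient 𝓕 K) {x : ℕ} (h : ∀ a, n ≤ a → G a x = 0) :
    Quiet 𝓕 K n G x := by
  refine ⟨fun a ha b hb _ => (h a ha).trans (h b hb).symm, fun a ha _ => h a ha, fun d r hr => ?_⟩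
  refine H.age_tup_zero (Nat.le_succ x) fun v y h1 h2 => ?_
  obtain rfl : y = x := by omega
  exact h _ (hr v)

theorem SameAge.age₁_eq {x a : ℕ} (h : SameAge 𝓕 K n G x) (ha : n ≤ a) :
    age₁ 𝓕 K (row K G a (x + 1)) = age₁ 𝓕 K (row K G a x) := h 1 (fun _ => a) fun _ => ha

theorem SameAge.pathStep {x : ℕ} (h : SameAge 𝓕 K n G x)
    (hp : ∀ a, n ≤ a → age₁ 𝓕 K (row K G a x) ∈ p a) : PathStep 𝓕 K p n G x := fun a ha =>
  ⟨h.age₁_eq ha ▸ hp a ha, .inl (h.age₁_eq ha)⟩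

theorem Ambient.levelOK_zero (H : Ambient 𝓕 K) {m x base : ℕ} (hm : m ≤ x)
    (h : ∀ a, n ≤ a → ∀ y, m ≤ y → y ≤ x → G a y = 0)
    (hp : ∀ a, n ≤ a → age₁ 𝓕 K (row K G a m) ∈ p a) : LevelOK p n G x C base := by
  have hq := H.quiet_of_zero fun a ha => h a ha x hm le_rfl
  refine ⟨hq.2.2.pathStep fun a ha => ?_, .inl hq⟩
  rw [H.age_row_zero hm fun y h1 h2 => h a ha y h1 h2.le]
  exact hp a ha

end CodingTree

/-! ### Producing controlled age changes and descending to a prescribed age. -/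

namespace CodingTree

variable {L : BinLang} {𝓕 : Class L L.ku} {K : Str L L.ku ℕ}
variable {C : Choices 𝓕 K} {p : ℕ → Set (Class L 1)} {n : ℕ} {G G' : ℕ → ℕ → Fin L.k}

/-! ### Age changes -/

theorem extend_trunc {d d₀ : ℕ} {ρ : Fin d → Fin L.ku} {e : Fin d₀ → Fin d}
    (he : Function.Injective e) (γ : Gluing L d₀) (k : ℕ) (hk : k ≤ γ.size) :
    Gluing.extend ρ e (γ.trunc k hk) = (Gluing.extend ρ e γ).trunc k hk := by
  simp only [Gluing.extend, Gluing.trunc, Gluing.mk.injEq, heq_eq_eq, true_and, and_true]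
  funext v x
  by_cases hv : ∃ i, e i = v
  · obtain ⟨i, rfl⟩ := hv
    rw [he.extend_apply, he.extend_apply]
  · rw [Function.extend_apply' _ _ _ hv, Function.extend_apply' _ _ _ hv]

theorem restr_subset_point {d : ℕ} {B : Class L d} {γ : Gluing L d} (h : B ⊆ γ.age 𝓕) (v : Fin d)
    (x : Fin γ.size) : restr B (fun _ : Fin 1 => v) ⊆
      (Gluing.point (γ.sort v) (γ.att v x) (γ.str.U x)).age 𝓕 := by
  intro X hX
  refine Omits.of_emb (f := Sum.map (fun _ => x) id) (h hX) ⟨Sum.map_injective.2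
    ⟨fun a b _ => Subsingleton.elim (α := Fin 1) a b, Function.injective_id⟩, ?_, ?_⟩
  · rintro (_ | _) <;> rfl
  · rintro (_ | _) (_ | _)
    · exact γ.str.R_self _
    · rfl
    · rfl
    · rfl

/-- The tuple `r` of row indices enumerates the rows on level `m`, and `idx` finds rows in it. -/
structure Enumerates (K : Str L L.ku ℕ) (n : ℕ) (G : ℕ → ℕ → Fin L.k) (m : ℕ) {d : ℕ} (r : Fin d → ℕ)
    (idx : ℕ → Fin d) : Prop where
  le : ∀ i, n ≤ r i
  lt : ∀ i j, i < j → (row K G (r i) m).LexLT (row K G (r j) m)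
  idx_spec : ∀ a, n ≤ a → row K G a m = row K G (r (idx a)) m

theorem Enumerates.isEnum {m d : ℕ} {r : Fin d → ℕ} {idx : ℕ → Fin d}
    (h : Enumerates K n G m r idx) : IsEnum (tup K G r m) (rows K G n m) := by
  refine ⟨h.lt, Set.Subset.antisymm ?_ ?_⟩
  · rintro _ ⟨i, rfl⟩
    exact ⟨r i, h.le i, rfl⟩
  · rintro _ ⟨a, ha, rfl⟩
    exact ⟨idx a, (h.idx_spec a ha).symm⟩

theorem Enumerates.idx_eq {m d : ℕ} {r : Fin d → ℕ} {idx : ℕ → Fin d}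
    (h : Enumerates K n G m r idx) {a : ℕ} (ha : n ≤ a) {i : Fin d}
    (e : row K G a m = row K G (r i) m) : idx a = i :=
  h.isEnum.injective ((h.idx_spec a ha).symm.trans e)

theorem exists_enumerates (K : Str L L.ku ℕ) (n : ℕ) (G : ℕ → ℕ → Fin L.k) (m : ℕ) :
    ∃ (d : ℕ) (r : Fin d → ℕ) (idx : ℕ → Fin d), Enumerates K n G m r idx := by
  classical
  obtain ⟨d, s, hs⟩ := exists_isEnum (rows K G n m)
  have h1 : ∀ i, ∃ a, n ≤ a ∧ row K G a m = s i := fun i => by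
    have : s i ∈ rows K G n m := hs.2 ▸ ⟨i, rfl⟩
    exact this
  choose r hr hrs using h1
  have h2 : ∀ a, ∃ i, n ≤ a → row K G a m = row K G (r i) m := by
    have h3 : ∀ a, n ≤ a → ∃ i, row K G a m = row K G (r i) m := by
      intro a ha
      have : row K G a m ∈ Set.range s := hs.2 ▸ ⟨a, ha, rfl⟩
      obtain ⟨i, hi⟩ := this
      exact ⟨i, by rw [hrs, hi]⟩
    intro a
    by_cases ha : n ≤ a
    · obtain ⟨i, hi⟩ := h3 a ha
      exact ⟨i, fun _ => hi⟩
    · obtain ⟨i, -⟩ := h3 n le_rfl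
      exact ⟨i, fun h => absurd h ha⟩
  choose idx hidx using h2
  exact ⟨d, r, idx, hr, fun i j hij => by rw [hrs, hrs]; exact hs.1 i j hij, hidx⟩

theorem Enumerates.of_rows {m m' d : ℕ} {r : Fin d → ℕ} {idx : ℕ → Fin d}
    (h : Enumerates K n G m r idx) (hm : m ≤ m') (hG : Agree m G G')
    (hr : ∀ a, n ≤ a → row K G' a m' = row K G' (r (idx a)) m') : Enumerates K n G' m' r idx :=
  ⟨h.le, fun i j hij => LexLT_nd_mono hm (by
    have := h.lt i j hij
    rw [← hG.row_eq, ← hG.row_eq (r j)] at this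
    exact this), hr⟩

theorem Enumerates.mem_ages {m d : ℕ} {r : Fin d → ℕ} {idx : ℕ → Fin d}
    (h : Enumerates K n G m r idx) (H : Ambient 𝓕 K)
    (hp : ∀ i, FinStr.pt i ∈ age 𝓕 K (tup K G r m)) :
    age 𝓕 K (tup K G r m) ∈ ages 𝓕 K (fun i => K.U (r i)) :=
  ⟨m, tup K G r m, h.lt, fun i => H.mem_lev_univ.2 (pt_mem_age_iff.1 (hp i)), fun _ => rfl, rfl⟩

/-- Here `e` counts the points of the copy below level `y`; the point `x` is not among them, so the
corresponding truncation of the cause is proper. -/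
theorem exists_lt_iff {s : ℕ} {φ : Fin s → ℕ} (hφ : StrictMono φ) {x y : ℕ} {l : Fin s}
    (hl : φ l = x) (hy : y ≤ x) : ∃ e < s, ∀ z : Fin s, (z : ℕ) < e ↔ φ z < y := by
  classical
  have hex : ∃ e, ∃ h : e < s, y ≤ φ ⟨e, h⟩ := ⟨l, l.2, hl ▸ hy⟩
  obtain ⟨h1, h2⟩ := Nat.find_spec hex
  refine ⟨Nat.find hex, h1, fun z => ⟨fun hz => ?_, fun hz => ?_⟩⟩
  · by_contra hcon
    exact Nat.find_min hex hz ⟨z.2, not_lt.1 hcon⟩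
  · by_contra hcon
    have := hφ.monotone (show (⟨Nat.find hex, h1⟩ : Fin s) ≤ z from not_lt.1 hcon)
    omega

/-- The rows pass a left-leaning copy of the cause of the change from the current age to `B`, which
intersects the age with that of the cause and so yields `B`. Rows on a left branch keep the top
class and have no free relation, so the cause attaches them by zero and none of them starts. -/
theorem Ambient.seg_ageChange (H : Ambient 𝓕 K) {base m d : ℕ} (hbase : base ≤ m) {r : Fin d → ℕ}
    {idx : ℕ → Fin d} (hr : Enumerates K n G m r idx) {B : Class L d}
    (hcon : Con 𝓕 K (fun i => K.U (r i)) (age 𝓕 K (tup K G r m)) B)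
    (hpA : ∀ a, n ≤ a → age₁ 𝓕 K (row K G a m) ∈ p a)
    (hpB : ∀ a, n ≤ a → restr B (fun _ : Fin 1 => idx a) ∈ p a)
    (hleft : ∀ i, row K G (r i) m = Node.left (K.U (r i)) m → ¬ HasFree 𝓕 K (K.U (r i)) ∧
      age₁ 𝓕 K (Node.left (K.U (r i)) 0) ⊆ restr B (fun _ : Fin 1 => i)) :
    ∃ m' G', Seg p n C base m G m' G' ∧ age 𝓕 K (tup K G' r m') = B ∧
      Enumerates K n G' m' r idx ∧
      ∀ i, row K G' (r i) m' = Node.left (K.U (r i)) m' ↔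
        row K G (r i) m = Node.left (K.U (r i)) m := by
  classical
  obtain ⟨d₀, e, γ₀, he, hcause, hcon₀, hmin⟩ := H.exists_cause C hcon
  have hsort : γ₀.sort = fun i => K.U (r (e i)) := hmin.1.1.1
  let ρ : Fin d → Fin L.ku := fun i => K.U (r i)
  let γ : Gluing L d := Gluing.extend ρ e γ₀
  have hBγ : B ⊆ γ.age 𝓕 := H.subset_extend_age hcon.2.1 he.injective hsort hmin.1.1.2.2
  have hAγ : ¬ age 𝓕 K (tup K G r m) ⊆ γ.age 𝓕 := by
    intro h
    refine hmin.1.2 ⟨hsort, hmin.1.1.2.1, ?_⟩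
    have := restr_mono h e
    rwa [restr_extend_age he.injective hsort] at this
  have hom : Omits 𝓕 γ.str := hmin.1.1.2.1.1
  have hAB := H.con_inter_eq hcon (γ := γ) rfl hom hBγ hAγ
  have hpos : 0 < γ.size := hmin.size_pos H hcon₀.1
  have htrunc : ∀ k (hk : k < γ.size), age 𝓕 K (tup K G r m) ⊆ (γ.trunc k hk.le).age 𝓕 := by
    intro k hk
    have h1 := H.subset_extend_age hcon.1 he.injective (γ := γ₀.trunc k (le_of_lt hk)) hsort
      (hmin.subset_trunc hk)
    rwa [extend_trunc he.injective] at h1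
  obtain ⟨φ, hφ, hlo⟩ := H.exists_left_leaning γ.str hom m
  have hinj := hφ.1.2.1
  let l : Fin γ.size := ⟨γ.size - 1, by omega⟩
  obtain ⟨x₁, hx₁⟩ : ∃ x₁, φ l = x₁ := ⟨_, rfl⟩
  have hle₁ : ∀ z, φ z ≤ x₁ := fun z => hx₁ ▸ hφ.1.1.monotone (Fin.le_def.2 (by
    have := z.2
    simp only [l]
    omega))
  have hmx : m ≤ x₁ := hx₁ ▸ hlo l
  -- The value depends on the row only through its node, so no row splits.
  let w : ℕ → ℕ → Fin L.k := fun a y => if h : ∃ z, φ z = y then γ.att (idx a) h.choose else 0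
  have hw : ∀ a z, w a (φ z) = γ.att (idx a) z := fun a z => by
    have hz : ∃ z', φ z' = φ z := ⟨z, rfl⟩
    simp only [w, hz, dite_true]
    rw [hinj hz.choose_spec]
  have hw0 : ∀ a y, y ∉ Set.range φ → w a y = 0 := fun a y hy => dif_neg hy
  have hidx : ∀ i, idx (r i) = i := fun i => hr.idx_eq (hr.le i) rfl
  have hatt : ∀ i, row K G (r i) m = Node.left (K.U (r i)) m → ∀ z, γ.att i z = 0 := by
    intro i hi z
    by_contra hz
    exact H.not_top_subset_point (hleft i hi).1 hz ((hleft i hi).2.trans (restr_subset_point hBγ i z))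
  -- properties of all continuations
  have main : ∀ G'', Agree (x₁ + 1) (ext G m w) G'' →
      (∀ y, m ≤ y → y ≤ x₁ → age 𝓕 K (tup K G'' r y) = age 𝓕 K (tup K G r m)) ∧
      age 𝓕 K (tup K G'' r (x₁ + 1)) = B ∧
      (∀ y, m ≤ y → y ≤ x₁ + 1 → Enumerates K n G'' y r idx) ∧
      (∀ a, n ≤ a → row K G a m = Node.left (K.U a) m → ∀ y, m ≤ y → y ≤ x₁ → G'' a y = 0) := by
    intro G'' hG
    have hGw : ∀ a y, m ≤ y → y ≤ x₁ → G'' a y = w a y := fun a y h1 h2 =>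
      (hG a y (by omega)).trans (ext_of_le h1)
    have hGm : Agree m G G'' := (agree_ext G m w).trans (hG.mono (by omega))
    have hGφ : ∀ v z, G'' (r v) (φ z) = γ.att v z := fun v z => by
      rw [hGw _ _ (hlo z) (hle₁ z), hw, hidx]
    refine ⟨fun y h1 h2 => ?_, ?_, fun y h1 h2 => ?_, fun a ha hl y h1 h2 => ?_⟩
    · obtain ⟨k, hk, hky⟩ := exists_lt_iff hφ.1.1 hx₁ h2
      rw [← hGm.tup_eq r]
      have := H.age_pass h1 (ν := ρ) (g := fun v => G'' (r v)) (γ := γ.trunc k hk.le) rfl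
        (φ := fun z => φ (z.castLE hk.le))
        ⟨⟨fun a b hab => hφ.1.1 hab, fun a b hab => Fin.castLE_injective hk.le (hinj hab),
          fun a => hφ.1.2.2.1 _, fun a b => hφ.1.2.2.2 _ _⟩, fun a b hb hab => by
            obtain ⟨z, rfl⟩ := hφ.2 _ _ hb hab
            have hz : (z : ℕ) < a := hφ.1.1.lt_iff_lt.1 hb
            exact ⟨⟨z, hz.trans a.2⟩, rfl⟩⟩
        (fun z => (hky _).1 z.2) (fun v z => hGφ v _) (fun v y' h3 h4 h5 => by
          rw [hGw _ _ h3 (by omega)]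
          refine hw0 _ _ ?_
          rintro ⟨z, rfl⟩
          exact h5 ⟨⟨z, (hky z).2 h4⟩, rfl⟩)
      refine this.trans (Set.inter_eq_left.2 ?_)
      have h3 := htrunc k hk
      rw [← hGm.tup_eq r] at h3
      exact h3
    · have := H.age_pass (show m ≤ x₁ + 1 by omega) (ν := ρ) (g := fun v => G'' (r v)) (γ := γ) rfl
        hφ (fun z => Nat.lt_succ_of_le (hle₁ z)) hGφ (fun v y h3 h4 h5 => by
          rw [hGw _ _ h3 (by omega)]
          exact hw0 _ _ h5)
      refine this.trans ?_
      rw [← hAB, ← hGm.tup_eq r]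
      rfl
    · refine hr.of_rows h1 hGm fun a ha => nd_eq_iff.2 ⟨congrArg Node.u (hr.idx_spec a ha), ?_⟩
      intro z hz
      by_cases hzm : z < m
      · rw [hGm a z hzm, hGm _ z hzm]
        exact (nd_eq_iff.1 (hr.idx_spec a ha)).2 z hzm
      · rw [hGw _ _ (not_lt.1 hzm) (by omega), hGw _ _ (not_lt.1 hzm) (by omega)]
        simp only [w, hidx]
    · rw [hGw _ _ h1 h2]
      by_cases hy : y ∈ Set.range φ
      · obtain ⟨z, rfl⟩ := hy
        rw [hw]
        refine hatt _ ?_ z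
        rw [← hr.idx_spec a ha, hl]
        exact congrArg (fun i => Node.left i m) (congrArg Node.u (hr.idx_spec a ha))
      · exact hw0 _ _ hy
  refine ⟨x₁ + 1, ext G m w, ⟨by omega, agree_ext G m w, fun G'' hG y h1 h2 => ?_⟩, ?_, ?_, ?_⟩
  · obtain ⟨m1, m2, m3, m4⟩ := main G'' hG
    have hGm : Agree m G G'' := (agree_ext G m w).trans (hG.mono (by omega))
    have hns : ∀ y, m ≤ y → y ≤ x₁ → NoSplit K n G'' y := fun y h1 h2 a ha b hb hab => by
      have E := m3 (y + 1) (by omega) (by omega)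
      have hi := (m3 y h1 (by omega)).idx_eq ha (hab.trans ((m3 y h1 (by omega)).idx_spec b hb))
      have := E.idx_spec a ha
      rw [hi, ← E.idx_spec b hb] at this
      exact (row_succ.1 this).2
    have hnst : ∀ y, m ≤ y → y ≤ x₁ → NoStart K n G'' y := fun y h1 h2 a ha hl => by
      refine m4 a ha ?_ y h1 h2
      rw [row_eq_left] at hl ⊢
      exact ⟨rfl, fun z hz => (hGm a z hz).symm.trans (hl.2 z (by omega))⟩
    have hsame : ∀ y, m ≤ y → y < x₁ → SameAge 𝓕 K n G'' y := fun y h1 h2 d' r' hr' => by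
      rw [age_tup_comp G'' r r' (fun i => idx (r' i)) fun i =>
          (m3 (y + 1) (by omega) (by omega)).idx_spec _ (hr' i),
        age_tup_comp G'' r r' (fun i => idx (r' i)) fun i =>
          (m3 y (by omega) (by omega)).idx_spec _ (hr' i), m1 y h1 h2.le,
        m1 (y + 1) (by omega) (by omega)]
    have hage : ∀ a, n ≤ a → ∀ y, m ≤ y → y ≤ x₁ → age₁ 𝓕 K (row K G'' a y) =
        age₁ 𝓕 K (row K G a m) := fun a ha y h1 h2 => by
      rw [(m3 y h1 (by omega)).idx_spec a ha, ← restr_age_tup, m1 y h1 h2, restr_age_tup,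
        ← hr.idx_spec a ha]
    rcases Nat.lt_succ_iff_lt_or_eq.1 h2 with h3 | rfl
    · have hs := hsame y h1 h3
      refine ⟨hs.pathStep fun a ha => ?_, .inl ⟨hns y h1 h3.le, hnst y h1 h3.le, hs⟩⟩
      rw [hage a ha y h1 h3.le]
      exact hpA a ha
    · refine ⟨fun a ha => ?_, .inr (.inl ⟨hns y h1 le_rfl, hnst y h1 le_rfl, d, tup K G'' r y,
        tup K G'' r (y + 1), (m3 y h1 (by omega)).isEnum, (m3 (y + 1) (by omega) le_rfl).isEnum,
        ?_, γ, ?_, φ, hφ, ⟨⟨l, hx₁⟩, ?_⟩, φ ⟨0, hpos⟩, ⟨⟨_, rfl⟩, ?_⟩, fun j z hz => ?_,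
        hbase.trans (hlo _), fun z hz1 hz2 => ?_⟩)⟩
      · have e1 : age₁ 𝓕 K (row K G'' a (y + 1)) = restr B (fun _ : Fin 1 => idx a) := by
          rw [(m3 (y + 1) (by omega) le_rfl).idx_spec a ha, ← restr_age_tup, m2]
        rw [e1]
        refine ⟨hpB a ha, ?_⟩
        rw [(m3 y h1 (by omega)).idx_spec a ha, ← restr_age_tup, m1 y h1 le_rfl]
        have hU : K.U a = K.U (r (idx a)) := congrArg Node.u (hr.idx_spec a ha)
        rw [hU]
        exact H.con_restr hcon (e := fun _ : Fin 1 => idx a) (Subsingleton.strictMono _)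
      · rw [m1 y h1 le_rfl, m2]
        exact hcon
      · rw [m1 y h1 le_rfl, m2]
        exact hcause
      · rintro _ ⟨z, rfl⟩
        exact hle₁ z
      · rintro _ ⟨z, rfl⟩
        exact hφ.1.1.monotone (Fin.le_def.2 (Nat.zero_le _))
      · have hmz : m ≤ z := (hlo _).trans hz
        have hGz : G'' (r j) z = w (r j) z :=
          (hG _ z (by omega)).trans (ext_of_le hmz)
        refine ⟨fun z' hz' => ?_, fun hz' => hGz.trans (hw0 _ _ hz')⟩
        refine hGz.trans ?_
        rw [← hz', hw, hidx]
      · have h4 : m ≤ z := (hlo _).trans hz1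
        exact ⟨hns z h4 hz2.le, hnst z h4 hz2.le, hsame z h4 hz2⟩
  · exact (main _ fun _ _ _ => rfl).2.1
  · exact (main _ fun _ _ _ => rfl).2.2.1 _ (by omega) le_rfl
  · intro i
    obtain ⟨-, -, -, m4⟩ := main (ext G m w) fun _ _ _ => rfl
    refine ⟨fun h => ?_, fun h => ?_⟩
    · rw [row_eq_left] at h ⊢
      exact ⟨rfl, fun z hz => (agree_ext G m w _ z hz).symm.trans (h.2 z (by omega))⟩
    · rw [row_eq_left]
      refine ⟨rfl, fun z hz => ?_⟩
      by_cases hzm : z < m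
      · rw [agree_ext G m w _ z hzm]
        exact (row_eq_left.1 h).2 z hzm
      · exact m4 (r i) (hr.le i) h z (not_lt.1 hzm) (by omega)

/-- Descend to a given age below the current one, by consecutive age changes along the paths. -/
theorem Ambient.seg_descend (H : Ambient 𝓕 K) {base d : ℕ} {r : Fin d → ℕ} {idx : ℕ → Fin d}
    (hp : ∀ a, IsMaxPath 𝓕 K (K.U a) (p a)) {E : Class L d}
    (hE : E ∈ ages 𝓕 K (fun i => K.U (r i)))
    (hpE : ∀ i, restr E (fun _ : Fin 1 => i) ∈ p (r i)) :
    ∀ (N : ℕ) (m : ℕ) (G : ℕ → ℕ → Fin L.k), base ≤ m → Enumerates K n G m r idx →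
      {B | B ∈ ages 𝓕 K (fun i => K.U (r i)) ∧ B ⊂ age 𝓕 K (tup K G r m)}.ncard ≤ N →
      E ⊆ age 𝓕 K (tup K G r m) →
      (∀ i, age₁ 𝓕 K (row K G (r i) m) ∈ p (r i)) →
      (∀ a, n ≤ a → p a = p (r (idx a)) ∨ row K G a m = Node.left (K.U a) m) →
      (∀ i, row K G (r i) m = Node.left (K.U (r i)) m → ¬ HasFree 𝓕 K (K.U (r i)) ∧
        age₁ 𝓕 K (Node.left (K.U (r i)) 0) ⊆ restr E (fun _ : Fin 1 => i)) →
    ∃ m' G', Seg p n C base m G m' G' ∧ age 𝓕 K (tup K G' r m') = E ∧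
      Enumerates K n G' m' r idx := by
  -- Induction on the number of ages strictly below the current one, which drops with every change.
  intro N
  induction N with
  | zero =>
    intro m G hb hr hN hEA hpA hpr hl
    have hfin := (H.finite_ages fun i => K.U (r i)).subset
      (Set.sep_subset _ fun B => B ⊂ age 𝓕 K (tup K G r m))
    have hempty := (Set.ncard_eq_zero hfin).1 (Nat.le_zero.1 hN)
    refine ⟨m, G, Seg.refl _ _, ?_, hr⟩
    by_contra hne
    exact Set.eq_empty_iff_forall_notMem.1 hempty E ⟨hE, hEA.ssubset_of_ne (Ne.symm hne)⟩
  | succ N ih =>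
    intro m G hb hr hN hEA hpA hpr hl
    by_cases heq : age 𝓕 K (tup K G r m) = E
    · exact ⟨m, G, Seg.refl _ _, heq, hr⟩
    have hfin := (H.finite_ages fun i => K.U (r i)).subset
      (Set.sep_subset _ fun B => B ⊂ age 𝓕 K (tup K G r m))
    have hA := hr.mem_ages H fun i => hEA (H.pt_mem_ages hE i)
    obtain ⟨B, hB, hEB, hpB⟩ := H.exists_step hA hE (hEA.ssubset_of_ne (Ne.symm heq))
      (fun i => p (r i)) (fun i => hp (r i)) (fun i => by rw [restr_age_tup]; exact hpA i) hpE
    -- Rows sharing a left branch may have different paths, but their class in `B` is still the top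
    -- one, which lies on all maximal paths of their symbol.
    have htop : ∀ a, n ≤ a → row K G a m = Node.left (K.U a) m →
        restr B (fun _ : Fin 1 => idx a) = age₁ 𝓕 K (Node.left (K.U a) 0) ∧
        row K G (r (idx a)) m = Node.left (K.U (r (idx a))) m := by
      intro a ha hla
      have hU : K.U a = K.U (r (idx a)) := congrArg Node.u (hr.idx_spec a ha)
      have hla' : row K G (r (idx a)) m = Node.left (K.U (r (idx a))) m := by
        rw [← hr.idx_spec a ha, hla, hU]
      refine ⟨Set.Subset.antisymm ?_ ?_, hla'⟩
      · rw [hU]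
        exact H.subset_top (restr_one_mem hB.2.1 (idx a))
      · rw [hU]
        exact (hl _ hla').2.trans (restr_mono hEB _)
    obtain ⟨m', G', hseg, hage, hen, hleft⟩ := H.seg_ageChange (C := C) (p := p) hb hr hB
      (fun a ha => by
        rcases hpr a ha with h | h
        · rw [hr.idx_spec a ha, h]
          exact hpA _
        · rw [h, H.age₁_left]
          exact (hp a).top_mem H)
      (fun a ha => by
        rcases hpr a ha with h | h
        · rw [h]
          exact hpB _
        · rw [(htop a ha h).1]
          exact (hp a).top_mem H)
      (fun i hi => ⟨(hl i hi).1, (hl i hi).2.trans (restr_mono hEB _)⟩)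
    have hcard : {D | D ∈ ages 𝓕 K (fun i => K.U (r i)) ∧
        D ⊂ age 𝓕 K (tup K G' r m')}.ncard ≤ N := by
      rw [hage]
      have hlt : {D | D ∈ ages 𝓕 K (fun i => K.U (r i)) ∧ D ⊂ B}.ncard <
          {D | D ∈ ages 𝓕 K (fun i => K.U (r i)) ∧ D ⊂ age 𝓕 K (tup K G r m)}.ncard := by
        refine Set.ncard_lt_ncard ⟨fun D hD => ⟨hD.1, hD.2.trans hB.2.2.1⟩, fun h => ?_⟩ hfin
        exact (h ⟨hB.2.1, hB.2.2.1⟩).2.ne rfl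
      omega
    obtain ⟨m'', G'', hseg', h1, h2⟩ := ih m' G' (hb.trans hseg.le) hen hcard (hage ▸ hEB)
      (fun i => by rw [← restr_age_tup, hage]; exact hpB i)
      (fun a ha => by
        rcases hpr a ha with h | h
        · exact .inl h
        · refine .inr ?_
          have hU : K.U a = K.U (r (idx a)) := congrArg Node.u (hr.idx_spec a ha)
          rw [hen.idx_spec a ha, (hleft _).2 (htop a ha h).2, hU])
      (fun i hi => hl i ((hleft i).1 hi))
    exact ⟨m'', G'', hseg.trans hseg', h1, h2⟩

end CodingTree

/-! ### Splitting one node on a point that is unrelated to everything before it. -/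

namespace CodingTree

variable {L : BinLang} {𝓕 : Class L L.ku} {K : Str L L.ku ℕ}
variable {C : Choices 𝓕 K} {p : ℕ → Set (Class L 1)} {n : ℕ} {G G' : ℕ → ℕ → Fin L.k}

/-! ### Adding a column -/

/-- Continue the first `m` columns of `G` by zeros, and by `v` in column `x`. -/
def addCol (G : ℕ → ℕ → Fin L.k) (m x : ℕ) (v : ℕ → Fin L.k) : ℕ → ℕ → Fin L.k :=
  ext G m fun a y => if y = x then v a else 0

theorem addCol_zero {m x : ℕ} {v : ℕ → Fin L.k} (hG : Agree (x + 1) (addCol G m x v) G')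
    {a y : ℕ} (h1 : m ≤ y) (h2 : y < x) : G' a y = 0 := by
  rw [hG a y (by omega), addCol, ext_of_le h1, if_neg h2.ne]

theorem addCol_self {m x : ℕ} {v : ℕ → Fin L.k} (hG : Agree (x + 1) (addCol G m x v) G')
    (hm : m ≤ x) (a : ℕ) : G' a x = v a := by
  rw [hG a x (by omega), addCol, ext_of_le hm, if_pos rfl]

theorem addCol_agree {m x : ℕ} {v : ℕ → Fin L.k} (hG : Agree (x + 1) (addCol G m x v) G')
    (hm : m ≤ x) : Agree m G G' :=
  (agree_ext _ _ _).trans (hG.mono (by omega))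

theorem row_eq_iff_of_zero {a b m m' : ℕ} (hm : m ≤ m')
    (h0 : ∀ c y, m ≤ y → y < m' → G c y = 0) :
    row K G a m' = row K G b m' ↔ row K G a m = row K G b m := by
  refine ⟨row_mono hm, fun h => ?_⟩
  rw [row, row, nd_eq_iff] at h ⊢
  refine ⟨h.1, fun x hx => ?_⟩
  by_cases hxm : x < m
  · exact h.2 x hxm
  · rw [h0 a x (not_lt.1 hxm) hx, h0 b x (not_lt.1 hxm) hx]

theorem addCol_row_iff {m x : ℕ} {v : ℕ → Fin L.k} (hG : Agree (x + 1) (addCol G m x v) G')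
    (hm : m ≤ x) {a b : ℕ} : row K G' a (x + 1) = row K G' b (x + 1) ↔
      row K G a m = row K G b m ∧ v a = v b := by
  rw [row_succ, row_eq_iff_of_zero hm fun c y h1 h2 => addCol_zero hG h1 h2,
    (addCol_agree hG hm).row_eq, (addCol_agree hG hm).row_eq, addCol_self hG hm, addCol_self hG hm]

theorem addCol_left_iff {m x : ℕ} {v : ℕ → Fin L.k} (hG : Agree (x + 1) (addCol G m x v) G')
    (hm : m ≤ x) {a : ℕ} : row K G' a (x + 1) = Node.left (K.U a) (x + 1) ↔
      row K G a m = Node.left (K.U a) m ∧ v a = 0 := by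
  simp only [row_eq_left, true_and]
  refine ⟨fun h => ⟨fun y hy => ?_, ?_⟩, fun h y hy => ?_⟩
  · rw [← addCol_agree hG hm a y hy]
    exact h y (by omega)
  · rw [← addCol_self hG hm]
    exact h x (by omega)
  · by_cases hym : y < m
    · rw [addCol_agree hG hm a y hym]
      exact h.1 y hym
    · rcases Nat.lt_succ_iff_lt_or_eq.1 hy with hy | rfl
      · exact addCol_zero hG (not_lt.1 hym) hy
      · rw [addCol_self hG hm]
        exact h.2

theorem Ambient.addCol_age_le (H : Ambient 𝓕 K) {m x : ℕ} {v : ℕ → Fin L.k}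
    (hG : Agree (x + 1) (addCol G m x v) G') (hm : m ≤ x) {y : ℕ} (h1 : m ≤ y) (h2 : y ≤ x)
    {d : ℕ} (r : Fin d → ℕ) : age 𝓕 K (tup K G' r y) = age 𝓕 K (tup K G r m) := by
  rw [H.age_tup_zero h1 fun v z h3 h4 => addCol_zero hG h3 (h4.trans_le h2),
    (addCol_agree hG hm).tup_eq]

theorem Ambient.addCol_age (H : Ambient 𝓕 K) {m x : ℕ} {v : ℕ → Fin L.k}
    (hG : Agree (x + 1) (addCol G m x v) G') (hm : m ≤ x) {j : Fin L.ku}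
    (hx : code K x = Node.left j x) {d : ℕ} (r : Fin d → ℕ) :
    age 𝓕 K (tup K G' r (x + 1)) = age 𝓕 K (tup K G r m) ∩
      (Gluing.col (fun i => K.U (r i)) (fun i => v (r i)) j).age 𝓕 := by
  rw [← H.addCol_age_le hG hm hm le_rfl]
  have h := H.age_col hx (fun i => K.U (r i)) (fun i => G' (r i))
  simp only [addCol_self hG hm] at h
  exact h

theorem Ambient.addCol_age₁ (H : Ambient 𝓕 K) {m x : ℕ} {v : ℕ → Fin L.k}
    (hG : Agree (x + 1) (addCol G m x v) G') (hm : m ≤ x) {j : Fin L.ku}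
    (hx : code K x = Node.left j x) (a : ℕ) :
    age₁ 𝓕 K (row K G' a (x + 1)) = age₁ 𝓕 K (row K G a m) ∩
      (Gluing.point (K.U a) (v a) j).age 𝓕 :=
  H.addCol_age hG hm hx fun _ : Fin 1 => a

/-- A column does not change the age if the single node that passes it non-trivially keeps its
age. -/
theorem Ambient.age_subset_col (H : Ambient 𝓕 K) {m d : ℕ} {r : Fin d → ℕ} {X : Set ℕ}
    {v : ℕ → Fin L.k} {q : Fin L.k} {j : Fin L.ku} {s : Node L m}
    (hv0 : ∀ a ∉ X, v a = 0) (hv1 : ∀ a ∈ X, v a = q)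
    (hs : ∀ i, r i ∈ X → row K G (r i) m = s)
    (h : age₁ 𝓕 K s ⊆ (Gluing.point s.u q j).age 𝓕) :
    age 𝓕 K (tup K G r m) ⊆
      (Gluing.col (fun i => K.U (r i)) (fun i => v (r i)) j).age 𝓕 := fun _ hY =>
  H.mem_col_age {i | r i ∈ X} (fun _ hi => hv0 _ hi)
    (fun i hi => ⟨congrArg Node.u (hs i hi), hv1 _ hi⟩) (omits_relabel_of_mem_age hY)
    (h (sub_mem_age (τ := fun _ => s) (fun i => hs i i.2) hY))

/-! ### Splitting -/

/-- The state of the construction while it splits the nodes of a level. -/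
structure SplitState (𝓕 : Class L L.ku) (K : Str L L.ku ℕ) (p : ℕ → Set (Class L 1)) (n : ℕ)
    (E : ∀ d : ℕ, (Fin d → ℕ) → Class L d) (m : ℕ) (G : ℕ → ℕ → Fin L.k) : Prop where
  path : ∀ a, n ≤ a → age₁ 𝓕 K (row K G a m) ∈ p a
  -- Only the left branch of a symbol without free relation may still carry rows with different
  -- paths.
  rowPath : ∀ a, n ≤ a → ∀ b, n ≤ b → row K G a m = row K G b m →
    p a = p b ∨ (¬ HasFree 𝓕 K (K.U a) ∧ row K G a m = Node.left (K.U a) m)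
  node : ∀ a, n ≤ a → ∀ b, n ≤ b → row K G a m = row K G b m → nodeAt K a n = nodeAt K b n
  free : ∀ a, n ≤ a → HasFree 𝓕 K (K.U a) → row K G a m ≠ Node.left (K.U a) m
  -- The classes `E d r` must remain reachable, so the ages may not leave the region above them.
  lower : ∀ (d : ℕ) (r : Fin d → ℕ), (∀ i, n ≤ r i) → E d r ⊆ age 𝓕 K (tup K G r m)

/-- The rows in `X` take the value `q` in the new column, the others zero. A free relation excludes
nothing, and repeating the start value imposes a condition already satisfied, so in these cases the
age is unchanged. Only on the left branch of a symbol without free relation does the split cost age,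
and there `hleft` makes it a consecutive change with a one-point cause. -/
theorem Ambient.seg_split (H : Ambient 𝓕 K) {E : ∀ d : ℕ, (Fin d → ℕ) → Class L d} {base m : ℕ}
    (S : SplitState 𝓕 K p n E m G) {X : Set ℕ} {s : Node L m} {q : Fin L.k} {j : Fin L.ku}
    (hq : q ≠ 0) (hX : ∃ a, n ≤ a ∧ a ∈ X) (hXs : ∀ a ∈ X, n ≤ a → row K G a m = s)
    (hb : ∃ b, n ≤ b ∧ b ∉ X ∧ row K G b m = s)
    (hfree : HasFree 𝓕 K s.u → q = (C.free s.u).1 ∧ j = (C.free s.u).2)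
    (hnon : ¬ HasFree 𝓕 K s.u → s ≠ Node.left s.u m →
      ∃ y : Fin m, s.IsStart y ∧ j = K.U y ∧ q = s.b y)
    (hleft : ¬ HasFree 𝓕 K s.u → s = Node.left s.u m →
      Con 𝓕 K (sort₁ s.u) (age₁ 𝓕 K s) (age₁ 𝓕 K s ∩ (Gluing.point s.u q j).age 𝓕) ∧
      C.IsCauseOf (sort₁ s.u) (age₁ 𝓕 K s) (age₁ 𝓕 K s ∩ (Gluing.point s.u q j).age 𝓕)
        (Gluing.point s.u q j) ∧
      (∀ a ∈ X, n ≤ a → age₁ 𝓕 K s ∩ (Gluing.point s.u q j).age 𝓕 ∈ p a) ∧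
      (∀ a ∈ X, n ≤ a → ∀ b ∈ X, n ≤ b → p a = p b) ∧
      ∀ (d : ℕ) (r : Fin d → ℕ) (v : ℕ → Fin L.k), (∀ a ∉ X, v a = 0) → (∀ a ∈ X, v a = q) →
        (∀ i, n ≤ r i) → E d r ⊆
          (Gluing.col (fun i => K.U (r i)) (fun i => v (r i)) j).age 𝓕) :
    ∃ m' G', Seg p n C base m G m' G' ∧ SplitState 𝓕 K p n E m' G' ∧
      (∀ a b, row K G' a m' = row K G' b m' ↔ row K G a m = row K G b m ∧ (a ∈ X ↔ b ∈ X)) ∧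
      ∀ a, row K G' a m' = Node.left (K.U a) m' ↔ row K G a m = Node.left (K.U a) m ∧ a ∉ X := by
  classical
  obtain ⟨x, hmx, hx⟩ := H.exists_left j m
  let v : ℕ → Fin L.k := fun a => if a ∈ X then q else 0
  have hv0 : ∀ a ∉ X, v a = 0 := fun a ha => if_neg ha
  have hv1 : ∀ a ∈ X, v a = q := fun a ha => if_pos ha
  have hviff : ∀ a b, v a = v b ↔ (a ∈ X ↔ b ∈ X) := fun a b => by
    by_cases ha : a ∈ X <;> by_cases hb : b ∈ X <;> simp [v, ha, hb, hq, Ne.symm hq]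
  have hvz : ∀ a, v a = 0 ↔ a ∉ X := fun a => by
    by_cases ha : a ∈ X <;> simp [v, ha, hq]
  -- without an age change, the node stays in the age of the attached point
  have hkeep : (HasFree 𝓕 K s.u ∨ s ≠ Node.left s.u m) →
      age₁ 𝓕 K s ⊆ (Gluing.point s.u q j).age 𝓕 := by
    intro h
    by_cases hf : HasFree 𝓕 K s.u
    · obtain ⟨rfl, rfl⟩ := hfree hf
      rw [(C.free_spec _ hf).2]
      exact fun Y hY => H.mem_age₁_left.2 (omits_relabel_of_mem_age hY)
    · obtain ⟨y, -, rfl, rfl⟩ := hnon hf (h.resolve_left hf)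
      exact age₁_subset_point s y
  have hcase : (HasFree 𝓕 K s.u ∨ s ≠ Node.left s.u m) ∨
      (¬ HasFree 𝓕 K s.u ∧ s = Node.left s.u m) := by tauto
  have hUX : ∀ a ∈ X, n ≤ a → K.U a = s.u := fun a ha hna => congrArg Node.u (hXs a ha hna)
  have hmemX : ∀ a ∈ X, n ≤ a → age₁ 𝓕 K s ∩ (Gluing.point s.u q j).age 𝓕 ∈ p a := by
    intro a ha hna
    rcases hcase with h | h
    · rw [Set.inter_eq_left.2 (hkeep h), ← hXs a ha hna]
      exact S.path a hna
    · exact (hleft h.1 h.2).2.2.1 a ha hna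
  have hin : ∀ G'', Agree (x + 1) (addCol G m x v) G'' → ∀ a, n ≤ a → a ∈ X →
      age₁ 𝓕 K (row K G'' a (x + 1)) = age₁ 𝓕 K s ∩ (Gluing.point s.u q j).age 𝓕 := by
    intro G'' hG a ha haX
    rw [H.addCol_age₁ hG hmx hx, hXs a haX ha, hv1 a haX, hUX a haX ha]
  have hout : ∀ G'', Agree (x + 1) (addCol G m x v) G'' → ∀ a, a ∉ X →
      age₁ 𝓕 K (row K G'' a (x + 1)) = age₁ 𝓕 K (row K G a m) := by
    intro G'' hG a haX
    rw [H.age_row_zero (show m ≤ x + 1 by omega) fun y h1 h2 => ?_, (addCol_agree hG hmx).row_eq]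
    rcases Nat.lt_succ_iff_lt_or_eq.1 h2 with h3 | rfl
    · exact addCol_zero hG h1 h3
    · rw [addCol_self hG hmx, hv0 a haX]
  have hpath : ∀ G'', Agree (x + 1) (addCol G m x v) G'' → ∀ a, n ≤ a →
      age₁ 𝓕 K (row K G'' a (x + 1)) ∈ p a := by
    intro G'' hG a ha
    by_cases haX : a ∈ X
    · rw [hin G'' hG a ha haX]
      exact hmemX a haX ha
    · rw [hout G'' hG a haX]
      exact S.path a ha
  have hiff := fun a b => addCol_row_iff (K := K) (fun _ _ _ => rfl :
    Agree (x + 1) (addCol G m x v) (addCol G m x v)) hmx (a := a) (b := b)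
  have hlf := fun a => addCol_left_iff (K := K) (fun _ _ _ => rfl :
    Agree (x + 1) (addCol G m x v) (addCol G m x v)) hmx (a := a)
  simp only [hviff] at hiff
  simp only [hvz] at hlf
  refine ⟨x + 1, addCol G m x v, ⟨by omega, addCol_agree (fun _ _ _ => rfl) hmx,
    fun G'' hG y h1 h2 => ?_⟩, ⟨hpath _ fun _ _ _ => rfl, fun a ha b hb hab => ?_,
    fun a ha b hb hab => ?_, fun a ha hf hl => ?_, fun d r hr => ?_⟩, hiff, hlf⟩
  · have hGm := addCol_agree hG hmx
    rcases Nat.lt_succ_iff_lt_or_eq.1 h2 with h3 | rfl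
    · refine H.levelOK_zero h1 (fun a _ z h4 h5 => addCol_zero hG h4 (by omega)) fun a ha => ?_
      rw [hGm.row_eq]
      exact S.path a ha
    have hrow : ∀ a b, row K G'' a y = row K G'' b y ↔ row K G a m = row K G b m := fun a b => by
      rw [row_eq_iff_of_zero hmx fun c z h3 h4 => addCol_zero hG h3 h4, hGm.row_eq, hGm.row_eq]
    have hage : ∀ a, age₁ 𝓕 K (row K G'' a y) = age₁ 𝓕 K (row K G a m) := fun a =>
      H.addCol_age_le hG hmx h1 le_rfl fun _ : Fin 1 => a
    refine ⟨fun a ha => ⟨hpath G'' hG a ha, ?_⟩, .inr (.inr ?_)⟩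
    · by_cases haX : a ∈ X
      · rw [hage, hin G'' hG a ha haX, hXs a haX ha, hUX a haX ha]
        rcases hcase with h | h
        · exact .inl (Set.inter_eq_left.2 (hkeep h))
        · exact .inr (hleft h.1 h.2).1
      · rw [hage, hout G'' hG a haX]
        exact .inl rfl
    · obtain ⟨a, ha, haX⟩ := hX
      obtain ⟨b, hb, hbX, hbs⟩ := hb
      have hU := hUX a haX ha
      have hsnoc : (row K G'' a y).snoc q = row K G'' a (y + 1) := by
        rw [← hv1 a haX, ← addCol_self hG hmx]
        exact snoc_nd _ _ _
      have hlow : ∀ z (hz : z < m), G'' a z = s.b ⟨z, hz⟩ := fun z hz => by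
        rw [hGm a z hz, ← hXs a haX ha]
        rfl
      have hleft' : row K G'' a y = Node.left (K.U a) y ↔ s = Node.left s.u m := by
        rw [row_eq_left]
        refine ⟨fun h => ?_, fun h => ⟨rfl, fun z hz => ?_⟩⟩
        · refine Node.ext rfl (funext fun z => ?_)
          rw [← hlow z z.2]
          exact h.2 z (by omega)
        · by_cases hzm : z < m
          · rw [hlow z hzm, h]
            rfl
          · exact addCol_zero hG (not_lt.1 hzm) hz
      refine ⟨X, row K G'' a y, q, hq, ⟨a, ha, haX⟩, fun c hc hnc => ?_, ⟨b, hb, hbX, ?_⟩,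
        fun c hc hnc => ?_, fun c hc hnc => ?_, ⟨?_, ?_, ?_⟩, ?_⟩
      · rw [hrow, hXs a haX ha, hXs c hc hnc]
      · rw [hrow, hXs a haX ha, hbs]
      · rw [addCol_self hG hmx, hv1 c hc]
      · rw [addCol_self hG hmx, hv0 c hc]
      · intro hf
        have hf' : HasFree 𝓕 K s.u := hU ▸ hf
        show code K y = Node.left (C.free (K.U a)).2 y ∧ q = (C.free (K.U a)).1
        rw [hU, ← (hfree hf').2]
        exact ⟨hx, (hfree hf').1⟩
      · intro hf hl
        obtain ⟨z, hz1, hz2, hz3⟩ := hnon (hU ▸ hf) (fun h => hl (hleft'.2 h))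
        refine ⟨⟨z, by omega⟩, ⟨?_, fun z' hz' => ?_⟩, hz2 ▸ hx, ?_⟩
        · exact fun h => hz1.1 ((hlow z z.2).symm.trans h)
        · have : (z' : ℕ) < z := hz'
          exact (hlow z' (by omega)).trans (hz1.2 ⟨z', by omega⟩ this)
        · exact hz3.trans (hlow z z.2).symm
      · intro hf hl
        obtain ⟨h3, h4, -⟩ := hleft (hU ▸ hf) (hleft'.1 hl)
        rw [hsnoc, hin G'' hG a ha haX, hage, hXs a haX ha]
        have hU' : (row K G'' a y).u = s.u := hU
        rw [hU']
        exact ⟨h3, j, h4, hx⟩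
      · intro hl c hc hnc c' hc' hnc'
        by_cases hf : HasFree 𝓕 K s.u
        · exfalso
          refine S.free a ha (by rw [hU]; exact hf) ?_
          rw [hXs a haX ha, hU]
          exact hleft'.1 hl
        · exact (hleft hf (hleft'.1 hl)).2.2.2.1 c hc hnc c' hc' hnc'
  · obtain ⟨h1, h2⟩ := (hiff a b).1 hab
    rcases S.rowPath a ha b hb h1 with h3 | ⟨h3, h4⟩
    · exact .inl h3
    by_cases haX : a ∈ X
    · have hU := hUX a haX ha
      refine .inl ((hleft (hU ▸ h3) ?_).2.2.2.1 a haX ha b (h2.1 haX) hb)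
      rw [← hXs a haX ha, h4]
      rfl
    · exact .inr ⟨h3, (hlf a).2 ⟨h4, haX⟩⟩
  · exact S.node a ha b hb ((hiff a b).1 hab).1
  · exact S.free a ha hf ((hlf a).1 hl).1
  · rw [H.addCol_age (fun _ _ _ => rfl) hmx hx]
    refine Set.subset_inter (S.lower d r hr) ?_
    rcases hcase with h | h
    · exact (S.lower d r hr).trans
        (H.age_subset_col hv0 hv1 (fun i hi => hXs _ hi (hr i)) (hkeep h))
    · exact (hleft h.1 h.2).2.2.2.2 d r v hv0 hv1 hr

end CodingTree

/-! ### Starting and separating the rows before the next point is coded. -/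

namespace CodingTree

variable {L : BinLang} {𝓕 : Class L L.ku} {K : Str L L.ku ℕ}
variable {C : Choices 𝓕 K} {p : ℕ → Set (Class L 1)} {n : ℕ} {G G' : ℕ → ℕ → Fin L.k}

/-! ### Separating the nodes before coding the next point -/

/-- A lower bound for the ages before the point `n` is coded: the ages after it, together with a
prescribed age for the point itself. -/
noncomputable def lowerAge (𝓕 : Class L L.ku) (K : Str L L.ku ℕ) (n : ℕ) {N : ℕ} (τ : Node L N)
    (d : ℕ) (r : Fin d → ℕ) : Class L d :=
  age 𝓕 K (fun i => nodeAt K (r i) (n + 1)) ∩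
    age 𝓕 K (fun i => if r i = n then τ else Node.left (K.U (r i)) N)

theorem IsMaxPath.subset_next {i : Fin L.ku} {P : Set (Class L 1)} (hP : IsMaxPath 𝓕 K i P)
    (H : Ambient 𝓕 K) {A B : Class L 1} (hA : Con 𝓕 K (sort₁ i) (age₁ 𝓕 K (Node.left i 0)) A)
    (hAP : A ∈ P) (hB : B ∈ P) (hne : B ≠ age₁ 𝓕 K (Node.left i 0)) : B ⊆ A := by
  rcases hP.comparable hB hAP with h | h
  · exact h
  · rcases hA.between (hP.1.1 hB) h (H.subset_top (hP.1.1 hB)) with h' | h'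
    · exact absurd h' hne
    · exact h'.subset

/-- No row may start on the coding level. So row `n`, and each row related to `n`, must leave a left
branch beforehand if its symbol has no free relation. Each such split is the initial step of a path;
the lower bound survives because the target class of these rows is not the top. -/
theorem Ambient.seg_start (H : Ambient 𝓕 K) (hp : ∀ a, IsMaxPath 𝓕 K (K.U a) (p a))
    (hpath : ∀ a, Path 𝓕 K a ⊆ p a) {N base m : ℕ} {τ : Node L N}
    (hτ : age₁ 𝓕 K τ = Pmin 𝓕 K (K.U n))
    (S : SplitState 𝓕 K p n (lowerAge 𝓕 K n τ) m G)
    (hL : ∀ a, n ≤ a → ¬ HasFree 𝓕 K (K.U a) → nodeAt K a n = Node.left (K.U a) n →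
      row K G a m = Node.left (K.U a) m) :
    ∃ m' G', Seg p n C base m G m' G' ∧ SplitState 𝓕 K p n (lowerAge 𝓕 K n τ) m' G' ∧
      ∀ a, n ≤ a → ¬ HasFree 𝓕 K (K.U a) → row K G' a m' = Node.left (K.U a) m' →
        row K G a m = Node.left (K.U a) m ∧ a ≠ n ∧ K.R a n = 0 := by
  classical
  have := H.finite_maxPath
  let P : ℕ → MaxPath 𝓕 K := fun a => ⟨K.U a, p a, hp a⟩
  -- Rows split off together share their path and their behaviour towards `n`, hence also their node
  -- of level `n + 1` in `K`.
  let key : ℕ → MaxPath 𝓕 K × Prop × Fin L.k := fun a => (P a, a = n, K.R a n)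
  let Z : Set ℕ := {a | ¬ HasFree 𝓕 K (K.U a) ∧ (a = n ∨ K.R a n ≠ 0)}
  have claim : ∀ Q : Finset (MaxPath 𝓕 K × Prop × Fin L.k), ∃ m' G', Seg p n C base m G m' G' ∧
      SplitState 𝓕 K p n (lowerAge 𝓕 K n τ) m' G' ∧
      (∀ a, n ≤ a → ¬ HasFree 𝓕 K (K.U a) → row K G a m = Node.left (K.U a) m →
        (row K G' a m' = Node.left (K.U a) m' ↔ ¬ (a ∈ Z ∧ key a ∈ Q))) ∧
      (∀ a, row K G' a m' = Node.left (K.U a) m' → row K G a m = Node.left (K.U a) m) := by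
    intro Q
    induction Q using Finset.induction_on with
    | empty => exact ⟨m, G, Seg.refl _ _, S, fun a _ _ h => by simp [h], fun a h => h⟩
    | insert κ Q hκ ih =>
      obtain ⟨m', G', hseg, S', h1, h2⟩ := ih
      let X : Set ℕ := {a | a ∈ Z ∧ key a = κ ∧ row K G a m = Node.left (K.U a) m}
      by_cases hX : ∃ a, n ≤ a ∧ a ∈ X
      · obtain ⟨a₀, ha₀, haZ, hak, hal⟩ := hX
        have hi := haZ.1
        have hkey : ∀ a ∈ X, K.U a = K.U a₀ ∧ p a = p a₀ ∧ (a = n ↔ a₀ = n) ∧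
            K.R a n = K.R a₀ n := by
          intro a ha
          have e := ha.2.1.trans hak.symm
          simp only [key, Prod.mk.injEq, P, MaxPath.mk.injEq] at e
          exact ⟨e.1.1, e.1.2, e.2.1.to_iff, e.2.2⟩
        have hnode : ∀ a ∈ X, n ≤ a → nodeAt K a (n + 1) = nodeAt K a₀ (n + 1) := by
          intro a ha hna
          obtain ⟨e1, -, -, e4⟩ := hkey a ha
          refine nd_succ.2 ⟨S.node a hna a₀ ha₀ ?_, e4⟩
          rw [ha.2.2, hal, e1]
        obtain ⟨A, hA, hcon, hAmin⟩ := (hp a₀).exists_next H ((hp a₀).top_mem H)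
          ((hp a₀).Pmin_mem H) ((H.subset_top (H.Pmin_mem _)).ssubset_of_ne (H.Pmin_ne_top hi))
        obtain ⟨q, j, hq, hAq, hcause⟩ := H.exists_point_cause C hi hcon
        have hinter : age₁ 𝓕 K (Node.left (K.U a₀) m') ∩ (Gluing.point (K.U a₀) q j).age 𝓕 = A := by
          rw [H.age₁_left]
          exact H.con_inter_eq hcon (γ := Gluing.point (K.U a₀) q j) rfl
            (H.omits_single (X := Fin 1) _) hAq (H.not_top_subset_point hi hq)
        -- The target class of row `a₀` is minimal if `a₀ = n`, and otherwise comes from a node with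
        -- a non-zero last entry. In both cases it lies on the path below the top, hence below `A`.
        have hlow : lowerAge 𝓕 K n τ 1 (fun _ => a₀) ⊆ A := by
          by_cases han : a₀ = n
          · subst han
            refine fun Y hY => hAmin ?_
            rw [← hτ]
            have h3 := hY.2
            simp only [if_true] at h3
            exact h3
          · have hn : n + 1 ≤ a₀ := by omega
            refine fun Y hY => (hp a₀).subset_next H hcon hA (hpath a₀ ⟨n + 1, hn, rfl⟩) ?_ hY.1
            intro h
            have := H.eq_left_of_age (s := nodeAt K a₀ (n + 1)) hi h.ge
            exact haZ.2.resolve_left han (congrFun (congrArg Node.b this) (Fin.last n))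
        -- A row unrelated to `n` stays on the left branch, so that the node really splits.
        obtain ⟨b, hb, hbn, -⟩ := H.realize (s := Node.left (K.U a₀) (n + 1))
          (H.mem_age₁_left.2 (H.omits_single (X := Unit) _))
        have hbU : K.U b = K.U a₀ := congrArg Node.u hbn
        have hbR : K.R b n = 0 := congrFun (congrArg Node.b hbn) (Fin.last n)
        have hbn' : nodeAt K b n = Node.left (K.U b) n := by
          have : nodeAt K b n = Node.left (K.U a₀) n := nd_mono (Nat.le_succ n) (show nd (K.U b) (K.R b) (n + 1) = nd (K.U a₀) (fun _ => 0) (n + 1) from hbn)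
          rw [this, hbU]
        have hbZ : b ∉ Z := fun h => by
          rcases h.2 with h | h
          · omega
          · exact h hbR
        obtain ⟨m'', G'', hseg', S'', h3, h4⟩ := H.seg_split (C := C) (base := base) S' (X := X)
          (s := Node.left (K.U a₀) m') (q := q) (j := j) hq ⟨a₀, ha₀, haZ, hak, hal⟩
          (fun a ha hna => by
            rw [← (hkey a ha).1]
            refine (h1 a hna ha.1.1 ha.2.2).2 fun h => hκ ?_
            rw [← ha.2.1]
            exact h.2)
          ⟨b, by omega, fun h => hbZ h.1, by
            rw [← hbU]
            exact (h1 b (by omega) (hbU ▸ hi) (hL b (by omega) (hbU ▸ hi) hbn')).2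
              fun h => hbZ h.1⟩
          (fun h => absurd h hi) (fun _ h => absurd rfl h)
          (fun _ _ => by
            show Con 𝓕 K (sort₁ (K.U a₀)) (age₁ 𝓕 K (Node.left (K.U a₀) m'))
                (age₁ 𝓕 K (Node.left (K.U a₀) m') ∩ (Gluing.point (K.U a₀) q j).age 𝓕) ∧
              C.IsCauseOf (sort₁ (K.U a₀)) (age₁ 𝓕 K (Node.left (K.U a₀) m'))
                (age₁ 𝓕 K (Node.left (K.U a₀) m') ∩ (Gluing.point (K.U a₀) q j).age 𝓕)
                (Gluing.point (K.U a₀) q j) ∧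
              (∀ a ∈ X, n ≤ a → age₁ 𝓕 K (Node.left (K.U a₀) m') ∩
                (Gluing.point (K.U a₀) q j).age 𝓕 ∈ p a) ∧ _
            rw [hinter, H.age₁_left]
            refine ⟨hcon, hcause, fun a ha _ => (hkey a ha).2.1 ▸ hA, fun a ha _ b hb _ =>
              (hkey a ha).2.1.trans (hkey b hb).2.1.symm, fun d r v hv0 hv1 hr Y hY => ?_⟩
            refine H.mem_col_age {i | r i ∈ X} (fun i hi => hv0 _ hi)
              (fun i hi => ⟨(hkey _ hi).1, hv1 _ hi⟩) (omits_relabel_of_mem_age hY.1)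
              (hAq (hlow ⟨?_, ?_⟩))
            · exact sub_mem_age (fun i => hnode _ i.2 (hr i)) hY.1
            · refine sub_mem_age (fun i => ?_) hY.2
              obtain ⟨e1, -, e3, -⟩ := hkey _ i.2
              simp only [e3, e1])
        refine ⟨m'', G'', hseg.trans hseg', S'', fun a ha hfa hla => ?_, fun a h => h2 a ((h4 a).1 h).1⟩
        rw [h4, h1 a ha hfa hla, Finset.mem_insert]
        have : a ∈ X ↔ a ∈ Z ∧ key a = κ := ⟨fun h => ⟨h.1, h.2.1⟩, fun h => ⟨h.1, h.2, hla⟩⟩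
        rw [this]
        tauto
      · refine ⟨m', G', hseg, S', fun a ha hfa hla => ?_, h2⟩
        rw [h1 a ha hfa hla, Finset.mem_insert]
        have : ¬ (a ∈ Z ∧ key a = κ) := fun h => hX ⟨a, ha, h.1, h.2, hla⟩
        tauto
  have := Fintype.ofFinite (MaxPath 𝓕 K × Prop × Fin L.k)
  obtain ⟨m', G', hseg, S', h1, h2⟩ := claim Finset.univ
  refine ⟨m', G', hseg, S', fun a ha hfa hla => ⟨h2 a hla, ?_⟩⟩
  have h3 := (h1 a ha hfa (h2 a hla)).1 hla
  by_contra hcon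
  refine h3 ⟨⟨hfa, ?_⟩, Finset.mem_univ _⟩
  tauto

theorem exists_isStart {m : ℕ} {s : Node L m} (h : s ≠ Node.left s.u m) : ∃ y, s.IsStart y := by
  have hex : ∃ y, s.b y ≠ 0 := by
    by_contra hcon
    simp only [not_exists, not_not] at hcon
    exact h (Node.ext rfl (funext hcon))
  obtain ⟨y, hy, hmin⟩ := WellFounded.has_min (wellFounded_lt (α := Fin m)) {y | s.b y ≠ 0} hex
  exact ⟨y, hy, fun z hz => by
    by_contra hne
    exact hmin z hne hz⟩

/-- Rows are split by their key until equal nodes imply equal keys. By `hl`, the left branch of a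
symbol without free relation carries only one key, so it is never split here and every split
preserves the age. -/
theorem Ambient.seg_separate (H : Ambient 𝓕 K) {E : ∀ d : ℕ, (Fin d → ℕ) → Class L d} {base m : ℕ}
    (S : SplitState 𝓕 K p n E m G)
    (hl : ∀ a, n ≤ a → ¬ HasFree 𝓕 K (K.U a) → row K G a m = Node.left (K.U a) m →
      a ≠ n ∧ K.R a n = 0) :
    ∃ m' G', Seg p n C base m G m' G' ∧ SplitState 𝓕 K p n E m' G' ∧
      (∀ a, n ≤ a → ∀ b, n ≤ b → row K G' a m' = row K G' b m' →
        row K G a m = row K G b m ∧ (a = n ↔ b = n) ∧ K.R a n = K.R b n) ∧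
      (∀ a, row K G' a m' = Node.left (K.U a) m' → row K G a m = Node.left (K.U a) m) := by
  classical
  let key : ℕ → Node L m × Prop × Fin L.k := fun a => (row K G a m, a = n, K.R a n)
  have hkey : ∀ a b, key a = key b ↔
      row K G a m = row K G b m ∧ (a = n ↔ b = n) ∧ K.R a n = K.R b n := fun a b => by
    simp only [key, Prod.mk.injEq, eq_iff_iff]
  -- Rows whose keys have not yet been treated stay together if they began together, so the rows
  -- with the next key still share one node.
  have claim : ∀ Q : Finset (Node L m × Prop × Fin L.k), ∃ m' G', Seg p n C base m G m' G' ∧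
      SplitState 𝓕 K p n E m' G' ∧
      (∀ a, n ≤ a → key a ∈ Q → ∀ b, n ≤ b → row K G' a m' = row K G' b m' → key a = key b) ∧
      (∀ a, n ≤ a → key a ∉ Q → ∀ b, n ≤ b → key b ∉ Q → row K G a m = row K G b m →
        row K G' a m' = row K G' b m') ∧
      (∀ a, n ≤ a → ∀ b, n ≤ b → row K G' a m' = row K G' b m' → row K G a m = row K G b m) ∧
      (∀ a, row K G' a m' = Node.left (K.U a) m' → row K G a m = Node.left (K.U a) m) := by
    intro Q
    induction Q using Finset.induction_on with
    | empty => exact ⟨m, G, Seg.refl _ _, S, by simp, fun a _ _ b _ _ h => h,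
        fun a _ b _ h => h, fun a h => h⟩
    | insert κ Q hκ ih =>
      obtain ⟨m', G', hseg, S', h1, h2, h3, h4⟩ := ih
      by_cases hsplit : ∃ a b, n ≤ a ∧ n ≤ b ∧ key a = κ ∧ key b ≠ κ ∧
          row K G' b m' = row K G' a m'
      · obtain ⟨a, b, ha, hb, hak, hbk, hab⟩ := hsplit
        have hXs : ∀ c, n ≤ c → key c = κ → row K G' c m' = row K G' a m' := fun c hc hck =>
          h2 c hc (hck ▸ hκ) a ha (hak ▸ hκ) ((hkey c a).1 (hck.trans hak.symm)).1
        have hnl : ¬ HasFree 𝓕 K (K.U a) → row K G' a m' ≠ Node.left (K.U a) m' := by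
          intro hf hla
          have hla' := h4 a hla
          have hUb : K.U b = K.U a := congrArg Node.u hab
          have hlb : row K G b m = Node.left (K.U b) m := h4 b (by rw [hab, hla, hUb])
          have e1 := hl a ha hf hla'
          have e2 := hl b hb (hUb ▸ hf) hlb
          refine hbk (((hkey b a).2 ⟨?_, ?_, ?_⟩).trans hak)
          · rw [hlb, hla', hUb]
          · exact ⟨fun h => absurd h e2.1, fun h => absurd h e1.1⟩
          · rw [e1.2, e2.2]
        obtain ⟨q, j, hq, hfree, hnon⟩ : ∃ (q : Fin L.k) (j : Fin L.ku), q ≠ 0 ∧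
            (HasFree 𝓕 K (K.U a) → q = (C.free (K.U a)).1 ∧ j = (C.free (K.U a)).2) ∧
            (¬ HasFree 𝓕 K (K.U a) → ∃ y : Fin m', (row K G' a m').IsStart y ∧ j = K.U y ∧
              q = (row K G' a m').b y) := by
          by_cases hf : HasFree 𝓕 K (K.U a)
          · exact ⟨_, _, (C.free_spec _ hf).1, fun _ => ⟨rfl, rfl⟩, fun h => absurd hf h⟩
          · obtain ⟨y, hy⟩ := exists_isStart (hnl hf)
            exact ⟨_, _, hy.1, fun h => absurd h hf, fun _ => ⟨y, hy, rfl, rfl⟩⟩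
        obtain ⟨m'', G'', hseg', S'', h5, h6⟩ := H.seg_split (C := C) (base := base) S'
          (X := {c | key c = κ}) (s := row K G' a m') (q := q) (j := j) hq ⟨a, ha, hak⟩
          (fun c hc hnc => hXs c hnc hc) ⟨b, hb, hbk, hab⟩ hfree (fun hf _ => hnon hf)
          (fun hf hla => absurd hla (hnl hf))
        refine ⟨m'', G'', hseg.trans hseg', S'', ?_, ?_, ?_, ?_⟩
        · intro c hc hck c' hc' hcc
          obtain ⟨h7, h8⟩ := (h5 c c').1 hcc
          rcases Finset.mem_insert.1 hck with h9 | h9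
          · exact h9.trans (h8.1 h9).symm
          · exact h1 c hc h9 c' hc' h7
        · intro c hc hck c' hc' hck' hcc
          rw [Finset.mem_insert, not_or] at hck hck'
          exact (h5 c c').2 ⟨h2 c hc hck.2 c' hc' hck'.2 hcc,
            ⟨fun h => absurd h hck.1, fun h => absurd h hck'.1⟩⟩
        · exact fun c hc c' hc' hcc => h3 c hc c' hc' ((h5 c c').1 hcc).1
        · exact fun c h => h4 c ((h6 c).1 h).1
      · refine ⟨m', G', hseg, S', ?_, ?_, h3, h4⟩
        · intro c hc hck c' hc' hcc
          rcases Finset.mem_insert.1 hck with h9 | h9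
          · by_contra hne
            exact hsplit ⟨c, c', hc, hc', h9, fun h => hne (h9.trans h.symm), hcc.symm⟩
          · exact h1 c hc h9 c' hc' hcc
        · intro c hc hck c' hc' hck' hcc
          rw [Finset.mem_insert, not_or] at hck hck'
          exact h2 c hc hck.2 c' hc' hck'.2 hcc
  have := Fintype.ofFinite (Node L m × Prop × Fin L.k)
  obtain ⟨m', G', hseg, S', h1, -, -, h4⟩ := claim Finset.univ
  exact ⟨m', G', hseg, S', fun a ha b hb hab =>
    (hkey a b).1 (h1 a ha (Finset.mem_univ _) b hb hab), h4⟩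

end CodingTree

/-! ### The effect of coding on ages, and the age from which to code. -/

namespace CodingTree

variable {L : BinLang} {𝓕 : Class L L.ku} {K : Str L L.ku ℕ}
variable {C : Choices 𝓕 K} {p : ℕ → Set (Class L 1)} {n : ℕ} {G G' : ℕ → ℕ → Fin L.k}

/-! ### Coding a point -/

theorem Omits.of_surjective {X Y : Type} {S : Str L L.ku X} {T : Str L L.ku Y} {f : X → Y}
    (hS : Omits 𝓕 S) (hf : S.IsEmb T f) (h : Function.Surjective f) : Omits 𝓕 T := by
  obtain ⟨g, hg⟩ := h.hasRightInverse
  exact hS.of_emb (f := g) ⟨hg.injective, fun a => by rw [← hf.2.1, hg], fun a b => by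
    rw [← hf.2.2, hg, hg]⟩

theorem addPointInv_subset_restr {d l : ℕ} {ρ : Fin d → Fin L.ku} {A : Class L d}
    (hA : A ∈ ages 𝓕 K ρ) (j : Fin d) (π : Fin l → Fin d) (φ : Fin l → Fin L.k) :
    addPointInv A j π φ ⊆ restr A π := by
  obtain ⟨N, s, -, -, -, rfl⟩ := hA
  intro X hX
  refine Omits.of_emb (f := Sum.map id some) hX ⟨Sum.map_injective.2
    ⟨Function.injective_id, Option.some_injective _⟩, ?_, ?_⟩
  · rintro (_ | _) <;> rfl
  · rintro (_ | _) (_ | _) <;> rfl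

/-- Passing a coding node. -/
theorem age_coding {d m : ℕ} {r : Fin (d + 1) → ℕ} {j : Fin (d + 1)}
    (hj : row K G (r j) m = nodeAt K m m) :
    age 𝓕 K (tup K G (fun α => r (j.succAbove α)) (m + 1)) =
      addPointInv (age 𝓕 K (tup K G r m)) j j.succAbove (fun α => G (r (j.succAbove α)) m) := by
  have hU : K.U (r j) = K.U m := congrArg Node.u hj
  have hR : ∀ x : Fin m, G (r j) x = K.R m x := fun x => congrFun (congrArg Node.b hj) x
  ext X
  -- The added point becomes the point `m` of `K`, now on the side of the gluing.
  let f : Fin m ⊕ Option X.carrier → Fin (m + 1) ⊕ X.carrier :=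
    Sum.elim (fun x => Sum.inl x.castSucc) (fun o => o.elim (Sum.inl (Fin.last m)) Sum.inr)
  have hf : ((nodeGluing K (tup K G r m)).glue (FinStr.addPoint j j.succAbove
      (fun α => G (r (j.succAbove α)) m) X).str).IsEmb
      ((nodeGluing K (tup K G (fun α => r (j.succAbove α)) (m + 1))).glue X.str) f := by
    refine ⟨?_, ?_, ?_⟩
    · rintro (x | _ | b) (y | _ | c) h
      · exact congrArg Sum.inl (Fin.castSucc_injective _ (Sum.inl_injective h))
      · exact absurd (Sum.inl_injective h) (Fin.castSucc_lt_last x).ne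
      · cases h
      · exact absurd (Sum.inl_injective h).symm (Fin.castSucc_lt_last y).ne
      · rfl
      · cases h
      · cases h
      · cases h
      · exact congrArg (fun b => Sum.inr (some b)) (Sum.inr_injective h)
    · rintro (x | _ | b)
      · rfl
      · exact hU.symm
      · rfl
    · rintro (x | _ | b) (y | _ | c)
      · rfl
      · exact (K.R_flip m x).trans (congrArg L.flip (hR x).symm)
      · rfl
      · exact (hR y).symm
      · exact K.R_self m
      · rfl
      · rfl
      · rfl
      · rfl
  refine ⟨fun hX => Omits.of_emb hX hf, fun hX => Omits.of_surjective hX hf ?_⟩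
  rintro (x | b)
  · rcases x.eq_castSucc_or_eq_last with ⟨y, rfl⟩ | rfl
    · exact ⟨Sum.inl y, rfl⟩
    · exact ⟨Sum.inr none, rfl⟩
  · exact ⟨Sum.inr (some b), rfl⟩

/-- Identifying the added point with `n` maps cliques into the structure given by `hX`. For the
second factor, a clique that meets the gluing contains no other point of the glued structure than
the added one, and `τ` takes care of it. -/
theorem Ambient.subset_addPointInv_lowerAge (H : Ambient 𝓕 K) {N d : ℕ} {τ : Node L N}
    (hτ : FinStr.pt 0 ∈ age₁ 𝓕 K τ) (hτu : τ.u = K.U n) {r : Fin (d + 1) → ℕ} {j : Fin (d + 1)}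
    (hj : ∀ i, r i = n ↔ i = j) :
    age 𝓕 K (fun α => nodeAt K (r (j.succAbove α)) (n + 1)) ⊆
      addPointInv (lowerAge 𝓕 K n τ (d + 1) r) j j.succAbove
        (fun α => K.R (r (j.succAbove α)) n) := by
  classical
  have hrj : r j = n := (hj j).2 rfl
  intro X hX
  refine ⟨H.omits_of_cliques fun Q _ hQ => ⟨_, _, Sum.elim Sum.inl
    (fun o : Option X.carrier => o.elim (Sum.inl (Fin.last n)) Sum.inr), hX, ?_, ?_, ?_⟩,
    H.omits_of_cliques fun Q _ hQ => ?_⟩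
  · have hnone : ∀ x : Fin (n + 1), x = Fin.last n → Sum.inl x ∈ Q → Sum.inr none ∈ Q → False := by
      rintro _ rfl h1 h2
      refine hQ _ h2 _ h1 (fun h => nomatch h) ?_
      show K.R (r j) n = 0
      rw [hrj, K.R_self]
    rintro (x | _ | b) h1 (y | _ | c) h2 h
    · exact congrArg Sum.inl (Sum.inl_injective h)
    · exact (hnone x (Sum.inl_injective h) h1 h2).elim
    · cases h
    · exact (hnone y (Sum.inl_injective h).symm h2 h1).elim
    · rfl
    · cases h
    · cases h
    · cases h
    · exact congrArg (fun b => Sum.inr (some b)) (Sum.inr_injective h)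
  · rintro (x | _ | b) -
    · rfl
    · show K.U n = K.U (r j)
      rw [hrj]
    · rfl
  · rintro (x | _ | b) - (y | _ | c) -
    · rfl
    · show K.R x n = L.flip (K.R (r j) x)
      rw [hrj, ← K.R_flip]
    · rfl
    · show K.R n y = K.R (r j) y
      rw [hrj]
    · exact K.R_self n
    · rfl
    · rfl
    · rfl
    · rfl
  · by_cases hne : ∃ x : Fin N, Sum.inl x ∈ Q
    · obtain ⟨x, hx⟩ := hne
      have hb : ∀ b : X.carrier, Sum.inr (some b) ∉ Q := by
        intro b hb
        refine hQ _ hb _ hx (fun h => nomatch h) ?_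
        show (if r (j.succAbove (X.str.U b)) = n then τ else Node.left _ N).b x = 0
        rw [if_neg fun h => Fin.succAbove_ne j _ ((hj _).1 h)]
        rfl
      refine ⟨_, _, Sum.elim Sum.inl (fun _ => Sum.inr PUnit.unit), hτ, ?_, ?_, ?_⟩
      · rintro (x | _ | b) h1 (y | _ | c) h2 h
        · exact congrArg Sum.inl (Sum.inl_injective h)
        · cases h
        · cases h
        · cases h
        · rfl
        · exact (hb _ h2).elim
        · cases h
        · exact (hb _ h1).elim
        · exact (hb _ h1).elim
      · rintro (x | _ | b) h1
        · rfl
        · show τ.u = (if r j = n then τ else Node.left _ N).u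
          rw [if_pos hrj]
        · exact (hb _ h1).elim
      · have e : (if r j = n then τ else Node.left (K.U (r j)) N) = τ := if_pos hrj
        rintro (x | _ | b) h1 (y | _ | c) h2
        · rfl
        · show L.flip (τ.b x) = L.flip ((if r j = n then τ else Node.left (K.U (r j)) N).b x)
          rw [e]
        · exact (hb _ h2).elim
        · show τ.b y = (if r j = n then τ else Node.left (K.U (r j)) N).b y
          rw [e]
        · rfl
        · exact (hb _ h2).elim
        · exact (hb _ h1).elim
        · exact (hb _ h1).elim
        · exact (hb _ h1).elim
    · have hx : ∀ x : Fin N, Sum.inl x ∉ Q := fun x h => hne ⟨x, h⟩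
      refine ⟨_, _, Sum.elim (fun _ => Sum.inl (Fin.last n))
        (fun o : Option X.carrier => o.elim (Sum.inl (Fin.last n)) Sum.inr), hX, ?_, ?_, ?_⟩
      · rintro (x | _ | b) h1 (y | _ | c) h2 h
        · exact (hx _ h1).elim
        · exact (hx _ h1).elim
        · exact (hx _ h1).elim
        · exact (hx _ h2).elim
        · rfl
        · cases h
        · exact (hx _ h2).elim
        · cases h
        · exact congrArg (fun b => Sum.inr (some b)) (Sum.inr_injective h)
      · rintro (x | _ | b) h1
        · exact (hx _ h1).elim
        · show K.U n = (if r j = n then τ else Node.left _ N).u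
          rw [if_pos hrj, hτu]
        · show K.U (r _) = (if r (j.succAbove (X.str.U b)) = n then τ else Node.left _ N).u
          rw [if_neg fun h => Fin.succAbove_ne j _ ((hj _).1 h)]
          rfl
      · rintro (x | _ | b) h1 (y | _ | c) h2
        · exact (hx _ h1).elim
        · exact (hx _ h1).elim
        · exact (hx _ h1).elim
        · exact (hx _ h2).elim
        · exact K.R_self n
        · rfl
        · exact (hx _ h2).elim
        · rfl
        · rfl

/-- The age from which the point `n` is coded. -/
theorem Ambient.exists_coding_age (H : Ambient 𝓕 K) {N d : ℕ} {τ : Node L N}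
    (hτ : age₁ 𝓕 K τ = Pmin 𝓕 K (K.U n)) (hτu : τ.u = K.U n) {r : Fin (d + 1) → ℕ}
    {j : Fin (d + 1)} (hn : ∀ i, n ≤ r i) (hj : ∀ i, r i = n ↔ i = j) {A : Class L (d + 1)}
    (hA : A ∈ ages 𝓕 K (fun i => K.U (r i))) (hlow : lowerAge 𝓕 K n τ (d + 1) r ⊆ A) :
    ∃ B, B ⊆ lowerAge 𝓕 K n τ (d + 1) r ∧
      ControlledCodingTriple 𝓕 K (fun i => K.U (r i)) B j
        (fun α => K.R (r (j.succAbove α)) n) ∧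
      restr B j.succAbove = age 𝓕 K (fun α => nodeAt K (r (j.succAbove α)) (n + 1)) := by
  classical
  have hrj : r j = n := (hj j).2 rfl
  have hpτ : FinStr.pt 0 ∈ age₁ 𝓕 K τ := by
    rw [hτ]
    exact H.pt_mem_ages (H.Pmin_mem _) 0
  have hE : lowerAge 𝓕 K n τ (d + 1) r ∈ ages 𝓕 K (fun i => K.U (r i)) := by
    rw [← Set.inter_eq_right.2 hlow, lowerAge, ← Set.inter_assoc]
    refine H.inter_mem_ages (H.inter_mem_ages hA rfl (H.omits_comap_val _) fun v => ?_) ?_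
      (H.omits_comap_val _) fun v => ?_
    · refine pt_mem_age_iff.2 ?_
      rcases (hn v).lt_or_eq with h | h
      · exact pt_mem_of_realized H h
      -- The node of `n` at level `n + 1` ends with the conventional value `K.R n n = 0`, so its age
      -- is that of the coding node.
      · have h1 := pt_mem_of_realized H (le_refl n)
        have h2 := H.age_zero (Nat.le_succ n) (ν := fun _ : Fin 1 => K.U n) (g := fun _ => K.R n)
          (fun _ y h1 h2 => by
            obtain rfl : y = n := by omega
            exact K.R_self y)
        rw [← h]
        exact h2.ge h1
    · funext v
      show (if r v = n then τ else Node.left (K.U (r v)) N).u = K.U (r v)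
      split_ifs with h
      · rw [hτu, h]
      · rfl
    · refine pt_mem_age_iff.2 ?_
      show FinStr.pt 0 ∈ age₁ 𝓕 K (if r v = n then τ else Node.left (K.U (r v)) N)
      split_ifs with h
      · exact hpτ
      · exact H.mem_age₁_left.2 (H.omits_single (X := Unit) _)
  set D := age 𝓕 K (fun α => nodeAt K (r (j.succAbove α)) (n + 1)) with hD
  let φ : Fin d → Fin L.k := fun α => K.R (r (j.succAbove α)) n
  have hDE : D ⊆ addPointInv (lowerAge 𝓕 K n τ (d + 1) r) j j.succAbove φ :=
    H.subset_addPointInv_lowerAge hpτ hτu hj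
  have hED : restr (lowerAge 𝓕 K n τ (d + 1) r) j.succAbove ⊆ D := by
    refine (restr_mono Set.inter_subset_left _).trans ?_
    rw [restr_age]
    rfl
  have hEj : restr (lowerAge 𝓕 K n τ (d + 1) r) (fun _ : Fin 1 => j) ⊆ Pmin 𝓕 K (K.U n) := by
    refine (restr_mono Set.inter_subset_right _).trans ?_
    rw [restr_age_one, if_pos hrj, hτ]
  have hfin : {B | B ∈ ages 𝓕 K (fun i => K.U (r i)) ∧ B ⊆ lowerAge 𝓕 K n τ (d + 1) r ∧
      D ⊆ addPointInv B j j.succAbove φ}.Finite := (H.finite_ages _).subset (Set.sep_subset _ _)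
  -- Strictness comes from minimality: a smaller age leaving all of `D` after coding would be a
  -- smaller candidate.
  obtain ⟨B, hB⟩ := hfin.exists_minimal ⟨_, hE, subset_rfl, hDE⟩
  obtain ⟨hB1, hB2, hB3⟩ := hB.prop
  have e1 : restr B j.succAbove ⊆ D := (restr_mono hB2 _).trans hED
  have e2 : addPointInv B j j.succAbove φ ⊆ restr B j.succAbove :=
    addPointInv_subset_restr hB1 _ _ _
  have e3 : restr B j.succAbove = D := e1.antisymm (hB3.trans e2)
  refine ⟨B, hB2, ⟨hB1, ?_, ?_, fun B' hB' hlt => .inr ?_⟩, e3⟩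
  · refine Set.Subset.antisymm ?_ (Pmin_subset (restr_one_mem hB1 j))
    exact (restr_mono hB2 _).trans (hEj.trans (congrArg (fun a => Pmin 𝓕 K (K.U a)) hrj).ge)
  · rw [e3]
    exact (e2.trans e1).antisymm hB3
  · have h1 : addPointInv B' j j.succAbove φ ⊆ restr B j.succAbove :=
      (addPointInv_subset_restr hB' _ _ _).trans (restr_mono hlt.subset _)
    refine h1.ssubset_of_ne fun h => hlt.not_subset ?_
    exact hB.le_of_le ⟨hB', hlt.subset.trans hB2, by rw [h, e3]⟩ hlt.subset

end CodingTree

/-! ### One complete stage: from one coded point to the next. -/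

namespace CodingTree

variable {L : BinLang} {𝓕 : Class L L.ku} {K : Str L L.ku ℕ}
variable {C : Choices 𝓕 K} {p : ℕ → Set (Class L 1)} {n : ℕ} {G G' : ℕ → ℕ → Fin L.k}

/-! ### One stage of the construction -/

/-- The points below `n` have been coded, by levels below `m`. -/
structure StageInv (𝓕 : Class L L.ku) (K : Str L L.ku ℕ) (p : ℕ → Set (Class L 1)) (n m : ℕ)
    (G : ℕ → ℕ → Fin L.k) : Prop where
  ages : ∀ (d : ℕ) (r : Fin d → ℕ), (∀ i, n ≤ r i) →
    age 𝓕 K (tup K G r m) = age 𝓕 K (fun i => nodeAt K (r i) n)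
  rowPath : ∀ a, n ≤ a → ∀ b, n ≤ b → row K G a m = row K G b m →
    p a = p b ∨ (¬ HasFree 𝓕 K (K.U a) ∧ row K G a m = Node.left (K.U a) m)
  node : ∀ a, n ≤ a → ∀ b, n ≤ b → row K G a m = row K G b m → nodeAt K a n = nodeAt K b n
  free : ∀ a, n ≤ a → HasFree 𝓕 K (K.U a) → row K G a m ≠ Node.left (K.U a) m

/-- The point `n` is coded on level `x`. -/
structure Coded (𝓕 : Class L L.ku) (K : Str L L.ku ℕ) (n : ℕ) (G : ℕ → ℕ → Fin L.k) (x : ℕ) :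
    Prop where
  code : row K G n x = code K x
  col : ∀ a, n < a → G a x = K.R a n
  ne : ∀ a, n < a → row K G a x ≠ row K G n x
  noSplit : ∀ a, n < a → ∀ b, n < b → row K G a x = row K G b x → G a x = G b x
  noStart : ∀ a, n < a → row K G a x = Node.left (K.U a) x → G a x = 0
  min : age₁ 𝓕 K (row K G n x) = Pmin 𝓕 K (K.U n)
  path : ∀ a, n < a → age₁ 𝓕 K (row K G a (x + 1)) = age₁ 𝓕 K (row K G a x)
  triple : ∃ (d : ℕ) (r : Fin (d + 1) → ℕ) (j : Fin (d + 1)),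
    IsEnum (tup K G r x) (rows K G n x) ∧
    IsEnum (tup K G (fun α => r (j.succAbove α)) (x + 1)) (rows K G (n + 1) (x + 1)) ∧ r j = n ∧
    ControlledCodingTriple 𝓕 K (fun i => K.U (r i)) (age 𝓕 K (tup K G r x)) j
      (fun α => G (r (j.succAbove α)) x)

/-- Without a free relation, being on the left branch means having the top age, and the invariant
equates the ages of the row and of the node in `K`. -/
theorem Ambient.age₁_eq_left (H : Ambient 𝓕 K) {m a : ℕ} (hS : StageInv 𝓕 K p n m G) (ha : n ≤ a)
    (hf : ¬ HasFree 𝓕 K (K.U a)) :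
    row K G a m = Node.left (K.U a) m ↔ nodeAt K a n = Node.left (K.U a) n := by
  have h := hS.ages 1 (fun _ => a) fun _ => ha
  refine ⟨fun hl => H.eq_left_of_age (s := nodeAt K a n) hf ?_,
    fun hl => H.eq_left_of_age (s := row K G a m) hf ?_⟩
  · have h' : age₁ 𝓕 K (row K G a m) = age₁ 𝓕 K (nodeAt K a n) := h
    rw [hl, H.age₁_left] at h'
    exact h'.le
  · have h' : age₁ 𝓕 K (row K G a m) = age₁ 𝓕 K (nodeAt K a n) := h
    rw [hl, H.age₁_left] at h'
    exact h'.ge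

/-- Starting and separating make the rows distinguishable by their behaviour towards `n`; descending
reaches an age from which coding is controlled; the column with entries `K.R a n` codes `n` and
restores the invariant. -/
theorem Ambient.exists_stage (H : Ambient 𝓕 K) (hp : ∀ a, IsMaxPath 𝓕 K (K.U a) (p a))
    (hpath : ∀ a, Path 𝓕 K a ⊆ p a) {m : ℕ} (hS : StageInv 𝓕 K p n m G) :
    ∃ x G', Seg p n C m m G x G' ∧
      ∀ G'', Agree (x + 1) G' G'' → Coded 𝓕 K n G'' x ∧ StageInv 𝓕 K p (n + 1) (x + 1) G'' := by
  classical
  obtain ⟨N, τ, hτu, -, hτ⟩ := H.exists_of_mem_P₁ (H.Pmin_mem (K.U n))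
  have S₀ : SplitState 𝓕 K p n (lowerAge 𝓕 K n τ) m G := by
    refine ⟨fun a ha => hpath a ⟨n, ha, (hS.ages 1 (fun _ => a) fun _ => ha).symm⟩, hS.rowPath,
      hS.node, hS.free, fun d r hr => ?_⟩
    rw [hS.ages d r hr]
    exact Set.inter_subset_left.trans
      (age_anti (Nat.le_succ n) (fun i => K.U (r i)) fun i => K.R (r i))
  obtain ⟨m', G', hseg, S', hl'⟩ := H.seg_start (C := C) (base := m) hp hpath hτ S₀
    fun a ha hf h => (H.age₁_eq_left hS ha hf).2 h
  obtain ⟨m₁, G₁, hseg₁, S₁, hsep, hl₁⟩ := H.seg_separate (C := C) (base := m) S'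
    fun a ha hf h => (hl' a ha hf h).2
  have hseg₁ := hseg.trans hseg₁
  have hleft : ∀ a, n ≤ a → row K G₁ a m₁ = Node.left (K.U a) m₁ →
      ¬ HasFree 𝓕 K (K.U a) ∧ a ≠ n ∧ K.R a n = 0 ∧
        nodeAt K a (n + 1) = Node.left (K.U a) (n + 1) := by
    intro a ha hla
    have hf : ¬ HasFree 𝓕 K (K.U a) := fun hf => S₁.free a ha hf hla
    obtain ⟨h1, h2, h3⟩ := hl' a ha hf (hl₁ a hla)
    exact ⟨hf, h2, h3, (nd_succ (i := K.U a) (j := K.U a) (g := K.R a)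
      (h := fun _ => 0)).2 ⟨(H.age₁_eq_left hS ha hf).1 h1, h3⟩⟩
  obtain ⟨d, r, idx, hr⟩ := exists_enumerates K n G₁ m₁
  obtain ⟨d, rfl⟩ : ∃ d', d = d' + 1 := ⟨d - 1, by have := (idx n).2; omega⟩
  obtain ⟨j, hj⟩ : ∃ j, idx n = j := ⟨_, rfl⟩
  have hrj : r j = n := by
    have := (hsep n le_rfl (r (idx n)) (hr.le _) (hr.idx_spec n le_rfl)).2.1.1 rfl
    rwa [hj] at this
  have hjn : ∀ i, r i = n ↔ i = j := fun i => by
    refine ⟨fun h => ?_, fun h => h ▸ hrj⟩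
    rw [← hj]
    exact (hr.idx_eq le_rfl (by rw [h])).symm
  have hlow := S₁.lower (d + 1) r hr.le
  have hnode : ∀ a, n ≤ a → nodeAt K a (n + 1) = nodeAt K (r (idx a)) (n + 1) := fun a ha =>
    nd_succ.2 ⟨S₁.node a ha _ (hr.le _) (hr.idx_spec a ha),
      (hsep a ha _ (hr.le _) (hr.idx_spec a ha)).2.2⟩
  have hidxj : ∀ a, n < a → idx a ≠ j := fun a ha h => by
    have := (hsep a ha.le _ (hr.le _) (hr.idx_spec a ha.le)).2.1.2 (by rw [h, hrj])
    omega
  have hpt : ∀ i, FinStr.pt i ∈ age 𝓕 K (tup K G₁ r m₁) := fun i => by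
    refine pt_mem_age_iff.2 ?_
    exact H.pt_mem_ages ((hp _).1.1 (S₁.path (r i) (hr.le i))) 0
  obtain ⟨B, hBlow, htri, hBD⟩ := H.exists_coding_age hτ hτu hr.le hjn (hr.mem_ages H hpt) hlow
  have hBα : ∀ α, restr B (fun _ : Fin 1 => j.succAbove α) =
      age₁ 𝓕 K (nodeAt K (r (j.succAbove α)) (n + 1)) := fun α => by
    have : restr B (fun _ : Fin 1 => j.succAbove α) =
      restr (restr B j.succAbove) (fun _ : Fin 1 => α) := rfl
    rw [this, hBD, restr_age_one]
  have hlt : ∀ α, n + 1 ≤ r (j.succAbove α) := fun α => by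
    have h1 := hr.le (j.succAbove α)
    have h2 : r (j.succAbove α) ≠ n := fun h => Fin.succAbove_ne j α ((hjn _).1 h)
    omega
  -- The classes of `B` in rank one lie on the paths: label `j` has the minimal class, and each
  -- other label has the class of a node of level `n + 1` in `K`.
  obtain ⟨m₂, G₂, hseg₁₂, hage₂, hen₂⟩ := H.seg_descend (C := C) (base := m) (p := p) hp htri.mem
    (fun i => by
      by_cases hi : i = j
      · subst hi
        rw [htri.min, hrj]
        exact (hp n).Pmin_mem H
      · obtain ⟨α, rfl⟩ := Fin.exists_succAbove_eq hi
        rw [hBα]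
        exact hpath _ ⟨n + 1, hlt α, rfl⟩)
    _ m₁ G₁ hseg₁.le hr le_rfl (hBlow.trans hlow) (fun i => S₁.path _ (hr.le i))
    (fun a ha => (S₁.rowPath a ha _ (hr.le _) (hr.idx_spec a ha)).imp_right fun h => h.2)
    (fun i hi => by
      obtain ⟨h1, h2, h3, h4⟩ := hleft _ (hr.le i) hi
      obtain ⟨α, rfl⟩ := Fin.exists_succAbove_eq fun h => h2 ((hjn i).2 h)
      refine ⟨h1, ?_⟩
      rw [hBα, h4, H.age₁_left _ (n + 1)])
  have hseg₂ := hseg₁.trans hseg₁₂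
  -- The level `x` is a point of `K` whose coding node is row `n`, continued by zeros from `m₂` on.
  obtain ⟨x, hmx, hxn, hx0⟩ := H.realize (s := row K G₂ n m₂) (by
    have := H.pt_mem_ages htri.mem j
    rw [← hage₂] at this
    have := pt_mem_age_iff.1 this
    rwa [tup, hrj] at this)
  let v : ℕ → Fin L.k := fun a => K.R a n
  refine ⟨x, addCol G₂ m₂ x v, hseg₂.trans ⟨hmx, addCol_agree (fun _ _ _ => rfl) hmx,
    fun G'' hG y h1 h2 => ?_⟩, fun G'' hG => ?_⟩
  · have h0 : ∀ a y, m₂ ≤ y → y < x → G'' a y = 0 := fun a y h3 h4 => by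
      rw [hG a y h4, addCol_zero (fun _ _ _ => rfl) h3 h4]
    have hGm : Agree m₂ G₂ G'' := (addCol_agree (fun _ _ _ => rfl) hmx).trans (hG.mono hmx)
    refine H.levelOK_zero h1 (fun a _ z h3 h4 => h0 a z h3 (by omega)) fun a ha => ?_
    rw [hGm.row_eq, hen₂.idx_spec a ha, ← restr_age_tup, hage₂]
    by_cases hi : idx a = j
    · have : a = n := (hsep a ha _ (hr.le _) (hr.idx_spec a ha)).2.1.2 (by rw [hi, hrj])
      rw [hi, htri.min, hrj, this]
      exact (hp n).Pmin_mem H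
    · have han : a ≠ n := by
        rintro rfl
        exact hi hj
      obtain ⟨α, hα⟩ := Fin.exists_succAbove_eq hi
      rw [← hα, hBα, hα, ← hnode a ha]
      exact hpath a ⟨n + 1, by omega, rfl⟩
  have h0 : ∀ a y, m₂ ≤ y → y < x → G'' a y = 0 := fun a y => addCol_zero hG
  have hGm : Agree m₂ G₂ G'' := addCol_agree hG hmx
  have hGx : ∀ a, G'' a x = K.R a n := fun a => addCol_self hG hmx a
  have hGm₁ : Agree m₁ G₁ G'' := hseg₁₂.agree.trans (hGm.mono hseg₁₂.le)
  have hm₁ : m₁ ≤ x := hseg₁₂.le.trans hmx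
  have hrow₁ : ∀ a b, row K G'' a x = row K G'' b x → row K G₁ a m₁ = row K G₁ b m₁ := by
    intro a b hab
    rw [← hGm₁.row_eq, ← hGm₁.row_eq]
    exact row_mono hm₁ hab
  have hidx : ∀ a, n ≤ a → row K G'' a x = row K G'' (r (idx a)) x := fun a ha => by
    rw [row_eq_iff_of_zero hmx h0, hGm.row_eq, hGm.row_eq]
    exact hen₂.idx_spec a ha
  have hidx' : ∀ a, n ≤ a → row K G'' a (x + 1) = row K G'' (r (idx a)) (x + 1) := fun a ha => by
    rw [row_succ, hGx, hGx]
    exact ⟨hidx a ha, (hsep a ha _ (hr.le _) (hr.idx_spec a ha)).2.2⟩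
  have hcode : row K G'' n x = nodeAt K x x := by
    refine nd_eq_iff.2 ⟨(congrArg Node.u hxn).symm, fun y hy => ?_⟩
    by_cases hym : y < m₂
    · rw [hGm n y hym]
      exact (congrFun (congrArg Node.b hxn) ⟨y, hym⟩).symm
    · rw [h0 n y (not_lt.1 hym) hy]
      exact (hx0 y (not_lt.1 hym) hy).symm
  have hagex : age 𝓕 K (tup K G'' r x) = B := by
    rw [H.addCol_age_le hG hmx hmx le_rfl, hage₂]
  have hφ : (fun α => G'' (r (j.succAbove α)) x) = fun α => K.R (r (j.succAbove α)) n :=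
    funext fun α => hGx _
  -- Coding turns `B` into its restriction to the other labels, which is the age of the
  -- corresponding nodes of level `n + 1`.
  have hagex' : age 𝓕 K (tup K G'' (fun α => r (j.succAbove α)) (x + 1)) =
      age 𝓕 K (fun α => nodeAt K (r (j.succAbove α)) (n + 1)) := by
    rw [age_coding (by rw [hrj]; exact hcode), hagex, hφ, htri.next, hBD]
  have hleftx : ∀ a, n < a → row K G'' a x = Node.left (K.U a) x →
      row K G₁ a m₁ = Node.left (K.U a) m₁ := fun a _ hla => by
    rw [← hGm₁.row_eq, row_eq_left]
    exact ⟨rfl, fun y hy => (row_eq_left.1 hla).2 y (by omega)⟩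
  have hStage : ∀ (d' : ℕ) (r' : Fin d' → ℕ), (∀ i, n + 1 ≤ r' i) →
      age 𝓕 K (tup K G'' r' (x + 1)) = age 𝓕 K (fun i => nodeAt K (r' i) (n + 1)) := by
    intro d' r' hr'
    have : ∀ i, ∃ α, j.succAbove α = idx (r' i) := fun i =>
      Fin.exists_succAbove_eq (hidxj _ (hr' i))
    choose π hπ using this
    rw [age_tup_comp G'' (fun α => r (j.succAbove α)) r' π fun i => by
      rw [hπ]; exact hidx' _ (Nat.le_of_succ_le (hr' i)), hagex', restr_age]
    congr 1
    funext i
    show nodeAt K (r (j.succAbove (π i))) (n + 1) = _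
    rw [hπ, ← hnode _ (Nat.le_of_succ_le (hr' i))]
  refine ⟨⟨hcode, fun a _ => hGx a, fun a ha h => ?_, fun a ha b hb h => ?_, fun a ha h => ?_, ?_,
    fun a ha => ?_, d, r, j, ?_, ?_, hrj, ?_⟩, ⟨hStage, fun a ha b hb h => ?_,
    fun a ha b hb h => ?_, fun a ha hf h => ?_⟩⟩
  · have := (hsep a ha.le n le_rfl (hrow₁ a n h)).2.1.2 rfl
    omega
  · rw [hGx, hGx]
    exact (hsep a ha.le b hb.le (hrow₁ a b h)).2.2
  · rw [hGx]
    exact (hleft a ha.le (hleftx a ha h)).2.2.1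
  · rw [← hrj, ← restr_age_tup, hagex]
    exact htri.min
  · obtain ⟨α, hα⟩ := Fin.exists_succAbove_eq (hidxj a ha)
    have h1 := hStage 1 (fun _ => a) fun _ => ha
    have h2 : age₁ 𝓕 K (row K G'' a (x + 1)) = age₁ 𝓕 K (nodeAt K a (n + 1)) := h1
    rw [h2, hidx a ha.le, ← restr_age_tup, hagex, ← hα, hBα, hα, ← hnode a ha.le]
  · exact ⟨(hen₂.of_rows hmx hGm hidx).lt, (hen₂.of_rows hmx hGm hidx).isEnum.2⟩
  · refine ⟨fun α β hαβ => ?_, Set.Subset.antisymm ?_ ?_⟩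
    · exact (hen₂.of_rows (m' := x + 1) (by omega) hGm hidx').lt _ _
        (Fin.strictMono_succAbove j hαβ)
    · rintro _ ⟨α, rfl⟩
      exact ⟨_, hlt α, rfl⟩
    · rintro _ ⟨a, ha, rfl⟩
      obtain ⟨α, hα⟩ := Fin.exists_succAbove_eq (hidxj a ha)
      refine ⟨α, ?_⟩
      show row K G'' (r (j.succAbove α)) (x + 1) = _
      rw [hα, ← hidx' a (Nat.le_of_succ_le ha)]
  · rw [hagex, hφ]
    exact htri
  · have ha' := Nat.le_of_succ_le ha
    have h1 := hrow₁ a b (row_succ.1 h).1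
    rcases S₁.rowPath a ha' b (Nat.le_of_succ_le hb) h1 with h2 | ⟨h2, h3⟩
    · exact .inl h2
    · refine .inr ⟨h2, H.eq_left_of_age (s := row K G'' a (x + 1)) h2 ?_⟩
      have h4 : age₁ 𝓕 K (row K G'' a (x + 1)) = age₁ 𝓕 K (nodeAt K a (n + 1)) :=
        hStage 1 (fun _ => a) fun _ => ha
      rw [h4, (hleft a ha' h3).2.2.2, H.age₁_left _ (n + 1)]
      exact le_rfl
  · have h1 := hrow₁ a b (row_succ.1 h).1
    have ha' := Nat.le_of_succ_le ha
    have hb' := Nat.le_of_succ_le hb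
    exact nd_succ.2 ⟨S₁.node a ha' b hb' h1, (hsep a ha' b hb' h1).2.2⟩
  · refine S₁.free a (Nat.le_of_succ_le ha) hf (hleftx a ha ?_)
    rw [row_eq_left] at h ⊢
    exact ⟨rfl, fun y hy => h.2 y (by omega)⟩

end CodingTree

/-! ### Starts by free relations, and the limit of the stages. -/

namespace CodingTree

variable {L : BinLang} {𝓕 : Class L L.ku} {K : Str L L.ku ℕ}
variable {C : Choices 𝓕 K} {p : ℕ → Set (Class L 1)} {n : ℕ} {G G' : ℕ → ℕ → Fin L.k}

/-! ### The start levels of the free symbols -/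

theorem exists_strictMono_of_unbounded {α : Type*} [LinearOrder α] [Finite α]
    {Q : α → ℕ → Prop} (h : ∀ a N, ∃ x, N ≤ x ∧ Q a x) :
    ∃ l : α → ℕ, StrictMono l ∧ ∀ a, Q a (l a) := by
  classical
  have claim : ∀ s : Finset α, ∃ l : α → ℕ, StrictMonoOn l s ∧ ∀ a, Q a (l a) := by
    intro s
    induction s using Finset.induction_on_max with
    | empty =>
      choose l hl using fun a => h a 0
      exact ⟨l, by simp [StrictMonoOn], fun a => (hl a).2⟩
    | insert a s ha ih =>
      obtain ⟨l, hl, hQ⟩ := ih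
      obtain ⟨x, hx, hQx⟩ := h a (s.sup l + 1)
      refine ⟨Function.update l a x, ?_, fun b => ?_⟩
      · intro b hb c hc hbc
        rw [Finset.mem_coe, Finset.mem_insert] at hb hc
        rcases hc with rfl | hc
        · have hbs : b ∈ s := hb.resolve_left hbc.ne
          rw [Function.update_self, Function.update_of_ne hbc.ne]
          have := Finset.le_sup (f := l) hbs
          omega
        · have hca := ha c hc
          have hbs : b ∈ s := hb.resolve_left (hbc.trans hca).ne
          rw [Function.update_of_ne hca.ne, Function.update_of_ne (hbc.trans hca).ne]
          exact hl hbs hc hbc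
      · by_cases hb : b = a
        · subst hb
          rwa [Function.update_self]
        · rw [Function.update_of_ne hb]
          exact hQ b
  have := Fintype.ofFinite α
  obtain ⟨l, hl, hQ⟩ := claim Finset.univ
  exact ⟨l, fun a b hab => hl (by simp) (by simp) hab, hQ⟩

/-- Below `M`, the non-zero entries of the matrix are the prescribed starts of the rows whose
symbol has a free relation: row `a` starts at the level given by the path `P a`. -/
structure FreeStarts (C : Choices 𝓕 K) (P : ℕ → MaxPath 𝓕 K) (l : MaxPath 𝓕 K → ℕ) (M : ℕ)
    (G : ℕ → ℕ → Fin L.k) : Prop where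
  mono : ∀ x y, C.pathOrder.lt x y → l x < l y
  lt : ∀ x, l x < M
  code : ∀ x, CodingTree.code K (l x) = Node.left (C.free x.sort).2 (l x)
  val : ∀ a, HasFree 𝓕 K (K.U a) → G a (l (P a)) = (C.free (K.U a)).1
  zero : ∀ a, ∀ x < M, G a x ≠ 0 → HasFree 𝓕 K (K.U a) ∧ x = l (P a)

/-- Suitable points exist above any level, so the finitely many maximal paths can be given start
levels increasing in `pathOrder`. -/
theorem Ambient.exists_freeStarts (H : Ambient 𝓕 K) (C : Choices 𝓕 K) (P : ℕ → MaxPath 𝓕 K) :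
    ∃ l M G, FreeStarts C P l M G := by
  classical
  let _ := C.pathOrder
  have := H.finite_maxPath
  obtain ⟨l, hl, hcode⟩ := exists_strictMono_of_unbounded (α := MaxPath 𝓕 K)
    (Q := fun y x => CodingTree.code K x = Node.left (C.free y.sort).2 x)
    fun y N => H.exists_left _ N
  have := Fintype.ofFinite (MaxPath 𝓕 K)
  refine ⟨l, Finset.univ.sup l + 1, fun a x => if HasFree 𝓕 K (K.U a) ∧ x = l (P a) then
    (C.free (K.U a)).1 else 0, fun x y h => hl h, fun x => ?_, hcode, fun a ha => ?_,
    fun a x _ h => ?_⟩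
  · exact Nat.lt_succ_of_le (Finset.le_sup (f := l) (Finset.mem_univ x))
  · exact if_pos ⟨ha, rfl⟩
  · by_contra hcon
    exact h (if_neg hcon)

namespace FreeStarts

variable {P : ℕ → MaxPath 𝓕 K} {l : MaxPath 𝓕 K → ℕ} {M : ℕ}

theorem injective (h : FreeStarts C P l M G) : Function.Injective l := by
  let _ := C.pathOrder
  have : StrictMono l := fun x y => h.mono x y
  exact this.injective

theorem of_agree (h : FreeStarts C P l M G) (hG : Agree M G G') : FreeStarts C P l M G' :=
  ⟨h.mono, h.lt, h.code, fun a ha => (hG a _ (h.lt _)).trans (h.val a ha), fun a x hx => by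
    rw [hG a x hx]
    exact h.zero a x hx⟩

theorem ne_zero (h : FreeStarts C P l M G) {a : ℕ} (ha : HasFree 𝓕 K (K.U a)) :
    G a (l (P a)) ≠ 0 := by
  rw [h.val a ha]
  exact (C.free_spec _ ha).1

theorem eq_zero (h : FreeStarts C P l M G) {a x : ℕ} (hx : x < M)
    (hne : HasFree 𝓕 K (K.U a) → x ≠ l (P a)) : G a x = 0 := by
  by_contra hcon
  obtain ⟨h1, h2⟩ := h.zero a x hx hcon
  exact hne h1 h2

theorem row_left (h : FreeStarts C P l M G) {a x : ℕ} (hx : x ≤ M)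
    (hf : HasFree 𝓕 K (K.U a) → x ≤ l (P a)) : row K G a x = Node.left (K.U a) x := by
  rw [row_eq_left]
  refine ⟨rfl, fun y hy => h.eq_zero (hy.trans_le hx) fun ha => ?_⟩
  have := hf ha
  omega

/-- In such a column, the rows with a non-zero entry all come from one left branch and use its free
relation, which excludes nothing. -/
theorem sameAge (h : FreeStarts C P l M G) (H : Ambient 𝓕 K) (hP : ∀ a, (P a).sort = K.U a)
    {x : ℕ} (hx : x < M) : SameAge 𝓕 K 0 G x := by
  classical
  intro d r _
  by_cases hl : ∃ y, l y = x ∧ HasFree 𝓕 K y.sort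
  · obtain ⟨y, rfl, hf⟩ := hl
    have h1 := H.age_col (h.code y) (fun i => K.U (r i)) (fun i => G (r i))
    refine Eq.trans h1 (Set.inter_eq_left.2 ?_)
    refine H.age_subset_col (X := {a | HasFree 𝓕 K (K.U a) ∧ P a = y}) (v := fun a => G a (l y))
      (q := (C.free y.sort).1) (j := (C.free y.sort).2) (s := Node.left y.sort (l y))
      (fun a ha => h.eq_zero hx ?_) (fun a ha => ?_) (fun i hi => ?_) ?_
    · exact fun hf he => ha ⟨hf, (h.injective he).symm⟩
    · obtain ⟨hfa, rfl⟩ := ha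
      rw [h.val a hfa, hP]
    · obtain ⟨hf, hi⟩ := hi
      rw [h.row_left hx.le fun _ => by rw [hi], ← hP, hi]
    · show age₁ 𝓕 K _ ⊆ (Gluing.point y.sort _ _).age 𝓕
      rw [(C.free_spec _ hf).2, H.age₁_left]
  · exact H.age_tup_zero (Nat.le_succ x) fun v z h1 h2 => by
      obtain rfl : z = x := by omega
      exact h.eq_zero hx fun hf he => hl ⟨_, he.symm, by rwa [hP]⟩

theorem age_eq (h : FreeStarts C P l M G) (H : Ambient 𝓕 K) (hP : ∀ a, (P a).sort = K.U a)
    {d : ℕ} (r : Fin d → ℕ) : ∀ x ≤ M, age 𝓕 K (tup K G r x) = age 𝓕 K (tup K G r 0)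
  | 0, _ => rfl
  | x + 1, hx => (h.sameAge H hP hx d r fun _ => Nat.zero_le _).trans (h.age_eq H hP r x (by omega))

theorem row_zero (G : ℕ → ℕ → Fin L.k) (a : ℕ) : row K G a 0 = Node.left (K.U a) 0 :=
  Node.ext rfl (funext fun x => x.elim0)

theorem pathStep (h : FreeStarts C P l M G) (H : Ambient 𝓕 K) (hP : ∀ a, (P a).sort = K.U a)
    (hp : ∀ a, IsMaxPath 𝓕 K (K.U a) (p a)) {x : ℕ} (hx : x < M) : PathStep 𝓕 K p 0 G x :=
  (h.sameAge H hP hx).pathStep fun a _ => by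
    have : age₁ 𝓕 K (row K G a x) = age₁ 𝓕 K (row K G a 0) := h.age_eq H hP (fun _ => a) x hx.le
    rw [this, row_zero]
    exact (hp a).top_mem H

theorem goodSplit (h : FreeStarts C P l M G) (hP : ∀ a, (P a).sort = K.U a)
    (hPp : ∀ a, (P a).path = p a) {x : ℕ} (hx : x < M) (hs : ¬ NoSplit K 0 G x) :
    GoodSplit p 0 G x C := by
  obtain ⟨a, b, hab, ha0, hb0⟩ : ∃ a b, row K G a x = row K G b x ∧ G a x ≠ 0 ∧ G b x = 0 := by
    simp only [NoSplit, Nat.zero_le, forall_const, not_forall] at hs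
    obtain ⟨a, b, hab, hne⟩ := hs
    by_cases ha : G a x = 0
    · exact ⟨b, a, hab.symm, fun hb => hne (ha.trans hb.symm), ha⟩
    · refine ⟨a, b, hab, ha, ?_⟩
      by_contra hb
      obtain ⟨ha1, ha2⟩ := h.zero a x hx ha
      obtain ⟨hb1, hb2⟩ := h.zero b x hx hb
      have hU : K.U a = K.U b := congrArg Node.u hab
      refine hne ?_
      have e1 := h.val a ha1
      have e2 := h.val b hb1
      rw [← ha2] at e1
      rw [← hb2] at e2
      rw [e1, e2, hU]
  obtain ⟨hf, rfl⟩ := h.zero a x hx ha0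
  have hX : ∀ c, c ∈ {c | HasFree 𝓕 K (K.U c) ∧ P c = P a} → K.U c = K.U a := fun c hc => by
    rw [← hP, ← hP, hc.2]
  have hl : ∀ c, c ∈ {c | HasFree 𝓕 K (K.U c) ∧ P c = P a} →
      row K G c (l (P a)) = Node.left (K.U a) (l (P a)) := fun c hc => by
    rw [h.row_left hx.le fun _ => by rw [hc.2], hX c hc]
  refine ⟨{c | HasFree 𝓕 K (K.U c) ∧ P c = P a}, Node.left (K.U a) (l (P a)),
    (C.free (K.U a)).1, (C.free_spec _ hf).1, ⟨a, Nat.zero_le _, hf, rfl⟩, fun c hc _ => hl c hc,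
    ⟨b, Nat.zero_le _, fun hb => ?_, ?_⟩, fun c hc _ => ?_, fun c hc _ => h.eq_zero hx ?_,
    ⟨fun _ => ⟨?_, rfl⟩, fun hn => absurd hf hn, fun hn => absurd hf hn⟩, fun _ c hc _ e he _ => ?_⟩
  · have := h.ne_zero hb.1
    rw [hb.2] at this
    exact this hb0
  · rw [← hab]
    exact hl a ⟨hf, rfl⟩
  · have := h.val c hc.1
    rwa [hc.2, hX c hc] at this
  · exact fun hf he => hc ⟨hf, (h.injective he).symm⟩
  · have := h.code (P a)
    rwa [hP] at this
  · rw [← hPp, ← hPp, hc.2, he.2]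

/-- Ages have not changed since level zero, and two rows with equal nodes and a free symbol start at
the same level, which determines the path. -/
theorem stageInv (h : FreeStarts C P l M G) (H : Ambient 𝓕 K) (hP : ∀ a, (P a).sort = K.U a)
    (hPp : ∀ a, (P a).path = p a) : StageInv 𝓕 K p 0 M G := by
  refine ⟨fun d r _ => (h.age_eq H hP r M le_rfl).trans ?_, fun a _ b _ hab => ?_,
    fun a _ b _ hab => ?_, fun a _ hf hl => ?_⟩
  · congr 1
    funext i
    exact Node.ext rfl (funext fun x => x.elim0)
  · by_cases hf : HasFree 𝓕 K (K.U a)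
    · left
      have hne := h.ne_zero hf
      have : G a (l (P a)) = G b (l (P a)) :=
        congrFun (congrArg Node.b hab) ⟨l (P a), h.lt _⟩
      rw [this] at hne
      rw [← hPp, ← hPp, h.injective (h.zero b _ (h.lt _) hne).2]
    · exact .inr ⟨hf, h.row_left le_rfl fun h => absurd h hf⟩
  · have hU : K.U a = K.U b := congrArg Node.u hab
    exact Node.ext hU (funext fun x => x.elim0)
  · exact h.ne_zero hf ((row_eq_left.1 hl).2 _ (h.lt _))

end FreeStarts

/-! ### The limit of the stages -/

/-- The rows still present on level `x` are those from `n` on. -/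
def IsStage (f : ℕ → ℕ) (n x : ℕ) : Prop := ∀ a, n ≤ a ↔ x ≤ f a

/-- The result of the construction: `f n` is the level on which the point `n` is coded. -/
structure Construction (C : Choices 𝓕 K) (p : ℕ → Set (Class L 1)) (P : ℕ → MaxPath 𝓕 K)
    (l : MaxPath 𝓕 K → ℕ) (M : ℕ) (G : ℕ → ℕ → Fin L.k) (f : ℕ → ℕ) : Prop where
  mono : StrictMono f
  le : ∀ n, M ≤ f n
  starts : FreeStarts C P l M G
  coded : ∀ n, Coded 𝓕 K n G (f n)
  level : ∀ x, M ≤ x → (∀ a, f a ≠ x) → ∃ n base, IsStage f n x ∧ (∀ y, base ≤ y → y ≤ x →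
    IsStage f n y) ∧ LevelOK p n G x C base

theorem Ambient.exists_construction (H : Ambient 𝓕 K) (C : Choices 𝓕 K)
    (hp : ∀ a, IsMaxPath 𝓕 K (K.U a) (p a)) (hpath : ∀ a, Path 𝓕 K a ⊆ p a) :
    ∃ l M G f, Construction C p (fun a => ⟨K.U a, p a, hp a⟩) l M G f := by
  classical
  obtain ⟨l, M, G₀, h₀⟩ := H.exists_freeStarts C fun a => ⟨K.U a, p a, hp a⟩
  have step : ∀ (n : ℕ) (s : {s : ℕ × (ℕ → ℕ → Fin L.k) // StageInv 𝓕 K p n s.1 s.2}),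
      ∃ x G', Seg p n C s.1.1 s.1.1 s.1.2 x G' ∧ ∀ G'', Agree (x + 1) G' G'' →
        Coded 𝓕 K n G'' x ∧ StageInv 𝓕 K p (n + 1) (x + 1) G'' :=
    fun n s => H.exists_stage hp hpath s.2
  choose x G' hseg hcoded using step
  let st : ∀ n : ℕ, {s : ℕ × (ℕ → ℕ → Fin L.k) // StageInv 𝓕 K p n s.1 s.2} := fun n =>
    Nat.rec ⟨(M, G₀), h₀.stageInv H (fun _ => rfl) fun _ => rfl⟩
      (fun n s => ⟨(x n s + 1, G' n s), (hcoded n s _ fun _ _ _ => rfl).2⟩) n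
  let f : ℕ → ℕ := fun n => x n (st n)
  have hst : ∀ n, (st (n + 1)).1 = (f n + 1, G' n (st n)) := fun _ => rfl
  have hle : ∀ n, (st n).1.1 ≤ f n := fun n => (hseg n (st n)).le
  have hf : StrictMono f := strictMono_nat_of_lt_succ fun n => hle (n + 1)
  have hag : ∀ n n', n ≤ n' → Agree (st n).1.1 (st n).1.2 (st n').1.2 := by
    intro n n' h
    induction n', h using Nat.le_induction with
    | base => exact fun _ _ _ => rfl
    | succ n' h ih =>
      refine ih.trans ((hseg n' (st n')).agree.mono ?_)
      clear ih
      induction n', h using Nat.le_induction with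
      | base => exact le_rfl
      | succ n' h ih => exact ih.trans ((hle n').trans (Nat.le_succ _))
  -- Stage `n` starts with at least `n` columns fixed, so column `y` is final from stage `y + 1` on.
  have hn : ∀ n, n ≤ (st n).1.1 := fun n => by
    cases n with
    | zero => exact Nat.zero_le _
    | succ n => exact Nat.succ_le_succ (hf.id_le n)
  let G : ℕ → ℕ → Fin L.k := fun a y => (st (y + 1)).1.2 a y
  have hG : ∀ n, Agree (st n).1.1 (st n).1.2 G := by
    intro n a y hy
    rcases le_total n (y + 1) with h | h
    · exact hag _ _ h a y hy
    · exact (hag _ _ h a y (hn (y + 1))).symm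
  have hM : ∀ n, M ≤ f n := fun n => (hle 0).trans (hf.monotone (Nat.zero_le n))
  refine ⟨l, M, G, f, hf, hM, h₀.of_agree (hG 0), fun n => (hcoded n (st n) G (hG (n + 1))).1, ?_⟩
  intro y hy hyf
  have hex : ∃ n, y ≤ f n := ⟨y, hf.id_le y⟩
  -- The stage containing level `y` is that of the least point coded at or above `y`; its initial
  -- level serves as `base`.
  obtain ⟨n, hn1, hn2⟩ : ∃ n, y ≤ f n ∧ ∀ a < n, f a < y :=
    ⟨Nat.find hex, Nat.find_spec hex, fun a ha => not_le.1 (Nat.find_min hex ha)⟩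
  have hlt : y < f n := lt_of_le_of_ne hn1 (hyf n).symm
  have hbase : ∀ z, (st n).1.1 ≤ z → z ≤ y → IsStage f n z := by
    intro z h1 h2 a
    refine ⟨fun h => (h2.trans hn1).trans (hf.monotone h), fun h => ?_⟩
    by_contra hcon
    cases n with
    | zero => omega
    | succ n =>
      have h3 : f a ≤ f n := hf.monotone (by omega)
      have h4 : f n + 1 ≤ z := h1
      omega
  have hby : (st n).1.1 ≤ y := by
    cases n with
    | zero => exact hy
    | succ n => exact hn2 n (Nat.lt_succ_self n)
  exact ⟨n, (st n).1.1, hbase y hby le_rfl, hbase,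
    (hseg n (st n)).ok G ((hG (n + 1)).mono (Nat.le_succ _)) y hby hlt⟩

end CodingTree

/-! ### Control of splitting levels. -/

namespace CodingTree

variable {L : BinLang} {𝓕 : Class L L.ku} {K : Str L L.ku ℕ}
variable {C : Choices 𝓕 K} {p : ℕ → Set (Class L 1)} {n : ℕ} {G G' : ℕ → ℕ → Fin L.k}

/-! ### Splitting levels are controlled -/

/-- If a node on a left branch passes to a next age, and all others pass by `0`, then the age of
the whole level passes to a next age. -/
theorem Ambient.con_of_left (H : Ambient 𝓕 K) {d m : ℕ} {ρ : Fin d → Fin L.ku}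
    {g : Fin d → ℕ → Fin L.k} {α : Fin d} {j : Fin L.ku}
    (hA : age 𝓕 K (fun v => nd (ρ v) (g v) m) ∈ ages 𝓕 K ρ)
    (hB : age 𝓕 K (fun v => nd (ρ v) (g v) (m + 1)) ∈ ages 𝓕 K ρ)
    (hm : code K m = Node.left j m) (hα : ¬ HasFree 𝓕 K (ρ α))
    (hleft : nd (ρ α) (g α) m = Node.left (ρ α) m) (h0 : ∀ v, v ≠ α → g v m = 0)
    (hcon : Con 𝓕 K (sort₁ (ρ α)) (age₁ 𝓕 K (nd (ρ α) (g α) m))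
      (age₁ 𝓕 K (nd (ρ α) (g α) (m + 1)))) :
    Con 𝓕 K ρ (age 𝓕 K (fun v => nd (ρ v) (g v) m)) (age 𝓕 K (fun v => nd (ρ v) (g v) (m + 1))) := by
  have hBA : age 𝓕 K (fun v => nd (ρ v) (g v) (m + 1)) ⊆ age 𝓕 K (fun v => nd (ρ v) (g v) m) :=
    age_anti (Nat.le_succ m) ρ g
  have hcol := H.age_col hm ρ g
  refine ⟨hA, hB, hBA.ssubset_of_ne fun h => ?_, ?_⟩
  · have h1 := congrArg (fun A => restr A (fun _ : Fin 1 => α)) h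
    have h1 : restr _ (fun _ : Fin 1 => α) = restr _ (fun _ : Fin 1 => α) := h1
    rw [restr_age_one, restr_age_one] at h1
    exact hcon.2.2.1.ne h1
  rintro ⟨D, hD, hBD, hDA⟩
  have h1 := restr_mono hBD.subset (fun _ : Fin 1 => α)
  have h2 := restr_mono hDA.subset (fun _ : Fin 1 => α)
  rw [restr_age_one] at h1 h2
  -- If the class of `D` at `α` is the top, the node of `α` is a left branch and imposes nothing,
  -- and the remaining labels are unaffected by the column; so `D` contains the upper age. Otherwise
  -- the class at `α` is the new one, and `D` satisfies the condition of the column.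
  rcases hcon.between (restr_one_mem hD α) h1 h2 with h3 | h3
  · refine hDA.not_subset fun X hX => ?_
    obtain ⟨N, σ, -, -, hσρ, rfl⟩ := hD
    rw [restr_age_one, hleft, H.age₁_left] at h3
    have hσα : σ α = Node.left (ρ α) N := by
      rw [← hσρ α]
      refine H.eq_left_of_age ?_ ?_
      · rwa [hσρ]
      · rw [h3, hσρ]
    have hsort : (nodeGluing K σ).sort = ρ := funext hσρ
    refine H.mem_gluing_age (γ := nodeGluing K σ) (γ' := nodeGluing K σ) (ψ := id)
      (by rw [hsort]; exact omits_relabel_of_mem_age hX) {v | v ≠ α} (fun v hv x => ?_)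
      (fun v => v) ⟨Function.injective_id, fun _ => rfl, fun _ _ => rfl⟩ (fun _ => rfl)
      (fun _ _ => rfl) (hBD.subset ?_)
    · obtain rfl : v = α := not_not.1 hv
      exact congrFun (congrArg Node.b hσα) x
    -- All labels other than `α` pass level `m` by zero, so after dropping the points labelled `α`
    -- there is no difference between the two levels.
    · have hX0 : X ∈ age 𝓕 K (fun v => nd (ρ v) (fun y => if y < m then g v y else 0) (m + 1)) := by
        have : (fun v => nd (ρ v) (g v) m) =
            fun v => nd (ρ v) (fun y => if y < m then g v y else 0) m :=
          funext fun v => nd_eq_iff.2 ⟨rfl, fun y hy => (if_pos hy).symm⟩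
        rw [H.age_zero (Nat.le_succ m) fun v y h4 h5 => if_neg (not_lt.2 h4), ← this]
        exact hX
      refine sub_mem_age (fun v => nd_eq_iff.2 ⟨rfl, fun y hy => ?_⟩) hX0
      by_cases hym : y < m
      · exact if_pos hym
      · obtain rfl : y = m := by omega
        rw [if_neg hym, h0 _ v.2]
  · refine hBD.not_subset fun X hX => ?_
    rw [hcol]
    refine ⟨hDA.subset hX, H.mem_col_age {α} (fun v hv => h0 v hv) (i := ρ α) (q := g α m)
      (fun v hv => by rw [Set.mem_singleton_iff] at hv; subst hv; exact ⟨rfl, rfl⟩)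
      (omits_of_mem_ages hD hX) ?_⟩
    have h4 : X.sub {α} (fun _ => 0) ∈ restr D (fun _ : Fin 1 => α) :=
      sub_mem_restr hD hX fun v => v.2.symm
    rw [h3] at h4
    have h5 := age₁_subset_point (nd (ρ α) (g α) (m + 1)) (Fin.last m) h4
    have hU : K.U m = j := congrArg Node.u hm
    rw [← hU]
    exact h5

theorem predAbove_succ_succAbove {d : ℕ} (α i : Fin d) :
    α.predAbove (α.succ.succAbove i) = i := by
  rcases lt_or_ge α i with h | h
  · rw [Fin.succAbove_of_le_castSucc _ _ (Fin.succ_le_castSucc_iff.2 h), Fin.predAbove_succ_of_le _ _ h.le]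
  · rw [Fin.succAbove_of_castSucc_lt _ _ (Fin.castSucc_lt_succ_iff.2 h), Fin.predAbove_castSucc_of_le _ _ h]

/-- `α.predAbove` merges the two successors of the splitting node, so the order on the next level is
inherited except for this pair. -/
theorem predAbove_lt_or {d : ℕ} (α : Fin d) {i i' : Fin (d + 1)} (h : i < i') :
    α.predAbove i < α.predAbove i' ∨ i = α.castSucc ∧ i' = α.succ := by
  by_cases hi : i = α.succ
  · subst hi
    left
    rw [Fin.predAbove_succ_self, Fin.predAbove_of_castSucc_lt _ _
      ((Fin.castSucc_lt_succ).trans h), Fin.lt_pred_iff]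
    exact h
  · obtain ⟨u, rfl⟩ := Fin.exists_succAbove_eq hi
    by_cases hi' : i' = α.succ
    · subst hi'
      rw [predAbove_succ_succAbove, Fin.predAbove_succ_self]
      rcases lt_trichotomy u α with h1 | h1 | h1
      · exact .inl h1
      · subst h1
        exact .inr ⟨Fin.succAbove_succ_self u, rfl⟩
      · rw [Fin.succAbove_of_le_castSucc _ _ (Fin.succ_le_castSucc_iff.2 h1)] at h
        exact absurd (Fin.succ_lt_succ_iff.1 h) h1.not_gt
    · obtain ⟨u', rfl⟩ := Fin.exists_succAbove_eq hi'
      rw [predAbove_succ_succAbove, predAbove_succ_succAbove]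
      exact .inl ((Fin.strictMono_succAbove _).lt_iff_lt.1 h)

/-- The next level is enumerated by doubling index `α`: value zero at `α.castSucc`, value `q` at
`α.succ`. The order is right because zero is the least value. -/
theorem Ambient.controlledSplitting_of_goodSplit (H : Ambient 𝓕 K)
    (hp : ∀ a, IsMaxPath 𝓕 K (K.U a) (p a)) {m : ℕ} {A : Set ℕ}
    (hs : GoodSplit p n G m C) (hpath : PathStep 𝓕 K p n G m)
    (hpath' : ∀ a, n ≤ a → age₁ 𝓕 K (row K G a m) ∈ p a)
    (hlev : lev K A m = rows K G n m) (hlev' : lev K A (m + 1) = rows K G n (m + 1))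
    (hA : ∀ a, n ≤ a → ∀ b, n ≤ b → row K G a m = row K G b m → G a m ≠ G b m →
      IsSplitNode K A (row K G a m)) : ControlledSplitting C A m := by
  classical
  obtain ⟨X, s, q, hq, ⟨a₀, ha₀, haX⟩, hXs, ⟨b₀, hb₀, hbX, hbs⟩, hXq, hX0, hcontrol, -⟩ := hs
  have hsa := hXs a₀ haX ha₀
  obtain ⟨d, r, idx, hr⟩ := exists_enumerates K n G m
  obtain ⟨α, hα⟩ : ∃ α, idx b₀ = α := ⟨_, rfl⟩
  have hrα : row K G (r α) m = s := by rw [← hα, ← hr.idx_spec b₀ hb₀, hbs]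
  -- The splitting node is represented by a row outside `X`, so that every representative continues
  -- by zero.
  let r₀ : Fin d → ℕ := fun i => if i = α then b₀ else r i
  have hr₀α : r₀ α = b₀ := if_pos rfl
  have hrow₀ : ∀ i, row K G (r₀ i) m = row K G (r i) m := fun i => by
    by_cases hi : i = α
    · rw [hi, hr₀α, hbs, hrα]
    · simp only [r₀, if_neg hi]
  have hr₀ : Enumerates K n G m r₀ idx := by
    refine ⟨fun i => ?_, fun i i' h => ?_, fun a ha => ?_⟩
    · by_cases hi : i = α
      · rw [hi, hr₀α]; exact hb₀
      · simp only [r₀, if_neg hi]; exact hr.le i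
    · rw [hrow₀, hrow₀]; exact hr.lt i i' h
    · rw [hrow₀]; exact hr.idx_spec a ha
  have hs₀ : row K G (r₀ α) m = s := by rw [hr₀α, hbs]
  have hr₀X : ∀ i, r₀ i ∉ X := fun i hi => by
    have h1 := hXs _ hi (hr₀.le i)
    have h2 : i = α := hr₀.isEnum.injective (h1.trans hs₀.symm)
    rw [h2, hr₀α] at hi
    exact hbX hi
  let rt : Fin (d + 1) → ℕ := fun i => if i = α.succ then a₀ else r₀ (α.predAbove i)
  have hrt1 : rt α.succ = a₀ := if_pos rfl
  have hrt2 : ∀ i, i ≠ α.succ → rt i = r₀ (α.predAbove i) := fun i hi => if_neg hi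
  have hrtn : ∀ i, n ≤ rt i := fun i => by
    by_cases hi : i = α.succ
    · rw [hi, hrt1]; exact ha₀
    · rw [hrt2 i hi]; exact hr₀.le _
  have hrtrow : ∀ i, row K G (rt i) m = row K G (r₀ (α.predAbove i)) m := fun i => by
    by_cases hi : i = α.succ
    · rw [hi, hrt1, Fin.predAbove_succ_self, hs₀, hsa]
    · rw [hrt2 i hi]
  have hG0 : ∀ i, G (r₀ i) m = 0 := fun i => hX0 _ (hr₀X i) (hr₀.le i)
  have hGa : G a₀ m = q := hXq a₀ haX ha₀
  have ht : IsEnum (tup K G rt (m + 1)) (rows K G n (m + 1)) := by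
    refine ⟨fun i i' h => ?_, Set.Subset.antisymm ?_ ?_⟩
    · rcases predAbove_lt_or α h with h1 | ⟨rfl, rfl⟩
      · refine LexLT_nd_mono (Nat.le_succ m) ?_
        have := hr₀.lt _ _ h1
        rwa [← hrtrow, ← hrtrow] at this
      · show (row K G (rt α.castSucc) (m + 1)).LexLT (row K G (rt α.succ) (m + 1))
        rw [hrt1, hrt2 _ Fin.castSucc_lt_succ.ne, Fin.predAbove_castSucc_self]
        have e1 : row K G (r₀ α) (m + 1) = s.snoc 0 := by
          rw [← hs₀, ← hG0 α]
          exact (snoc_nd _ _ _).symm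
        have e2 : row K G a₀ (m + 1) = s.snoc q := by
          rw [← hsa, ← hGa]
          exact (snoc_nd _ _ _).symm
        rw [e1, e2]
        exact snoc_LexLT_self s (Fin.pos_iff_ne_zero.2 hq)
    · rintro _ ⟨i, rfl⟩
      exact ⟨_, hrtn i, rfl⟩
    · rintro _ ⟨c, hc, rfl⟩
      by_cases hcX : c ∈ X
      · refine ⟨α.succ, ?_⟩
        show row K G (rt α.succ) (m + 1) = _
        rw [hrt1, row_succ, hsa, hXs c hcX hc, hGa, hXq c hcX hc]
        exact ⟨rfl, rfl⟩
      · refine ⟨α.succ.succAbove (idx c), ?_⟩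
        show row K G (rt (α.succ.succAbove (idx c))) (m + 1) = _
        rw [hrt2 _ (Fin.succAbove_ne _ _), predAbove_succ_succAbove, row_succ, hG0, hX0 c hcX hc]
        exact ⟨(hr₀.idx_spec c hc).symm, rfl⟩
  have htα : tup K G rt (m + 1) α.succ = (tup K G r₀ m α).snoc q := by
    show row K G (rt α.succ) (m + 1) = (row K G (r₀ α) m).snoc q
    rw [hrt1, hs₀, ← hsa, ← hGa]
    exact (snoc_nd _ _ _).symm
  have hsα : tup K G r₀ m α = s := hs₀
  refine ⟨d, tup K G r₀ m, tup K G rt (m + 1), α, hlev ▸ hr₀.isEnum, hlev' ▸ ht, ?_, ?_, ?_, ?_⟩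
  · rw [hsα, ← hsa]
    refine hA a₀ ha₀ b₀ hb₀ (by rw [hsa, hbs]) ?_
    rw [hGa, hX0 b₀ hbX hb₀]
    exact hq
  · rw [htα, hsα]
    intro hf
    obtain ⟨h1, h2⟩ := hcontrol.1 hf
    exact ⟨h1, by rw [h2]⟩
  · rw [htα, hsα]
    intro hf hl
    obtain ⟨y, h1, h2, h3⟩ := hcontrol.2.1 hf hl
    exact ⟨y, h1, h2, by rw [h3]⟩
  · rw [htα, hsα]
    intro hf hl
    obtain ⟨h1, j, h2, h3⟩ := hcontrol.2.2 hf hl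
    refine ⟨?_, q, j, hq, rfl, h2, h3⟩
    have hpt : ∀ a, n ≤ a → FinStr.pt 0 ∈ age₁ 𝓕 K (row K G a m) := fun a ha =>
      H.pt_mem_ages ((hp a).1.1 (hpath' a ha)) 0
    have hpt' : ∀ a, n ≤ a → FinStr.pt 0 ∈ age₁ 𝓕 K (row K G a (m + 1)) := fun a ha =>
      H.pt_mem_ages ((hp a).1.1 (hpath a ha).1) 0
    -- Omitting the zero successor of the splitting node amounts to representing that node by `a₀`,
    -- which continues by `q`.
    let r₁ : Fin d → ℕ := fun i => rt (α.castSucc.succAbove i)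
    have hr₁ : ∀ i, row K G (r₁ i) m = row K G (r₀ i) m := fun i => by
      simp only [r₁]
      rw [hrtrow, Fin.predAbove_succAbove]
    have hr₁α : r₁ α = a₀ := by
      simp only [r₁]
      rw [Fin.succAbove_castSucc_self, hrt1]
    have hr₁n : ∀ i, n ≤ r₁ i := fun i => hrtn _
    have hr₁0 : ∀ i, i ≠ α → G (r₁ i) m = 0 := fun i hi => by
      have : α.castSucc.succAbove i ≠ α.succ := fun h => hi (Fin.succAbove_right_injective
        (h.trans (Fin.succAbove_castSucc_self α).symm))
      simp only [r₁]
      rw [hrt2 _ this, hG0]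
    have e1 : tup K G r₀ m = tup K G r₁ m := funext fun i => (hr₁ i).symm
    have hU : ∀ i, K.U (r₀ i) = K.U (r₁ i) := fun i => congrArg Node.u (hr₁ i).symm
    have hsort : (fun i => (tup K G r₀ m i).u) = fun i => K.U (r₁ i) := funext hU
    have hlt : ∀ i i', i < i' → (row K G (r₁ i) m).LexLT (row K G (r₁ i') m) := fun i i' h => by
      rw [hr₁, hr₁]
      exact hr₀.lt i i' h
    have hsu : s.u = K.U (r₁ α) := by rw [hr₁α, ← hsa]; rfl
    rw [hsort, e1]
    refine H.con_of_left (ρ := fun i => K.U (r₁ i)) (g := fun i => G (r₁ i)) (α := α) (j := j)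
      ⟨m, _, hlt, fun i => H.mem_lev_univ.2 (hpt _ (hr₁n i)), fun _ => rfl, rfl⟩
      ⟨m + 1, _, fun i i' h => LexLT_nd_mono (Nat.le_succ m) (hlt i i' h),
        fun i => H.mem_lev_univ.2 (hpt' _ (hr₁n i)), fun _ => rfl, rfl⟩ h3 (hsu ▸ hf) ?_ hr₁0 ?_
    · show row K G (r₁ α) m = _
      rw [← hsu, hr₁α, hsa, ← hl]
    · have e2 : row K G (r₁ α) m = s := by rw [hr₁α, hsa]
      have e3 : row K G (r₁ α) (m + 1) = s.snoc q := by
        rw [← e2, ← hGa, ← hr₁α]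
        exact (snoc_nd _ _ _).symm
      show Con 𝓕 K (sort₁ (K.U (r₁ α))) (age₁ 𝓕 K (row K G (r₁ α) m))
        (age₁ 𝓕 K (row K G (r₁ α) (m + 1)))
      rw [e2, e3, ← hsu]
      exact h1

end CodingTree

/-! ### Reading off diagonality from the matrix. -/

namespace CodingTree

variable {L : BinLang} {𝓕 : Class L L.ku} {K : Str L L.ku ℕ}
variable {C : Choices 𝓕 K} {p : ℕ → Set (Class L 1)} {n : ℕ} {G G' : ℕ → ℕ → Fin L.k}

/-! ### The result of the construction is diagonal -/

/-- Without splitting, the same row indices enumerate both levels, and enumerations are unique. -/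
theorem age_eq_of_noSplit {x d : ℕ} {s : Fin d → Node L x} {t : Fin d → Node L (x + 1)}
    (hns : NoSplit K n G x) (hsame : SameAge 𝓕 K n G x) (hs : IsEnum s (rows K G n x))
    (ht : IsEnum t (rows K G n (x + 1))) : age 𝓕 K s = age 𝓕 K t := by
  obtain ⟨d', r, idx, hr⟩ := exists_enumerates K n G x
  obtain ⟨rfl, e⟩ := hs.unique hr.isEnum
  have hr' : IsEnum (tup K G r (x + 1)) (rows K G n (x + 1)) := by
    refine ⟨fun i j hij => LexLT_nd_mono (Nat.le_succ x) (hr.lt i j hij),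
      Set.Subset.antisymm ?_ ?_⟩
    · rintro _ ⟨i, rfl⟩
      exact ⟨_, hr.le i, rfl⟩
    · rintro _ ⟨a, ha, rfl⟩
      exact ⟨idx a, (row_succ.2 ⟨hr.idx_spec a ha, hns a ha _ (hr.le _) (hr.idx_spec a ha)⟩).symm⟩
  obtain ⟨_, e'⟩ := ht.unique hr'
  have hs' : s = tup K G r x := e
  have ht' : t = tup K G r (x + 1) := e'
  rw [hs', ht', hsame _ r hr.le]

theorem GoodSplit.not_noSplit {x : ℕ} (h : GoodSplit p n G x C) : ¬ NoSplit K n G x := by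
  obtain ⟨X, s, q, hq, ⟨a, ha, haX⟩, hXs, ⟨b, hb, hbX, hbs⟩, hXq, hX0, -⟩ := h
  intro hns
  have := hns a ha b hb ((hXs a haX ha).trans hbs.symm)
  rw [hXq a haX ha, hX0 b hbX hb] at this
  exact hq this

theorem IsStage.succ {f : ℕ → ℕ} {x : ℕ} (hn : IsStage f n x) (hx : ∀ a, f a ≠ x) :
    IsStage f n (x + 1) :=
  fun a => (hn a).trans ⟨fun h => lt_of_le_of_ne h (hx a).symm, fun h => Nat.le_of_succ_le h⟩

namespace Construction

variable {hp : ∀ a, IsMaxPath 𝓕 K (K.U a) (p a)} {l : MaxPath 𝓕 K → ℕ} {M : ℕ} {f : ℕ → ℕ}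

theorem U_eq (h : Construction C p (fun a => ⟨K.U a, p a, hp a⟩) l M G f)
    (a : ℕ) : K.U (f a) = K.U a := (congrArg Node.u (h.coded a).code).symm

theorem node_eq (h : Construction C p (fun a => ⟨K.U a, p a, hp a⟩) l M G f)
    {a x : ℕ} (hx : x ≤ f a) : nodeAt K (f a) x = row K G a x :=
  nd_mono hx (h.coded a).code.symm

theorem R_eq (h : Construction C p (fun a => ⟨K.U a, p a, hp a⟩) l M G f)
    {a x : ℕ} (hx : x < f a) : K.R (f a) x = G a x :=
  congrFun (congrArg Node.b (h.coded a).code.symm) ⟨x, hx⟩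

theorem isOEmb (h : Construction C p (fun a => ⟨K.U a, p a, hp a⟩) l M G f) : K.IsOEmb K f := by
  have hlt : ∀ a b, a < b → K.R (f b) (f a) = K.R b a := fun a b hab => by
    rw [h.R_eq (h.mono hab), (h.coded a).col b hab]
  refine ⟨h.mono, h.mono.injective, h.U_eq, fun a b => ?_⟩
  rcases lt_trichotomy a b with hab | rfl | hab
  · rw [K.R_flip (f b), hlt a b hab, ← K.R_flip]
  · rw [K.R_self, K.R_self]
  · exact hlt b a hab

theorem isStage_self (h : Construction C p (fun a => ⟨K.U a, p a, hp a⟩) l M G f)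
    (n : ℕ) : IsStage f n (f n) := fun _ => h.mono.le_iff_le.symm

theorem isStage_self_succ (h : Construction C p (fun a => ⟨K.U a, p a, hp a⟩) l M G f)
    (n : ℕ) : IsStage f (n + 1) (f n + 1) := fun _ =>
  h.mono.lt_iff_lt.symm

theorem isStage_zero (h : Construction C p (fun a => ⟨K.U a, p a, hp a⟩) l M G f)
    {x : ℕ} (hx : x ≤ M) : IsStage f 0 x := fun a =>
  ⟨fun _ => hx.trans (h.le a), fun _ => Nat.zero_le a⟩

theorem ne_of_lt (h : Construction C p (fun a => ⟨K.U a, p a, hp a⟩) l M G f)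
    {x : ℕ} (hx : x < M) (a : ℕ) : f a ≠ x := fun e => by
  have := h.le a
  omega

theorem lev_eq (h : Construction C p (fun a => ⟨K.U a, p a, hp a⟩) l M G f)
    {x : ℕ} (hn : IsStage f n x) : lev K (Set.range f) x = rows K G n x := by
  ext t
  constructor
  · rintro ⟨_, ⟨a, rfl⟩, hx, rfl⟩
    exact ⟨a, (hn a).2 hx, (h.node_eq hx).symm⟩
  · rintro ⟨a, ha, rfl⟩
    exact ⟨f a, ⟨a, rfl⟩, (hn a).1 ha, h.node_eq ((hn a).1 ha)⟩

theorem isSplitNode_iff (h : Construction C p (fun a => ⟨K.U a, p a, hp a⟩) l M G f)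
    {x : ℕ} {s : Node L x} : IsSplitNode K (Set.range f) s ↔
    ∃ a b, x < f a ∧ x < f b ∧ row K G a x = s ∧ row K G b x = s ∧ G a x ≠ G b x := by
  constructor
  · rintro ⟨_, ⟨a, rfl⟩, _, ⟨b, rfl⟩, ha, hb, h1, h2, h3⟩
    rw [h.node_eq ha.le] at h1
    rw [h.node_eq hb.le] at h2
    rw [h.R_eq ha, h.R_eq hb] at h3
    exact ⟨a, b, ha, hb, h1, h2, h3⟩
  · rintro ⟨a, b, ha, hb, h1, h2, h3⟩
    rw [← h.node_eq ha.le] at h1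
    rw [← h.node_eq hb.le] at h2
    rw [← h.R_eq ha, ← h.R_eq hb] at h3
    exact ⟨_, ⟨a, rfl⟩, _, ⟨b, rfl⟩, ha, hb, h1, h2, h3⟩

theorem exists_level (h : Construction C p (fun a => ⟨K.U a, p a, hp a⟩) l M G f)
    (H : Ambient 𝓕 K) {x : ℕ} (hx : ∀ a, f a ≠ x) : ∃ n, IsStage f n x ∧
    PathStep 𝓕 K p n G x ∧ (NoSplit K n G x ∨ GoodSplit p n G x C) := by
  by_cases hM : x < M
  · refine ⟨0, h.isStage_zero hM.le, h.starts.pathStep H (fun _ => rfl) hp hM, ?_⟩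
    by_cases hs : NoSplit K 0 G x
    · exact .inl hs
    · exact .inr (h.starts.goodSplit (fun _ => rfl) (fun _ => rfl) hM hs)
  · obtain ⟨n, base, h1, -, h2, h3 | h3 | h3⟩ := h.level x (not_lt.1 hM) hx
    · exact ⟨n, h1, h2, .inl h3.1⟩
    · exact ⟨n, h1, h2, .inl h3.1⟩
    · exact ⟨n, h1, h2, .inr h3⟩

theorem not_sp_coded (h : Construction C p (fun a => ⟨K.U a, p a, hp a⟩) l M G f)
    (n : ℕ) : f n ∉ Sp K (Set.range f) := by
  rintro ⟨s, hs⟩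
  obtain ⟨a, b, ha, hb, h1, h2, h3⟩ := h.isSplitNode_iff.1 hs
  exact h3 ((h.coded n).noSplit a (h.mono.lt_iff_lt.1 ha) b (h.mono.lt_iff_lt.1 hb)
    (h1.trans h2.symm))

theorem not_sp_of_noSplit (h : Construction C p (fun a => ⟨K.U a, p a, hp a⟩) l M G f)
    {x : ℕ} (hn : IsStage f n x) (hs : NoSplit K n G x) :
    x ∉ Sp K (Set.range f) := by
  rintro ⟨s, hs'⟩
  obtain ⟨a, b, ha, hb, h1, h2, h3⟩ := h.isSplitNode_iff.1 hs'
  exact h3 (hs a ((hn a).2 ha.le) b ((hn b).2 hb.le) (h1.trans h2.symm))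

theorem exists_goodSplit (h : Construction C p (fun a => ⟨K.U a, p a, hp a⟩) l M G f)
    (H : Ambient 𝓕 K) {x : ℕ} (hx : x ∈ Sp K (Set.range f)) :
    (∀ a, f a ≠ x) ∧ ∃ n, IsStage f n x ∧ PathStep 𝓕 K p n G x ∧ GoodSplit p n G x C := by
  have hne : ∀ a, f a ≠ x := by
    rintro a rfl
    exact h.not_sp_coded a hx
  obtain ⟨n, hn, hpath, hs | hs⟩ := h.exists_level H hne
  · exact absurd hx (h.not_sp_of_noSplit hn hs)
  · exact ⟨hne, n, hn, hpath, hs⟩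

/-- Coding levels leave the classes of the later rows unchanged; all other levels satisfy
`PathStep`. -/
theorem step (h : Construction C p (fun a => ⟨K.U a, p a, hp a⟩) l M G f)
    (H : Ambient 𝓕 K) {a x : ℕ} (hx : x < f a) :
    age₁ 𝓕 K (row K G a (x + 1)) = age₁ 𝓕 K (row K G a x) ∨
      age₁ 𝓕 K (row K G a (x + 1)) ∈ p a ∧
      Con 𝓕 K (sort₁ (K.U a)) (age₁ 𝓕 K (row K G a x)) (age₁ 𝓕 K (row K G a (x + 1))) := by
  by_cases hne : ∀ b, f b ≠ x
  · obtain ⟨n, hn, hpath, -⟩ := h.exists_level H hne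
    obtain ⟨h1, h2⟩ := hpath a ((hn a).2 hx.le)
    exact h2.imp_right fun h3 => ⟨h1, h3⟩
  · simp only [not_forall, not_not] at hne
    obtain ⟨b, rfl⟩ := hne
    exact .inl ((h.coded b).path a (h.mono.lt_iff_lt.1 hx))

theorem age_mem (h : Construction C p (fun a => ⟨K.U a, p a, hp a⟩) l M G f)
    (H : Ambient 𝓕 K) (a : ℕ) : ∀ x ≤ f a, age₁ 𝓕 K (row K G a x) ∈ p a
  | 0, _ => by
    rw [FreeStarts.row_zero]
    exact (hp a).top_mem H
  | x + 1, hx => by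
    rcases h.step H (show x < f a from hx) with h1 | h1
    · rw [h1]
      exact h.age_mem H a x (Nat.le_of_succ_le hx)
    · exact h1.1

/-- The row descends from the top to the minimum by consecutive steps within `p a`, so it visits all
of it. -/
theorem path_eq (h : Construction C p (fun a => ⟨K.U a, p a, hp a⟩) l M G f)
    (H : Ambient 𝓕 K) (a : ℕ) : Path 𝓕 K (f a) = p a := by
  have h1 := (hp a).eq_of_steps H (fun x => age₁ 𝓕 K (row K G a x)) (f a)
    (by rw [FreeStarts.row_zero]) (h.age_mem H a)
    (fun x hx => (h.step H hx).imp_right fun h => h.2) (h.coded a).min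
  rw [← h1]
  ext A
  refine exists_congr fun x => and_congr_right fun hx => ?_
  rw [h.node_eq hx]

/-- Without a free relation, the final class is minimal and differs from the top, so the row has
left the left branch. -/
theorem exists_ne_zero (h : Construction C p (fun a => ⟨K.U a, p a, hp a⟩) l M G f)
    (H : Ambient 𝓕 K) (a : ℕ) : HasStart K (f a) := by
  by_cases hf : HasFree 𝓕 K (K.U a)
  · have hlt : l ⟨K.U a, p a, hp a⟩ < f a := (h.starts.lt _).trans_le (h.le a)
    refine ⟨_, hlt, ?_⟩
    rw [h.R_eq hlt]
    exact h.starts.ne_zero hf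
  · by_contra hcon
    have h0 : row K G a (f a) = Node.left (K.U a) (f a) := by
      rw [row_eq_left]
      refine ⟨rfl, fun x hx => ?_⟩
      rw [← h.R_eq hx]
      by_contra hne
      exact hcon ⟨x, hx, hne⟩
    have h1 := (h.coded a).min
    rw [h0, H.age₁_left] at h1
    exact H.Pmin_ne_top hf h1.symm

theorem start_spec (h : Construction C p (fun a => ⟨K.U a, p a, hp a⟩) l M G f)
    (H : Ambient 𝓕 K) (a : ℕ) : start K (f a) < f a ∧ G a (start K (f a)) ≠ 0 ∧
    row K G a (start K (f a)) = Node.left (K.U a) (start K (f a)) := by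
  obtain ⟨h1, h2⟩ : start K (f a) ∈ {x | x < f a ∧ K.R (f a) x ≠ 0} :=
    Nat.sInf_mem (h.exists_ne_zero H a)
  refine ⟨h1, by rwa [← h.R_eq h1], row_eq_left.2 ⟨rfl, fun x hx => ?_⟩⟩
  rw [← h.R_eq (hx.trans h1)]
  by_contra hne
  exact Nat.notMem_of_lt_sInf hx ⟨hx.trans h1, hne⟩

theorem start_eq (h : Construction C p (fun a => ⟨K.U a, p a, hp a⟩) l M G f)
    (H : Ambient 𝓕 K) {a x : ℕ} (hl : row K G a x = Node.left (K.U a) x)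
    (h0 : G a x ≠ 0) : start K (f a) = x := by
  obtain ⟨h1, h2, h3⟩ := h.start_spec H a
  rcases lt_trichotomy (start K (f a)) x with h4 | h4 | h4
  · exact absurd ((row_eq_left.1 hl).2 _ h4) h2
  · exact h4
  · exact absurd ((row_eq_left.1 h3).2 _ h4) h0

theorem start_free (h : Construction C p (fun a => ⟨K.U a, p a, hp a⟩) l M G f)
    (H : Ambient 𝓕 K) {a : ℕ} (hf : HasFree 𝓕 K (K.U a)) :
    start K (f a) = l ⟨K.U a, p a, hp a⟩ :=
  h.start_eq H (h.starts.row_left (h.starts.lt _).le fun _ => le_rfl) (h.starts.ne_zero hf)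

theorem mem_freeStart (h : Construction C p (fun a => ⟨K.U a, p a, hp a⟩) l M G f)
    (H : Ambient 𝓕 K) {a x : ℕ} (hx : x < M) (h0 : G a x ≠ 0) :
    x ∈ freeStart 𝓕 K (Set.range f) := by
  obtain ⟨hf, rfl⟩ := h.starts.zero a x hx h0
  exact ⟨f a, ⟨a, rfl⟩, by rwa [h.U_eq], h.exists_ne_zero H a, h.start_free H hf⟩

theorem not_ac (h : Construction C p (fun a => ⟨K.U a, p a, hp a⟩) l M G f)
    {x : ℕ} (hx : ∀ a, f a ≠ x) (hn : IsStage f n x) (hns : NoSplit K n G x)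
    (hsame : SameAge 𝓕 K n G x) : x ∉ AC 𝓕 K (Set.range f) := by
  rintro ⟨-, d, s, t, hs, ht, hne⟩
  rw [h.lev_eq hn] at hs
  rw [h.lev_eq (hn.succ hx)] at ht
  exact hne (age_eq_of_noSplit hns hsame hs ht)

theorem noSplit_of_not_sp (h : Construction C p (fun a => ⟨K.U a, p a, hp a⟩) l M G f)
    {x : ℕ} (hx : ∀ a, f a ≠ x) (hn : IsStage f n x)
    (hsp : x ∉ Sp K (Set.range f)) : NoSplit K n G x := by
  intro a ha b hb hab
  by_contra hne
  exact hsp ⟨_, h.isSplitNode_iff.2 ⟨a, b, lt_of_le_of_ne ((hn a).1 ha) (hx a).symm,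
    lt_of_le_of_ne ((hn b).1 hb) (hx b).symm, rfl, hab.symm, hne⟩⟩

theorem not_ac_of_lt (h : Construction C p (fun a => ⟨K.U a, p a, hp a⟩) l M G f)
    (H : Ambient 𝓕 K) {x : ℕ} (hx : x < M) : x ∉ AC 𝓕 K (Set.range f) := by
  intro hac
  have hne := h.ne_of_lt hx
  have hsp : x ∉ Sp K (Set.range f) := fun hs => hac.1 (.inr hs)
  have hn := h.isStage_zero hx.le
  exact h.not_ac hne hn (h.noSplit_of_not_sp hne hn hsp)
    (h.starts.sameAge H (fun _ => rfl) hx) hac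

theorem not_critPlus (h : Construction C p (fun a => ⟨K.U a, p a, hp a⟩) l M G f)
    (H : Ambient 𝓕 K) {x : ℕ} (hx : ∀ a, f a ≠ x) (hn : IsStage f n x)
    (hq : Quiet 𝓕 K n G x) : x ∉ CritPlus 𝓕 K (Set.range f) := by
  rintro (((⟨a, rfl⟩ | hsp) | hac) | ⟨_, ⟨a, rfl⟩, -, rfl⟩)
  · exact hx a rfl
  · exact h.not_sp_of_noSplit hn hq.1 hsp
  · exact h.not_ac hx hn hq.1 hq.2.2 hac
  · obtain ⟨h1, h2, h3⟩ := h.start_spec H a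
    exact h2 (hq.2.1 a ((hn a).2 h1.le) h3)

theorem weaklyDiagonal (h : Construction C p (fun a => ⟨K.U a, p a, hp a⟩) l M G f)
    (H : Ambient 𝓕 K) : WeaklyDiagonal 𝓕 K (Set.range f) where
  antichain := by
    rintro _ ⟨a, rfl⟩ _ ⟨b, rfl⟩ hab
    rw [h.node_eq hab.le, ← (h.coded a).code]
    exact (h.coded a).ne b (h.mono.lt_iff_lt.1 hab)
  split_not_code := by
    rw [Set.eq_empty_iff_forall_notMem]
    rintro _ ⟨h1, a, rfl⟩
    exact h.not_sp_coded a h1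
  split_unique := by
    intro m hm
    obtain ⟨hne, n, hn, -, X, s, q, hq, -, hXs, -, hXq, hX0, -⟩ := h.exists_goodSplit H hm
    obtain ⟨s', hs'⟩ := hm
    have huniq : ∀ s' : Node L m, IsSplitNode K (Set.range f) s' → s' = s := by
      intro s' hs'
      obtain ⟨a, b, ha, hb, h1, h2, h3⟩ := h.isSplitNode_iff.1 hs'
      have ha' := (hn a).2 ha.le
      have hb' := (hn b).2 hb.le
      by_cases haX : a ∈ X
      · rw [← h1, hXs a haX ha']
      · by_cases hbX : b ∈ X
        · rw [← h2, hXs b hbX hb']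
        · rw [hX0 a haX ha', hX0 b hbX hb'] at h3
          exact absurd rfl h3
    exact ⟨s', hs', fun s'' hs'' => (huniq s'' hs'').trans (huniq s' hs').symm⟩
  split_two := by
    intro m s' hs'
    obtain ⟨hne, n, hn, -, X, s, q, hq, ⟨a₀, ha₀, haX⟩, hXs, ⟨b₀, hb₀, hbX, hbs⟩, hXq, hX0, -⟩ :=
      h.exists_goodSplit H ⟨s', hs'⟩
    have hs : s' = s := by
      obtain ⟨a, b, ha, hb, h1, h2, h3⟩ := h.isSplitNode_iff.1 hs'
      have ha' := (hn a).2 ha.le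
      have hb' := (hn b).2 hb.le
      by_cases haX : a ∈ X
      · rw [← h1, hXs a haX ha']
      · by_cases hbX : b ∈ X
        · rw [← h2, hXs b hbX hb']
        · rw [hX0 a haX ha', hX0 b hbX hb'] at h3
          exact absurd rfl h3
    subst hs
    have : {q' | s'.snoc q' ∈ lev K (Set.range f) (m + 1)} = {0, q} := by
      rw [h.lev_eq (hn.succ hne)]
      ext q'
      constructor
      · rintro ⟨a, ha, h1⟩
        have h2 : G a m = q' := by
          have := (snoc_nd (K.U a) (G a) m).trans h1
          exact (snoc_inj.1 this).2
        by_cases haX : a ∈ X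
        · exact .inr (h2.symm.trans (hXq a haX ha))
        · exact .inl (h2.symm.trans (hX0 a haX ha))
      · rintro (rfl | rfl)
        · refine ⟨b₀, hb₀, ?_⟩
          rw [← hbs, ← hX0 b₀ hbX hb₀]
          exact (snoc_nd _ _ _).symm
        · refine ⟨a₀, ha₀, ?_⟩
          rw [← hXs a₀ haX ha₀, ← hXq a₀ haX ha₀]
          exact (snoc_nd _ _ _).symm
    rw [this, Set.ncard_pair hq.symm]
  split_left := by
    intro m hm t ht
    obtain ⟨hne, n, hn, -, X, s, q, hq, -, hXs, ⟨b₀, hb₀, hbX, hbs⟩, hXq, hX0, -⟩ :=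
      h.exists_goodSplit H hm
    rw [h.lev_eq hn] at ht
    rw [h.lev_eq (hn.succ hne)]
    have key : ∀ b, n ≤ b → b ∉ X → (row K G b m).snoc 0 ∈ rows K G n (m + 1) := by
      intro b hb hbX
      refine ⟨b, hb, ?_⟩
      rw [← hX0 b hbX hb]
      exact (snoc_nd _ _ _).symm
    obtain ⟨a, ha, rfl⟩ := ht
    by_cases haX : a ∈ X
    · rw [hXs a haX ha, ← hbs]
      exact key b₀ hb₀ hbX
    · exact key a ha haX
  hasStart := by
    rintro _ ⟨a, rfl⟩
    exact h.exists_ne_zero H a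
  freeStart_initial := by
    rintro x hx _ ⟨_, ⟨a, rfl⟩, hf, -, rfl⟩ hxa
    rw [h.U_eq] at hf
    rw [h.start_free H hf] at hxa
    -- Below `M` every non-zero entry is a free start, and a splitting or a start needs a non-zero
    -- entry.
    have hxM : x < M := hxa.trans_lt (h.starts.lt _)
    have hne := h.ne_of_lt hxM
    rcases hx with ((⟨b, rfl⟩ | hsp) | hac) | ⟨_, ⟨b, rfl⟩, -, rfl⟩
    · exact absurd rfl (hne b)
    · obtain ⟨s, hs⟩ := hsp
      obtain ⟨b, c, -, -, -, -, h3⟩ := h.isSplitNode_iff.1 hs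
      by_cases hb : G b x = 0
      · exact h.mem_freeStart H hxM (a := c) fun hc => h3 (hb.trans hc.symm)
      · exact h.mem_freeStart H hxM hb
    · exact absurd hac (h.not_ac_of_lt H hxM)
    · exact h.mem_freeStart H hxM (h.start_spec H b).2.1

theorem controlledPaths (h : Construction C p (fun a => ⟨K.U a, p a, hp a⟩) l M G f)
    (H : Ambient 𝓕 K) : ControlledPaths C (Set.range f) where
  maximal := by
    rintro _ ⟨a, rfl⟩
    rw [h.path_eq H, h.U_eq]
    exact hp a
  nonfree := by
    rintro _ ⟨a, rfl⟩ _ ⟨b, rfl⟩ hU hf hab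
    rw [h.U_eq, h.U_eq] at hU
    rw [h.U_eq] at hf
    rw [h.path_eq H, h.path_eq H]
    obtain ⟨a1, a2, a3⟩ := h.start_spec H a
    obtain ⟨b1, b2, b3⟩ := h.start_spec H b
    rw [← hab] at b1 b2 b3
    obtain ⟨x, hx⟩ : ∃ x, start K (f a) = x := ⟨_, rfl⟩
    rw [hx] at a1 a2 a3 b1 b2 b3
    by_cases hM : x < M
    · exact absurd (h.starts.zero a x hM a2).1 hf
    -- From `M` on, rows can start only on splitting levels, and the rows that leave a left branch
    -- together have the same path.
    by_cases hne : ∀ c, f c ≠ x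
    · obtain ⟨n, base, hn, -, -, h1 | h1 | h1⟩ := h.level x (not_lt.1 hM) hne
      · exact absurd (h1.2.1 a ((hn a).2 a1.le) a3) a2
      · exact absurd (h1.2.1 a ((hn a).2 a1.le) a3) a2
      · obtain ⟨X, s, q, hq, -, hXs, -, hXq, hX0, -, hXp⟩ := h1
        have ha := (hn a).2 a1.le
        have hb := (hn b).2 b1.le
        have haX : a ∈ X := by
          by_contra hc
          exact a2 (hX0 a hc ha)
        have hbX : b ∈ X := by
          by_contra hc
          exact b2 (hX0 b hc hb)
        refine hXp ?_ a haX ha b hbX hb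
        rw [← hXs a haX ha, a3]
        rfl
    · simp only [not_forall, not_not] at hne
      obtain ⟨c, rfl⟩ := hne
      exact absurd ((h.coded c).noStart a (h.mono.lt_iff_lt.1 a1) a3) a2
  free_order := by
    rintro _ ⟨a, rfl⟩ _ ⟨b, rfl⟩ hU hf P Q hP hP' hQ hQ'
    have hf' : HasFree 𝓕 K (K.U b) := by rwa [hU, h.U_eq] at hf
    rw [h.U_eq] at hf hP hQ
    rw [h.path_eq H] at hP' hQ'
    rw [h.start_free H hf, h.start_free H hf']
    obtain ⟨i, P, hPm⟩ := P
    obtain ⟨i', Q, hQm⟩ := Q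
    dsimp only at hP hP' hQ hQ'
    subst hP hP' hQ hQ'
    let _ := C.pathOrder
    have hmono : StrictMono l := fun x y => h.starts.mono x y
    exact hmono.le_iff_le
  free_start := by
    rintro _ ⟨a, rfl⟩ hf
    rw [h.U_eq] at hf
    have hs := h.start_free H hf
    have hlt := (h.start_spec H a).1
    rw [h.R_eq hlt, h.U_eq, hs]
    exact ⟨congrArg Node.u (h.starts.code _), h.starts.val a hf⟩
  free_zero := by
    rintro _ ⟨a, rfl⟩ _ ⟨b, rfl⟩ hU hf hne
    rw [h.U_eq] at hf
    rw [h.path_eq H, h.path_eq H] at hne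
    have hlt : l ⟨K.U a, p a, hp a⟩ < f b := (h.starts.lt _).trans_le (h.le b)
    rw [h.start_free H hf]
    refine ⟨hlt, ?_⟩
    rw [h.R_eq hlt]
    refine h.starts.eq_zero (h.starts.lt _) fun _ he => hne ?_
    exact congrArg MaxPath.path (h.starts.injective he)
  free_sorts := by
    rintro _ ⟨a, rfl⟩ _ ⟨b, rfl⟩ hf hf' hU
    rw [h.U_eq] at hf hf'
    rw [h.U_eq, h.U_eq] at hU
    rw [h.start_free H hf, h.start_free H hf']
    let _ := C.pathOrder
    refine h.starts.mono _ _ (lt_of_le_of_ne (C.pathOrder_spec _ _ hU) fun he => ?_)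
    exact hU.ne (congrArg MaxPath.sort he)

theorem controlledAC (h : Construction C p (fun a => ⟨K.U a, p a, hp a⟩) l M G f)
    (H : Ambient 𝓕 K) {m : ℕ} (hm : m ∈ AC 𝓕 K (Set.range f)) :
    ControlledAC C (Set.range f) m := by
  have hne : ∀ a, f a ≠ m := fun a ha => hm.1 (.inl ⟨a, ha⟩)
  have hsp : m ∉ Sp K (Set.range f) := fun hs => hm.1 (.inr hs)
  have hM : M ≤ m := not_lt.1 fun hM => h.not_ac_of_lt H hM hm
  obtain ⟨n, base, hn, hbase, -, h1 | h1 | h1⟩ := h.level m hM hne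
  · exact absurd hm (h.not_ac hne hn h1.1 h1.2.2)
  · obtain ⟨-, -, d, s, t, hs, ht, hcon, γ, hγ, φ, hφ, hmax, i, hi, hatt, hbi, hquiet⟩ := h1
    rw [← h.lev_eq hn] at hs
    rw [← h.lev_eq (hn.succ hne)] at ht
    refine ⟨d, s, t, hs, ht, hcon, γ, hγ, φ, hφ, hmax, i, hi, hatt, ?_⟩
    refine Set.Subset.antisymm ?_ ?_
    · rintro y ⟨hy, hiy, hym⟩
      rcases hym.lt_or_eq with h2 | h2
      -- From `base` to `m` the remaining rows are those from `n` on, so no point is coded strictly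
      -- before `m`.
      · have hy' := hbase y (hbi.trans hiy) hym
        refine absurd hy (h.not_critPlus H (fun a ha => ?_) hy' (hquiet y hiy h2))
        have h3 := (hn a).1 ((hy' a).2 ha.ge)
        omega
      · exact h2
    · rintro _ rfl
      exact ⟨.inl (.inr hm), hmax.2 hi.1, le_rfl⟩
  · exact absurd (h.noSplit_of_not_sp hne hn hsp) h1.not_noSplit

theorem controlledCoding (h : Construction C p (fun a => ⟨K.U a, p a, hp a⟩) l M G f)
    (n : ℕ) : ControlledCoding 𝓕 K (Set.range f) (f n) := by
  obtain ⟨d, r, j, hs, ht, hj, htri⟩ := (h.coded n).triple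
  refine ⟨d, tup K G r (f n), tup K G (fun α => r (j.succAbove α)) (f n + 1), j, ?_, ?_, ?_, htri⟩
  · rwa [h.lev_eq (h.isStage_self n)]
  · rwa [h.lev_eq (h.isStage_self_succ n)]
  · show row K G (r j) (f n) = _
    rw [hj]
    exact (h.coded n).code

theorem diagonal (h : Construction C p (fun a => ⟨K.U a, p a, hp a⟩) l M G f)
    (H : Ambient 𝓕 K) : Diagonal C (Set.range f) where
  weaklyDiagonal := h.weaklyDiagonal H
  controlledPaths := h.controlledPaths H
  controlledAC _ hm := h.controlledAC H hm
  controlledCoding := by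
    rintro _ ⟨n, rfl⟩
    exact h.controlledCoding n
  controlledSplitting := by
    intro m hm
    obtain ⟨hne, n, hn, hpath, hs⟩ := h.exists_goodSplit H hm
    refine H.controlledSplitting_of_goodSplit hp hs hpath
      (fun a ha => h.age_mem H a m ((hn a).1 ha)) (h.lev_eq hn)
      (h.lev_eq (hn.succ hne)) fun a ha b hb hab hG => ?_
    exact h.isSplitNode_iff.2 ⟨a, b, lt_of_le_of_ne ((hn a).1 ha) (hne a).symm,
      lt_of_le_of_ne ((hn b).1 hb) (hne b).symm, rfl, hab.symm, hG⟩

end Construction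

end CodingTree

/-! ### From the Fraïssé limit to the combinatorial hypotheses, and the conclusion. -/

namespace CodingTree

variable {L : BinLang} {𝓕 : Class L L.ku} {K : Str L L.ku ℕ}

/-! ### The theorem -/

theorem eq_of_toFO_eq {X : Type} {S T : Str L L.ku X} (h : S.toFO = T.toFO) : S = T := by
  have h1 : ∀ {n} (r : (lang L).Relations n) (v : Fin n → X),
      S.toFO.RelMap r v ↔ T.toFO.RelMap r v := fun r v => by rw [h]
  have hU : ∀ a, S.U a = T.U a := fun a =>
    (((h1 (n := 1) (RelSymb.un (S.U a)) fun _ => a).1 rfl : T.U a = S.U a)).symm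
  have hR : ∀ a b, S.R a b = T.R a b := fun a b => by
    by_cases hab : a = b
    · subst hab
      rw [S.R_self, T.R_self]
    · exact (((h1 (n := 2) (RelSymb.bin (S.R a b)) ![a, b]).1 ⟨hab, rfl⟩).2 :
        T.R a b = S.R a b).symm
  cases S
  cases T
  congr 1
  · exact funext hU
  · exact funext fun a => funext (hR a)

/-- A forbidden structure embedded in `K` would lie in the age of `K`, which is `Forb(𝓕)`, although
it embeds itself. -/
theorem omits_of_isFraisseLimitOf (h : IsFraisseLimitOf 𝓕 K) : Omits 𝓕 K := by
  rintro F hF ⟨g, hg⟩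
  let _ := K.toFO
  have hage : (lang L).age ℕ = forbClass 𝓕 := (show FirstOrder.Language.IsFraisseLimit (forbClass 𝓕) ℕ from h).age
  have hmem : (⟨F.carrier, F.str.toFO⟩ : CategoryTheory.Bundled.{0} (lang L).Structure) ∈
      (lang L).age ℕ := by
    let _ := F.str.toFO
    have := F.finite
    refine ⟨FirstOrder.Language.Structure.FG.of_finite, ⟨⟨⟨g, hg.1⟩, fun f => Empty.elim f, fun r v => ?_⟩⟩⟩
    cases r with
    | un i =>
      show K.U (g (v 0)) = i ↔ F.str.U (v 0) = i
      rw [hg.2.1]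
    | bin q =>
      show (g (v 0) ≠ g (v 1) ∧ K.R (g (v 0)) (g (v 1)) = q) ↔ (v 0 ≠ v 1 ∧ F.str.R (v 0) (v 1) = q)
      rw [hg.2.2, hg.1.ne_iff]
  rw [hage] at hmem
  obtain ⟨-, S, hS, hom⟩ := hmem
  rw [eq_of_toFO_eq hS] at hom
  exact hom F hF ⟨id, Function.injective_id, fun _ => rfl, fun _ _ => rfl⟩

end CodingTree

theorem mainTheorem4 (L : CodingTree.BinLang)
    (𝓕 : CodingTree.Class L L.ku) (h_fin : 𝓕.Finite)
    (h_irr : ∀ F ∈ 𝓕, F.str.Irreducible)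
    (h_two : ∀ F ∈ 𝓕, 2 ≤ Nat.card F.carrier)
    (h_nondeg : ∀ i : Fin L.ku, CodingTree.NonDegenerate 𝓕 i)
    (K : CodingTree.Str L L.ku ℕ)
    (h_lim : CodingTree.IsFraisseLimitOf 𝓕 K)
    (h_dense : CodingTree.LeftDense 𝓕 K)
    (C : CodingTree.Choices 𝓕 K) :
    ∃ f : ℕ → ℕ, K.IsOEmb K f ∧ CodingTree.Diagonal C (Set.range f) := by
  have H : CodingTree.Ambient 𝓕 K :=
    ⟨h_fin, h_irr, h_two, h_nondeg, CodingTree.omits_of_isFraisseLimitOf h_lim, h_dense⟩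
  -- The paths of the images are fixed here; containing `Path 𝓕 K a` ensures that the ages of `K` to
  -- be imitated lie on them.
  choose p hp hpath using H.exists_maxPath
  obtain ⟨l, M, G, f, h⟩ := H.exists_construction C hp hpath
  exact ⟨f, h.isOEmb, h.diagonal H⟩
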